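/- **Setting.** Let $\Omega\subset\mathbb R^2$ be bounded and open, split (up to a null set) into disjoint open sets $\Omega^+,\Omega^-$. Let $\sigma$ be measurable with $\sigma>0$ on $\Omega^+$, $\sigma<0$ on $\Omega^-$, $\sigma,\sigma^{-1}\in L^\infty(\Omega)$, let $c=\kappa\sigma$ with a constant $\kappa>0$, and let $k>0$. Put $V=H^1_0(\Omega)$, $\mathcal B(u,v)=\int_\Omega\sigma\nabla u\cdot\nabla v-k^2\int_\Omega c\,uv$, $\|v\|_{\tilde a}^2=\int_\Omega|\sigma||\nabla v|^2$, $\Upsilon=\operatorname{ess\,inf}_{\Omega^+}\sigma/\operatorname{ess\,sup}_{\Omega^-}|\sigma|$. Assume that $\mathcal B(u,\cdot)=0$ on $V$ only for $u=0$. For $X\subset V$ write $\beta(X)=\inf_{u\in X\setminus\{0\}}\sup_{w\in X\setminus\{0\}}\frac{\mathcal B(u,w)}{\|u\|_{\tilde a}\|w\|_{\tilde a}}$. Let $R$ be a linear map from $V|_{\Omega^+}$ to $V|_{\Omega^-}$ such that, for every $v\in V$, the function equal to $v$ in $\Omega^+$ and to $R(v|_{\Omega^+})$ in $\Omega^-$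 belongs to $V$ (the traces on the interface agree), with $\|Rw\|_{L^2(\Omega^-)}\le R_0\|w\|_{L^2(\Omega^+)}$ and $\|\nabla Rw\|_{L^2(\Omega^-)}\le R_1\|\nabla w\|_{L^2(\Omega^+)}$. Let $\mathcal Tv=v$ in $\Omega^+$, $\mathcal Tv=-v+2R(v|_{\Omega^+})$ in $\Omega^-$, and $C_1=\max\{(1+8R_0^2/\Upsilon)^{1/2},\sqrt2\}$. Let $K_1,\dots,K_N$ be disjoint open convex quadrilaterals in $\Omega$ that cover $\Omega$ up to a null set, each contained in $\Omega^+$ or in $\Omega^-$. Let $H=\max_i\operatorname{diam}K_i\le\rho\operatorname{diam}K_i$ for all $i$, let $\mu_{\rm msh}>0$, $\mu=\mu_{\rm msh}\operatorname{diam}(K_i)^{-2}c$ on $K_i$, $s(v,w)=\int_\Omega\mu vw$, $\|v\|_{\tilde s}^2=\int_\Omega|\mu|v^2$. Let $\lambda_i^1\le\lambda_i^2\le\cdots$ be the eigenvalues, counted with multiplicity, of $\int_{K_i}|\sigma|\nabla v\cdot\nabla w=\lambda\int_{K_i}|\mu|vw$ for all $w\in H^1(K_i)$, let $\psi_i^1,\dots,\psi_i^{l}$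 be orthonormal (for $\int_{K_i}|\mu|vw$) eigenvectors for $\lambda_i^1,\dots,\lambda_i^{l}$, extended by zero, $V^{\rm aux}$ their span over all $i$, $\pi$ the projection onto $V^{\rm aux}$ orthogonal for $\|\cdot\|_{\tilde s}$, $\Lambda=\min_i\lambda_i^{l+1}$, $\tilde V=\{v\in V:\pi v=0\}$. Let $C_{\rm po}$ be the best constant in $\|v\|_{\tilde s}\le C_{\rm po}H^{-1}\|v\|_{\tilde a}$, $v\in V$, and let $\bar C_{\rm inv}$ be a bound for the best constant (infimum of the admissible constants) $C$ such that for every $i$ each $\psi\in\operatorname{span}\{\psi_i^j\}_j$ has a $w\in V$ vanishing outside $K_i$ with $\pi w=\psi$ and $\|w\|_{\tilde a}\le C\|\psi\|_{\tilde s}$. Let the patches $\hat K_i^m$, $m\ge1$, be unions of coarse elements with $K_i\subset\hat K_i^1\subset\hat K_i^2\subset\cdots$ and $\operatorname{dist}(\hat K_i^m,\Omega\setminus\hat K_i^{m+1})\ge C_{\rm msh}H$, where $C_{\rm msh}>0$, such that $\mathcal T$ preserves the property of vanishing a.e. outside $\hat K_i^m$ and that of vanishing a.e. in $\hat K_i^m$,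 and such that each coarse element lies in at most $C_{\rm ol}m^2$ of the patches $\hat K_i^m$. Let $\mu_{\rm msh}$ be such that $\kappa\mu_{\rm msh}C_{\rm msh}^2\ge1$. Let $\hat V_i^m=H^1_0(\hat K_i^m)$ be the space of the functions of $V$ that vanish outside $\hat K_i^m$. The basis functions $\phi_i^j\in V$ and $\phi_{i,m}^j\in\hat V_i^m$ are the solutions of $$\mathcal B(\phi,w)+s(\pi\phi,\pi w)=s(\psi_i^j,\pi w)$$ for all $w\in V$, respectively for all $w\in\hat V_i^m$. Let $V_{\rm glo}=\operatorname{span}\{\phi_i^j\}$ and $V_{\rm ms}=\operatorname{span}\{\phi_{i,m}^j\}$. **Cea's Lemma.** For all $R_0,R_1\ge0$, $C_{\rm msh}>0$, $\rho$, $C_{\rm ol}$, $\bar C_{\rm inv}$ and $q<1$ there are $\Upsilon'>0$, $C_{\rm loc}>0$ and $\theta\in(0,1)$, depending only on these numbers, such that the following holds in every such setting with $\Upsilon\ge\Upsilon'$, $\Lambda\ge1$ and with a constant $C_*>0$ for which $C_*\Lambda\le q$ and the resolution condition $C_1\mu_{\rm msh}^{-1}k^2H^2\le C_*\Lambda$ holds.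 Put $$\alpha=C_1+C_*\bigl(1+C_{\rm po}H^{-1}\sqrt\Lambda\bigr),\qquad \eta=C_{\rm loc}\,(1+C_{\rm po}H^{-1})^3\,(m+1)\,\theta^{(m-1)/2}.$$ 1. All the $\phi_i^j$ and $\phi_{i,m}^j$ ($m\ge1$) exist and are unique. 2. There is a $\beta_{\rm glo}>0$ with $\beta(\tilde V)\ge\beta_{\rm glo}$ and $\beta(V_{\rm glo})\ge\beta_{\rm glo}$. 3. Let $\beta_{\rm glo}$ be any number with $\beta(\tilde V)\ge\beta_{\rm glo}$ and $\beta(V_{\rm glo})\ge\beta_{\rm glo}$, and let $m\ge1$ be such that $\beta_{\rm cem}:=\beta_{\rm glo}/4-9\alpha\eta/4-3\alpha\eta/2>0$. Then $$\inf_{u\in V_{\rm ms}\setminus\{0\}}\ \sup_{v\in V_{\rm ms}\setminus\{0\}}\frac{\mathcal B(u,v)}{\|u\|_{\tilde a}\|v\|_{\tilde a}}\ \ge\ \beta_{\rm cem}.$$ Moreover, for every $f\in L^2(\Omega)$ there is exactly one $u_{\rm ms}\in V_{\rm ms}$ with $\mathcal B(u_{\rm ms},w)=(f,w)$ for all $w\in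 V_{\rm ms}$, and if $u\in V$ satisfies $\mathcal B(u,v)=(f,v)$ for all $v\in V$, then $$\|u-u_{\rm ms}\|_{\tilde a}\le\frac{\alpha}{\beta_{\rm cem}}\,\|u-v_{\rm ms}\|_{\tilde a}\qquad\text{for every }v_{\rm ms}\in V_{\rm ms}.$$ -/

import Mathlib

open MeasureTheory
open scoped ENNReal

noncomputable section

namespace SignChanging

/-- The Euclidean plane. -/
abbrev E2 : Type := EuclideanSpace ℝ (Fin 2)

/-- Pairs `(v, g)` with `v ∈ L²(μ)` and `g ∈ L²(μ; ℝ²)`: the Hilbert space in which Sobolev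
functions are represented together with their weak gradients. -/
abbrev L2Pair (μ : Measure E2) : Type := WithLp 2 (Lp ℝ 2 μ × Lp E2 2 μ)

/-- `(v, g)` represents an element of `H¹(K)`: `g` is the weak gradient of `v` in `K`. -/
def MemH1 (K : Set E2) (x : L2Pair (volume.restrict K)) : Prop :=
  ∀ φ : E2 → ℝ, ContDiff ℝ (⊤ : ℕ∞) φ → HasCompactSupport φ → tsupport φ ⊆ K →
    ∀ e : E2, ∫ p in K, x.fst p * fderiv ℝ φ p e = - ∫ p in K, inner ℝ (x.snd p) e * φ p

/-- `H¹₀(Ω)`: the closure in the `H¹` norm of the test functions `C_c^∞(Ω)` (each extended by zero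
to the plane and paired with its gradient). -/
def H10 (Ω : Set E2) : Submodule ℝ (L2Pair volume) :=
  (Submodule.span ℝ {x : L2Pair volume | ∃ φ : E2 → ℝ,
    ContDiff ℝ (⊤ : ℕ∞) φ ∧ HasCompactSupport φ ∧ tsupport φ ⊆ Ω ∧
    x.fst =ᵐ[volume] φ ∧ x.snd =ᵐ[volume] gradient φ}).topologicalClosure

/-- The data of the Helmholtz-like equation `-∇·(σ∇u) - k² c u = f` in `Ω`, `u = 0` on `∂Ω`, with
sign-changing coefficients: `σ > 0` in `Ωp`, `σ < 0` in `Ωm`, the functions `σ`, `σ⁻¹` are bounded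
and `c = κ σ` with a constant `κ > 0`. -/
structure Problem where
  Ω : Set E2
  Ωp : Set E2
  Ωm : Set E2
  isOpen_Ω : IsOpen Ω
  bounded_Ω : Bornology.IsBounded Ω
  isOpen_Ωp : IsOpen Ωp
  isOpen_Ωm : IsOpen Ωm
  Ωp_subset : Ωp ⊆ Ω
  Ωm_subset : Ωm ⊆ Ω
  disjoint_pm : Disjoint Ωp Ωm
  cover_pm : volume (Ω \ (Ωp ∪ Ωm)) = 0
  σ : E2 → ℝ
  c : E2 → ℝ
  κ : ℝ
  k : ℝ
  measurable_σ : Measurable σ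
  measurable_c : Measurable c
  σ_pos : ∀ᵐ p ∂volume.restrict Ωp, 0 < σ p
  σ_neg : ∀ᵐ p ∂volume.restrict Ωm, σ p < 0
  σ_bounds : ∃ lo hi : ℝ, 0 < lo ∧ ∀ᵐ p ∂volume.restrict Ω, lo ≤ |σ p| ∧ |σ p| ≤ hi
  κ_pos : 0 < κ
  c_eq : ∀ᵐ p ∂volume.restrict Ω, c p = κ * σ p
  k_pos : 0 < k

namespace Problem

variable (P : Problem)

/-- The energy space `V = H¹₀(Ω)`. -/
abbrev V : Submodule ℝ (L2Pair volume) := H10 P.Ω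

/-- The function underlying an element of `V`. -/
def val (u : P.V) : E2 → ℝ := (u : L2Pair volume).fst

/-- The weak gradient of an element of `V`. -/
def grad (u : P.V) : E2 → E2 := (u : L2Pair volume).snd

/-- `𝓑(u, v) = ∫_Ω σ ∇u · ∇v - k² ∫_Ω c u v`. -/
def form (u v : P.V) : ℝ :=
  (∫ p in P.Ω, P.σ p * inner ℝ (P.grad u p) (P.grad v p))
    - P.k ^ 2 * ∫ p in P.Ω, P.c p * P.val u p * P.val v p

/-- `‖v‖_ã = (∫_Ω |σ| |∇v|²)^{1/2}`. -/
def normA (v : P.V) : ℝ := √(∫ p in P.Ω, |P.σ p| * ‖P.grad v p‖ ^ 2)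

/-- The contrast `Υ = σ⁺_min / σ⁻_max`. -/
def contrast : ℝ :=
  essInf P.σ (volume.restrict P.Ωp) / essSup (fun p => |P.σ p|) (volume.restrict P.Ωm)

/-- `u ∈ V` is a solution of `𝓑(u, v) = (f, v)` for all `v ∈ V`. -/
def IsSolution (f : E2 → ℝ) (u : P.V) : Prop :=
  ∀ v : P.V, P.form u v = ∫ p in P.Ω, f p * P.val v p

/-- The variational problem is well-posed: zero data only admit the zero solution. -/
def WellPosed : Prop := ∀ u : P.V, (∀ v : P.V, P.form u v = 0) → u = 0

/-- `inf_{u ∈ X} sup_{w ∈ X} 𝓑(u, w) / (‖u‖_ã ‖w‖_ã)`, over nonzero `u` and `w`. -/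
def infSup (X : Set P.V) : EReal :=
  ⨅ u : {u : P.V // u ∈ X ∧ u ≠ 0}, ⨆ w : {w : P.V // w ∈ X ∧ w ≠ 0},
    ((P.form u.1 w.1 / (P.normA u.1 * P.normA w.1) : ℝ) : EReal)

end Problem

/-- The map `R : V⁺ → V⁻` with `R w = w` on the interface, given through
`ext v = (v in Ωp, R (v|_{Ωp}) in Ωm)`. That this glued function belongs to `V = H¹₀(Ω)` is the
equality of the traces on the interface; `R₀` and `R₁` bound `R` in `L²` and in the `H¹` seminorm
(in particular `ext v` only depends on `v|_{Ωp}`). -/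
structure Reflection (P : Problem) (R₀ R₁ : ℝ) where
  ext : P.V →ₗ[ℝ] P.V
  ext_eq : ∀ v : P.V, ∀ᵐ p ∂volume.restrict P.Ωp, P.val (ext v) p = P.val v p
  bound_zero : ∀ v : P.V,
    √(∫ p in P.Ωm, P.val (ext v) p ^ 2) ≤ R₀ * √(∫ p in P.Ωp, P.val v p ^ 2)
  bound_one : ∀ v : P.V,
    √(∫ p in P.Ωm, ‖P.grad (ext v) p‖ ^ 2) ≤ R₁ * √(∫ p in P.Ωp, ‖P.grad v p‖ ^ 2)

namespace Reflection

variable {P : Problem} {R₀ R₁ : ℝ} (R : Reflection P R₀ R₁)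

/-- The operator `𝒯`: `𝒯 v = v` in `Ωp` and `𝒯 v = -v + 2 R (v|_{Ωp})` in `Ωm`. As `ext v = v` in
`Ωp`, both cases read `-v + 2 ext v`. -/
def T (v : P.V) : P.V := -v + (2 : ℝ) • R.ext v

end Reflection

/-- The constant `C₁ = max {(1 + 8 R₀² / Υ)^{1/2}, √2}`. -/
def constOne (R₀ Υ : ℝ) : ℝ := max (√(1 + 8 * R₀ ^ 2 / Υ)) (√2)

/-- A coarse mesh of `Ω`: finitely many disjoint (open, convex) quadrilaterals that cover `Ω` up to
a null set, each of them on one side of the interface, and the mesh parameter `μ_msh`. -/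
structure CoarseMesh (P : Problem) where
  N : ℕ
  vertices : Fin N → Fin 4 → E2
  elem : Fin N → Set E2
  elem_eq : ∀ i, elem i = interior (convexHull ℝ (Set.range (vertices i)))
  elem_nonempty : ∀ i, (elem i).Nonempty
  elem_subset : ∀ i, elem i ⊆ P.Ω
  elem_disjoint : Pairwise fun i j => Disjoint (elem i) (elem j)
  elem_cover : volume (P.Ω \ ⋃ i, elem i) = 0
  elem_side : ∀ i, elem i ⊆ P.Ωp ∨ elem i ⊆ P.Ωm
  μmsh : ℝ
  μmsh_pos : 0 < μmsh

namespace CoarseMesh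

variable {P : Problem} (M : CoarseMesh P)

/-- The mesh size `H = max_i diam K_i`. -/
def size : ℝ := ⨆ i, Metric.diam (M.elem i)

/-- The weight `μ`, equal to `μ_msh diam(K_i)⁻² c` in `K_i`. -/
def weight (p : E2) : ℝ :=
  ∑ i, (M.elem i).indicator (fun q => M.μmsh * (Metric.diam (M.elem i))⁻¹ ^ 2 * P.c q) p

/-- `s(v, w) = ∫_Ω μ v w`. -/
def sForm (v w : E2 → ℝ) : ℝ := ∫ p in P.Ω, M.weight p * v p * w p

/-- `‖v‖_s̃ = (∫_Ω |μ| v²)^{1/2}`. -/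
def normS (v : E2 → ℝ) : ℝ := √(∫ p in P.Ω, |M.weight p| * v p ^ 2)

/-- `∫_{K_i} |σ| ∇v · ∇w` for `v, w ∈ H¹(K_i)`. -/
def localA (i : Fin M.N) (v w : L2Pair (volume.restrict (M.elem i))) : ℝ :=
  ∫ p in M.elem i, |P.σ p| * inner ℝ (v.snd p) (w.snd p)

/-- `∫_{K_i} μ_msh diam(K_i)⁻² |c| v w`. -/
def localS (i : Fin M.N) (v w : E2 → ℝ) : ℝ :=
  ∫ p in M.elem i, M.μmsh * (Metric.diam (M.elem i))⁻¹ ^ 2 * |P.c p| * v p * w p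

/-- The `j`-th smallest eigenvalue (`j = 1, 2, …`, counted with multiplicity) of the problem
`∫_{K_i} |σ| ∇v · ∇w = λ ∫_{K_i} μ_msh diam(K_i)⁻² |c| v w` for all `w ∈ H¹(K_i)`, in the
Courant-Fischer form: the infimum, over the `j`-dimensional subspaces `W` of `H¹(K_i)`, of the
largest value of the Rayleigh quotient in `W`. -/
def eigenvalue (i : Fin M.N) (j : ℕ) : ℝ :=
  sInf {t : ℝ | ∃ W : Submodule ℝ (L2Pair (volume.restrict (M.elem i))),
    Module.finrank ℝ W = j ∧
    ∀ v ∈ W, MemH1 (M.elem i) v ∧ M.localA i v v ≤ t * M.localS i v.fst v.fst}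

/-- `Λ = min_i λ_i^{l+1}`. -/
def gap (l : ℕ) : ℝ := ⨅ i, M.eigenvalue i (l + 1)

/-- The (best) Poincaré constant `C_po` in `‖v‖_s̃ ≤ C_po H⁻¹ ‖v‖_ã` for all `v ∈ V`. -/
def poincareConst : ℝ :=
  sInf {C : ℝ | 0 ≤ C ∧ ∀ v : P.V, M.normS (P.val v) ≤ C * M.size⁻¹ * P.normA v}

/-- All elements have a diameter comparable to the mesh size. -/
def QuasiUniform (ρ : ℝ) : Prop := ∀ i, M.size ≤ ρ * Metric.diam (M.elem i)

/-- The constant `α = C₁ + C_* (1 + C_po H⁻¹ √Λ)`. -/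
def alpha (C₁ Cstar : ℝ) (l : ℕ) : ℝ :=
  C₁ + Cstar * (1 + M.poincareConst * M.size⁻¹ * √(M.gap l))

end CoarseMesh

/-- The `l` leading eigenvectors `ψ_i^1, …, ψ_i^l` on every coarse element, normalized to be
orthonormal for `∫_{K_i} |μ| v w` (`ψ i j` has the index `j + 1`). -/
structure AuxBasis {P : Problem} (M : CoarseMesh P) (l : ℕ) where
  ψ : (i : Fin M.N) → Fin l → L2Pair (volume.restrict (M.elem i))
  memH1 : ∀ i j, MemH1 (M.elem i) (ψ i j)
  orthonormal : ∀ i j j', M.localS i (ψ i j).fst (ψ i j').fst = if j = j' then 1 else 0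
  eigen : ∀ i j, ∀ w, MemH1 (M.elem i) w →
    M.localA i (ψ i j) w = M.eigenvalue i (j + 1) * M.localS i (ψ i j).fst w.fst

namespace AuxBasis

variable {P : Problem} {M : CoarseMesh P} {l : ℕ} (A : AuxBasis M l)

/-- `ψ_i^j`, extended by zero. -/
def fn (i : Fin M.N) (j : Fin l) : E2 → ℝ := (M.elem i).indicator (A.ψ i j).fst

/-- The projection `π` onto `V^aux = span {ψ_i^j}`, orthogonal for `∫_Ω |μ| v w`. -/
def proj (v : E2 → ℝ) : E2 → ℝ := fun p =>
  ∑ i, ∑ j, M.localS i v (A.fn i j) * A.fn i j p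

/-- `Ṽ = {v ∈ V | π v = 0}`. -/
def kernel : Set P.V := {v | A.proj (P.val v) =ᵐ[volume.restrict P.Ω] 0}

/-- `φ` solves `𝓑(φ, w) + s(π φ, π w) = s(ψ_i^j, π w)` for all `w ∈ X`. -/
def Solves (X : Set P.V) (i : Fin M.N) (j : Fin l) (φ : P.V) : Prop :=
  ∀ w ∈ X, P.form φ w + M.sForm (A.proj (P.val φ)) (A.proj (P.val w))
    = M.sForm (A.fn i j) (A.proj (P.val w))

/-- `φ ∈ V` is the global multiscale basis function `φ_i^j`. -/
def IsGlobalBasis (i : Fin M.N) (j : Fin l) (φ : P.V) : Prop := A.Solves Set.univ i j φ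

/-- `V_glo = span {φ_i^j}`. -/
def Vglo : Submodule ℝ P.V := Submodule.span ℝ {φ | ∃ i j, A.IsGlobalBasis i j φ}

/-- The (best) constant `C_inv` of the local liftings: every `ψ ∈ V_i^aux` has liftings
`w ∈ H¹₀(K_i)` with `π w = ψ` and `‖w‖_ã ≤ C ‖ψ‖_s̃`, for all `C > C_inv`. -/
def inverseConst : ℝ :=
  sInf {C : ℝ | 0 ≤ C ∧ ∀ (i : Fin M.N) (b : Fin l → ℝ), ∃ w : P.V,
    (∀ᵐ p ∂volume.restrict (P.Ω \ M.elem i), P.val w p = 0) ∧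
    A.proj (P.val w) =ᵐ[volume.restrict P.Ω] (fun p => ∑ j, b j * A.fn i j p) ∧
    P.normA w ≤ C * M.normS (fun p => ∑ j, b j * A.fn i j p)}

end AuxBasis

/-- Oversampling patches `K̂_i^m` (`m ≥ 1`), each a union of coarse elements: `patch i m` is the set
of the indices of these elements. -/
structure Patches {P : Problem} (M : CoarseMesh P) where
  patch : Fin M.N → ℕ → Finset (Fin M.N)

namespace Patches

variable {P : Problem} {M : CoarseMesh P} (Q : Patches M)

/-- `v` vanishes almost everywhere in the coarse elements with indices in `I`. -/
def VanishesOn (M : CoarseMesh P) (I : Set (Fin M.N)) (v : P.V) : Prop :=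
  ∀ j ∈ I, ∀ᵐ p ∂volume.restrict (M.elem j), P.val v p = 0

/-- The patches are increasing, `K_i ⊆ K̂_i^1 ⊆ K̂_i^2 ⊆ …`, with
`dist (K̂_i^m, Ω \ K̂_i^{m+1}) ≥ C_msh H`, and `𝒯` preserves the property of being supported in the
closure of `K̂_i^m`, and that of being supported in the closure of `Ω \ K̂_i^m`. -/
structure Admissible {R₀ R₁ : ℝ} (R : Reflection P R₀ R₁) (Cmsh : ℝ) : Prop where
  self_mem : ∀ i, i ∈ Q.patch i 1
  mono : ∀ i m, 1 ≤ m → Q.patch i m ⊆ Q.patch i (m + 1)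
  dist_le : ∀ i m, 1 ≤ m → ∀ j ∈ Q.patch i m, ∀ j' ∉ Q.patch i (m + 1),
    ∀ x ∈ M.elem j, ∀ y ∈ M.elem j', Cmsh * M.size ≤ dist x y
  T_inside : ∀ i m, 1 ≤ m → ∀ v : P.V,
    VanishesOn M {j | j ∉ Q.patch i m} v → VanishesOn M {j | j ∉ Q.patch i m} (R.T v)
  T_outside : ∀ i m, 1 ≤ m → ∀ v : P.V,
    VanishesOn M {j | j ∈ Q.patch i m} v → VanishesOn M {j | j ∈ Q.patch i m} (R.T v)

/-- Every coarse element belongs to at most `C_ol m²` of the patches `K̂_i^m`. -/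
def Overlap (Col : ℝ) : Prop :=
  ∀ (j : Fin M.N) (m : ℕ), 1 ≤ m →
    ((Finset.univ.filter fun i => j ∈ Q.patch i m).card : ℝ) ≤ Col * (m : ℝ) ^ 2

/-- `V̂_i^m = H¹₀(K̂_i^m)`, identified with the functions of `V` that vanish outside `K̂_i^m`. -/
def localSpace (i : Fin M.N) (m : ℕ) : Set P.V :=
  {v | VanishesOn M {j | j ∉ Q.patch i m} v}

variable {l : ℕ}

/-- `φ ∈ V̂_i^m` is the localized multiscale basis function `φ_{i,m}^j`. -/
def IsLocalBasis (A : AuxBasis M l) (m : ℕ) (i : Fin M.N) (j : Fin l) (φ : P.V) : Prop :=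
  φ ∈ Q.localSpace i m ∧ A.Solves (Q.localSpace i m) i j φ

/-- `V_ms = span {φ_{i,m}^j}`. -/
def Vms (A : AuxBasis M l) (m : ℕ) : Submodule ℝ P.V :=
  Submodule.span ℝ {φ | ∃ i j, Q.IsLocalBasis A m i j φ}

/-- `u ∈ V_ms` is a solution of the multiscale problem `𝓑(u, w) = (f, w)` for all `w ∈ V_ms`. -/
def IsMsSolution (A : AuxBasis M l) (m : ℕ) (f : E2 → ℝ) (u : P.V) : Prop :=
  u ∈ Q.Vms A m ∧ ∀ w ∈ Q.Vms A m, P.form u w = ∫ p in P.Ω, f p * P.val w p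

end Patches

/-- The localization error `η = C (1 + C_po H⁻¹)³ (m + 1) θ^{(m-1)/2}`. -/
def locError {P : Problem} (M : CoarseMesh P) (C θ : ℝ) (m : ℕ) : ℝ :=
  C * (1 + M.poincareConst * M.size⁻¹) ^ 3 * ((m : ℝ) + 1) * θ ^ (((m : ℝ) - 1) / 2)

end SignChanging

end

/-!
# Quasi-optimality of a multiscale method for a sign-changing Helmholtz problem

The form `𝓑` is indefinite, for two reasons: the coefficient `σ` changes its sign across the
interface, and the lower order term carries the opposite sign. The reflection `𝒯` is an involution
that undoes the first defect up to cross terms in `Ω⁻`, and these are small when the contrast is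
large. The stabilization `s(π u, π w)` undoes the second one: since `Λ ≥ 1`, the part of the weighted
`L²` norm that `π` does not see is bounded by the energy, and the lower order term is at most `q < 1`
times that norm. Hence the stabilized form `bp = 𝓑 + s(π ·, π ·)` satisfies
`bp u (𝒯 u) ≥ (1 - q) / 4 * nE u ^ 2` with the full energy norm `nE`
(`LocalizedSystem.coercive`). Every closed subspace that `𝒯` maps into itself, in particular each
space on a patch, therefore admits the Lax-Milgram theorem (`existsUnique_solution`), and this gives
the basis functions. The spectral inequalities behind the role of `π` follow from the Courant-Fischer
description of the eigenvalues (`eigenvalue_le`, `spectral_gap`).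

A global basis function solves a homogeneous equation away from its element. Testing it with the
reflection of its product with a cutoff function bounds the energy outside a patch by that in one
layer (`cutoff_energy_le`), so it decays by a fixed factor per layer (`out_decay`), and Céa's lemma on
the patch turns this into an estimate for the localized function (`localization_error`). The errors of
different elements interact only through neighbouring patches, which overlap boundedly
(`nE_comb_sub_sq_le`). The coefficients of a combination are bounded by its energy, by testing with
local liftings (`IsGlo.sum_sq_le`), so the map from global to localized combinations is close to the
identity relative to the energy (`nE_comb_sub_le`).

On `ker π` the forms `bp` and `𝓑` agree. The reflection of a function of `ker π` leaves this space by
a small amount only, which a lifting corrects, so `𝓑` satisfies an inf-sup condition there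
(`infSup_ker`). The space `V` is the sum of `ker π` and `V_glo`, orthogonal to each other for `𝓑`
(`IsGlo.exists_decomp`). By well-posedness, `𝓑` is thus nondegenerate on the finite-dimensional space
`V_glo` and satisfies an inf-sup condition there too (`IsGlo.exists_infSup_range`). The closeness of
the localized functions transfers it to `V_ms` (`infSup_range_of_close`). For the quasi-optimality
(`cea_of_close`) the error is split along `ker π` and `V_glo`: the second part is small because the
error is orthogonal to `V_ms`, and on the first part the gap improves the bound of `𝓑` to `α`
(`abs_b_le_of_mem_ker`).

All of this takes place in an abstract `LocalizedSystem`, a sum of element contributions to bilinear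
forms with a projection, an extension and patches. The problem on the mesh is such a system
(`Setting.system`) through the Poincaré inequality (`poincare`), the locality of weak gradients
(`snd_ae_zero_of_fst`), smooth cutoff functions (`exists_smooth_cutoff`, `exists_mul`), the bound of
the extension by the contrast (`sum_neg_le_contrast`), and the existence of local liftings, which is a
consequence of the fundamental lemma of the calculus of variations (`eq_zero_of_test`).
-/


namespace SignChanging

/-! ### Nonnegative symmetric bilinear forms -/

section SemiForm

variable {V : Type*} [AddCommGroup V] [Module ℝ V] {f : LinearMap.BilinForm ℝ V}

theorem abs_le_sqrt_mul_sqrt (hs : ∀ u w, f u w = f w u) (hf : ∀ u, 0 ≤ f u u) (u w : V) :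
    |f u w| ≤ √(f u u) * √(f w w) := by
  rw [← Real.sqrt_mul (hf u), ← Real.sqrt_sq_eq_abs]
  refine Real.sqrt_le_sqrt ?_
  have := LinearMap.BilinForm.apply_mul_apply_le_of_forall_zero_le f hf u w
  rw [hs w u] at this
  nlinarith [this]

theorem sqrt_form_add_le (hs : ∀ u w, f u w = f w u) (hf : ∀ u, 0 ≤ f u u) (u w : V) :
    √(f (u + w) (u + w)) ≤ √(f u u) + √(f w w) := by
  have h := (abs_le.1 (abs_le_sqrt_mul_sqrt hs hf u w)).2
  refine Real.sqrt_le_iff.2 ⟨by positivity, ?_⟩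
  have e : f (u + w) (u + w) = f u u + 2 * f u w + f w w := by
    simp only [map_add, LinearMap.add_apply]; rw [hs w u]; ring
  rw [e]
  nlinarith [Real.sq_sqrt (hf u), Real.sq_sqrt (hf w)]

theorem sqrt_form_neg (u : V) : √(f (-u) (-u)) = √(f u u) := by simp

theorem sqrt_form_sub_le (hs : ∀ u w, f u w = f w u) (hf : ∀ u, 0 ≤ f u u) (u w : V) :
    √(f (u - w) (u - w)) ≤ √(f u u) + √(f w w) := by
  rw [sub_eq_add_neg]
  refine (sqrt_form_add_le hs hf u (-w)).trans (le_of_eq ?_)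
  rw [sqrt_form_neg]

theorem form_apply_eq_zero (hs : ∀ u w, f u w = f w u) (hf : ∀ u, 0 ≤ f u u) {u : V}
    (h : f u u = 0) (w : V) : f u w = 0 := by
  have := abs_le_sqrt_mul_sqrt hs hf u w
  rw [h, Real.sqrt_zero, zero_mul] at this
  exact abs_nonpos_iff.1 this

theorem form_add_le (hs : ∀ u w, f u w = f w u) (hf : ∀ u, 0 ≤ f u u) (u w : V) :
    f (u + w) (u + w) ≤ 2 * f u u + 2 * f w w := by
  have h := hf (u - w)
  simp only [map_sub, LinearMap.sub_apply] at h
  simp only [map_add, LinearMap.add_apply]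
  rw [hs w u] at *
  linarith

theorem form_add_eq_of_null (hs : ∀ u w, f u w = f w u) (hf : ∀ u, 0 ≤ f u u) (u : V) {w : V}
    (h : f w w = 0) : f (u + w) (u + w) = f u u := by
  have h1 := form_apply_eq_zero hs hf h u
  simp only [map_add, LinearMap.add_apply]
  rw [hs u w, h1, h]; ring

end SemiForm

theorem sum_mul_le_sqrt {ι : Type*} (I : Finset ι) {x y : ι → ℝ} (hx : ∀ i, 0 ≤ x i)
    (hy : ∀ i, 0 ≤ y i) : ∑ i ∈ I, √(x i) * √(y i) ≤ √(∑ i ∈ I, x i) * √(∑ i ∈ I, y i) :=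
  Real.sum_sqrt_mul_sqrt_le I hx hy

/-! ### Localized sign-changing forms -/

/-- An abstract sign-changing problem that is assembled from contributions of the elements
`j : ι` of a mesh: `a j` and `s j` stand for `∫_{K_j} |σ| ∇u · ∇w` and `∫_{K_j} |μ| u w`, `sgn j`
is the sign of `σ` in `K_j`, `ω j` the ratio between `k² |c|` and `|μ|` in `K_j`, `coef j k` the
coefficients of the projection onto the auxiliary space, and `R` the extension by reflection.
An element `u` vanishes in `K_j` when `s j u u = 0`. The parameters `q`, `τ`, `Λ`, `Cl`, `Col`
bound, in this order, the numbers `ω j`, the reflection relative to the contrast, the first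
neglected eigenvalue from below, the local liftings, and the overlap of the patches. -/
structure LocalizedSystem (V ι κ : Type*) [NormedAddCommGroup V] [InnerProductSpace ℝ V]
    [Fintype ι] [Fintype κ] [DecidableEq ι] (q τ Λ Cl Col : ℝ) where
  a : ι → LinearMap.BilinForm ℝ V
  s : ι → LinearMap.BilinForm ℝ V
  coef : ι → κ → V →ₗ[ℝ] ℝ
  sgn : ι → ℝ
  ω : ι → ℝ
  R : V →ₗ[ℝ] V
  patch : ι → ℕ → Finset ι
  a_symm : ∀ j u w, a j u w = a j w u
  s_symm : ∀ j u w, s j u w = s j w u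
  a_nonneg : ∀ j u, 0 ≤ a j u u
  s_nonneg : ∀ j u, 0 ≤ s j u u
  a_eq_zero : ∀ j u, s j u u = 0 → a j u u = 0
  sgn_eq : ∀ j, sgn j = 1 ∨ sgn j = -1
  ω_nonneg : ∀ j, 0 ≤ ω j
  ω_le : ∀ j, ω j ≤ q
  one_le_gap : 1 ≤ Λ
  coef_le : ∀ j u, ∑ k, coef j k u ^ 2 ≤ s j u u
  gap_le : ∀ j u, Λ * (s j u u - ∑ k, coef j k u ^ 2) ≤ a j u u
  R_idem : ∀ u, R (R u) = R u
  R_plus : ∀ j u, sgn j = 1 → s j (R u - u) (R u - u) = 0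
  R_a : ∀ u, ∑ j with sgn j = -1, a j (R u) (R u) ≤ τ ^ 2 * ∑ j, a j u u
  R_s : ∀ u, ∑ j with sgn j = -1, s j (R u) (R u) ≤ τ ^ 2 * ∑ j, s j u u
  lift : ∀ c : ι → κ → ℝ, ∃ w, (∀ j k, coef j k w = c j k) ∧
    ∑ j, a j w w ≤ Cl ^ 2 * ∑ j, ∑ k, c j k ^ 2
  lower : ∃ C : ℝ, 0 < C ∧ ∀ u, C * ‖u‖ ^ 2 ≤ ∑ j, a j u u
  upper : ∃ C : ℝ, 0 < C ∧ ∀ u, ∑ j, (a j u u + s j u u) ≤ C * ‖u‖ ^ 2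
  self_mem : ∀ i, i ∈ patch i 1
  mono : ∀ i m, 1 ≤ m → patch i m ⊆ patch i (m + 1)
  overlap : ∀ j (m : ℕ), 1 ≤ m →
    ((Finset.univ.filter fun i => j ∈ patch i m).card : ℝ) ≤ Col * (m : ℝ) ^ 2
  T_inside : ∀ i m, 1 ≤ m → ∀ u, (∀ j ∉ patch i m, s j u u = 0) →
    ∀ j ∉ patch i m, s j (-u + (2 : ℝ) • R u) (-u + (2 : ℝ) • R u) = 0
  T_outside : ∀ i m, 1 ≤ m → ∀ u, (∀ j ∈ patch i m, s j u u = 0) →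
    ∀ j ∈ patch i m, s j (-u + (2 : ℝ) • R u) (-u + (2 : ℝ) • R u) = 0
  cutoff : ∀ i m, 1 ≤ m → ∀ u, ∃ w, (∀ j ∈ patch i m, s j (u - w) (u - w) = 0) ∧
    (∀ j ∉ patch i (m + 1), s j w w = 0) ∧
    ∀ j, a j w w + s j w w ≤ 19 * (a j u u + s j u u)

namespace LocalizedSystem

variable {V ι κ : Type*} [NormedAddCommGroup V] [InnerProductSpace ℝ V]
  [Fintype ι] [Fintype κ] [DecidableEq ι] {q τ Λ Cl Col : ℝ} (S : LocalizedSystem V ι κ q τ Λ Cl Col)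

/-- The reflection operator `𝒯`. -/
def T : V →ₗ[ℝ] V := -LinearMap.id + (2 : ℝ) • S.R

/-- The full local energy form. -/
def e (j : ι) : LinearMap.BilinForm ℝ V := S.a j + S.s j

/-- The local contribution `s(π u, π w)`, without its sign. -/
def p (j : ι) : LinearMap.BilinForm ℝ V :=
  ∑ k, LinearMap.BilinForm.linMulLin (S.coef j k) (S.coef j k)

/-- The local contribution to the sign-changing form. -/
def bAt (j : ι) : LinearMap.BilinForm ℝ V := S.sgn j • (S.a j - S.ω j • S.s j)

/-- The local contribution to the stabilized form. -/
def bpAt (j : ι) : LinearMap.BilinForm ℝ V := S.bAt j + S.sgn j • S.p j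

/-- The energy inner product `∫_Ω |σ| ∇u · ∇w`. -/
def aTot : LinearMap.BilinForm ℝ V := ∑ j, S.a j

/-- The weighted inner product `∫_Ω |μ| u w`. -/
def sTot : LinearMap.BilinForm ℝ V := ∑ j, S.s j

/-- The full energy form, the sum of `aTot` and `sTot`. -/
def eTot : LinearMap.BilinForm ℝ V := ∑ j, S.e j

/-- The sign-changing form `𝓑`. -/
def b : LinearMap.BilinForm ℝ V := ∑ j, S.bAt j

/-- The stabilized form `𝓑(u, w) + s(π u, π w)`. -/
def bp : LinearMap.BilinForm ℝ V := ∑ j, S.bpAt j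

/-- The energy norm. -/
noncomputable def nA (u : V) : ℝ := √(S.aTot u u)

/-- The norm that belongs to the sum of the energy and the weighted `L²` inner product. -/
noncomputable def nE (u : V) : ℝ := √(S.eTot u u)

theorem T_apply (u : V) : S.T u = -u + (2 : ℝ) • S.R u := by simp [T]

theorem T_T (u : V) : S.T (S.T u) = u := by
  simp only [T_apply, map_add, map_neg, map_smul, S.R_idem]
  module

theorem e_apply (j : ι) (u w : V) : S.e j u w = S.a j u w + S.s j u w := by simp [e]

theorem p_apply (j : ι) (u w : V) : S.p j u w = ∑ k, S.coef j k u * S.coef j k w := by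
  simp [p, LinearMap.sum_apply]

theorem bAt_apply (j : ι) (u w : V) :
    S.bAt j u w = S.sgn j * (S.a j u w - S.ω j * S.s j u w) := by simp [bAt]

theorem bpAt_apply (j : ι) (u w : V) :
    S.bpAt j u w = S.sgn j * (S.a j u w - S.ω j * S.s j u w + S.p j u w) := by
  simp [bpAt, bAt]; ring

theorem aTot_apply (u w : V) : S.aTot u w = ∑ j, S.a j u w := by simp [aTot, LinearMap.sum_apply]

theorem sTot_apply (u w : V) : S.sTot u w = ∑ j, S.s j u w := by simp [sTot, LinearMap.sum_apply]

theorem eTot_apply (u w : V) : S.eTot u w = ∑ j, S.e j u w := by simp [eTot, LinearMap.sum_apply]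

theorem b_apply (u w : V) : S.b u w = ∑ j, S.bAt j u w := by simp [b, LinearMap.sum_apply]

theorem bp_apply (u w : V) : S.bp u w = ∑ j, S.bpAt j u w := by simp [bp, LinearMap.sum_apply]

theorem bp_eq (u w : V) : S.bp u w = S.b u w + ∑ j, S.sgn j * S.p j u w := by
  simp only [bp_apply, b_apply, bpAt, LinearMap.add_apply, LinearMap.smul_apply, smul_eq_mul,
    Finset.sum_add_distrib]

theorem eTot_eq (u w : V) : S.eTot u w = S.aTot u w + S.sTot u w := by
  simp [eTot_apply, aTot_apply, sTot_apply, e_apply, Finset.sum_add_distrib]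

theorem p_symm (j : ι) (u w : V) : S.p j u w = S.p j w u := by
  simp [p_apply, mul_comm]

theorem p_self (j : ι) (u : V) : S.p j u u = ∑ k, S.coef j k u ^ 2 := by
  simp [p_apply, sq]

theorem p_nonneg (j : ι) (u : V) : 0 ≤ S.p j u u := by
  rw [p_self]; positivity

theorem p_le (j : ι) (u : V) : S.p j u u ≤ S.s j u u := by
  rw [p_self]; exact S.coef_le j u

theorem e_symm (j : ι) (u w : V) : S.e j u w = S.e j w u := by
  rw [e_apply, e_apply, S.a_symm, S.s_symm]

theorem e_nonneg (j : ι) (u : V) : 0 ≤ S.e j u u := by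
  rw [e_apply]; exact add_nonneg (S.a_nonneg j u) (S.s_nonneg j u)

theorem aTot_symm (u w : V) : S.aTot u w = S.aTot w u := by
  simp only [aTot_apply, S.a_symm _ u w]

theorem aTot_nonneg (u : V) : 0 ≤ S.aTot u u := by
  rw [aTot_apply]; exact Finset.sum_nonneg fun j _ => S.a_nonneg j u

theorem sTot_nonneg (u : V) : 0 ≤ S.sTot u u := by
  rw [sTot_apply]; exact Finset.sum_nonneg fun j _ => S.s_nonneg j u

theorem eTot_symm (u w : V) : S.eTot u w = S.eTot w u := by
  simp only [eTot_apply, S.e_symm _ u w]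

theorem eTot_nonneg (u : V) : 0 ≤ S.eTot u u := by
  rw [eTot_apply]; exact Finset.sum_nonneg fun j _ => S.e_nonneg j u

theorem b_symm (u w : V) : S.b u w = S.b w u := by
  simp only [b_apply, bAt_apply, S.a_symm _ u w, S.s_symm _ u w]

theorem bp_symm (u w : V) : S.bp u w = S.bp w u := by
  rw [bp_eq, bp_eq, S.b_symm]; simp only [S.p_symm _ u w]

theorem nE_nonneg (u : V) : 0 ≤ S.nE u := Real.sqrt_nonneg _

theorem nA_nonneg (u : V) : 0 ≤ S.nA u := Real.sqrt_nonneg _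

theorem nE_sq (u : V) : S.nE u ^ 2 = S.eTot u u := Real.sq_sqrt (S.eTot_nonneg u)

theorem nA_sq (u : V) : S.nA u ^ 2 = S.aTot u u := Real.sq_sqrt (S.aTot_nonneg u)

theorem nE_add_le (u w : V) : S.nE (u + w) ≤ S.nE u + S.nE w :=
  sqrt_form_add_le S.eTot_symm S.eTot_nonneg u w

theorem nE_sub_le (u w : V) : S.nE (u - w) ≤ S.nE u + S.nE w :=
  sqrt_form_sub_le S.eTot_symm S.eTot_nonneg u w

theorem nA_add_le (u w : V) : S.nA (u + w) ≤ S.nA u + S.nA w :=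
  sqrt_form_add_le S.aTot_symm S.aTot_nonneg u w

theorem nA_sub_le (u w : V) : S.nA (u - w) ≤ S.nA u + S.nA w :=
  sqrt_form_sub_le S.aTot_symm S.aTot_nonneg u w

theorem nA_le_nE (u : V) : S.nA u ≤ S.nE u := by
  refine Real.sqrt_le_sqrt ?_
  rw [eTot_eq]; linarith [S.sTot_nonneg u]

/-- With the projection under control, the spectral gap `Λ ≥ 1` makes the full energy comparable to
the quantities in which the stabilized form is coercive. -/
theorem sTot_le (u : V) : S.sTot u u ≤ ∑ j, S.p j u u + S.aTot u u := by
  rw [sTot_apply, aTot_apply, ← Finset.sum_add_distrib]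
  refine Finset.sum_le_sum fun j _ => ?_
  have h1 := S.gap_le j u
  have h2 := S.coef_le j u
  rw [p_self]
  nlinarith [S.one_le_gap]

theorem nA_eq_zero {u : V} (h : S.nA u = 0) : u = 0 := by
  obtain ⟨C, hC, hl⟩ := S.lower
  have h1 := hl u
  rw [← S.aTot_apply, ← S.nA_sq, h] at h1
  have : ‖u‖ ^ 2 ≤ 0 := by nlinarith
  simpa using this

theorem nA_zero : S.nA 0 = 0 := by simp [nA]

theorem nE_zero : S.nE 0 = 0 := by simp [nE]

theorem nA_pos {u : V} (h : u ≠ 0) : 0 < S.nA u :=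
  lt_of_le_of_ne (S.nA_nonneg u) fun h' => h (S.nA_eq_zero h'.symm)

theorem nE_eq_zero {u : V} (h : S.nE u = 0) : u = 0 :=
  S.nA_eq_zero (le_antisymm (h ▸ S.nA_le_nE u) (S.nA_nonneg u))

theorem sgn_abs (j : ι) : |S.sgn j| = 1 := by
  rcases S.sgn_eq j with h | h <;> simp [h]

theorem sgn_mul_self (j : ι) : S.sgn j * S.sgn j = 1 := by
  rcases S.sgn_eq j with h | h <;> simp [h]

theorem sqrt_two_le (a₁ a₂ s₁ s₂ : ℝ) (h1 : 0 ≤ a₁) (h2 : 0 ≤ a₂) (h3 : 0 ≤ s₁) (h4 : 0 ≤ s₂) :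
    √a₁ * √a₂ + √s₁ * √s₂ ≤ √(a₁ + s₁) * √(a₂ + s₂) := by
  rw [← Real.sqrt_mul (add_nonneg h1 h3)]
  refine Real.le_sqrt_of_sq_le ?_
  have e1 := Real.sq_sqrt h1
  have e2 := Real.sq_sqrt h2
  have e3 := Real.sq_sqrt h3
  have e4 := Real.sq_sqrt h4
  calc (√a₁ * √a₂ + √s₁ * √s₂) ^ 2
      ≤ (√a₁ ^ 2 + √s₁ ^ 2) * (√a₂ ^ 2 + √s₂ ^ 2) := by
        nlinarith [sq_nonneg (√a₁ * √s₂ - √s₁ * √a₂)]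
    _ = _ := by rw [e1, e2, e3, e4]

/-- As `ω j ≤ 1`, the Cauchy-Schwarz inequality holds with the full energy although the two parts of
the form have opposite signs. -/
theorem abs_bAt_le (hq : q ≤ 1) (j : ι) (u w : V) :
    |S.bAt j u w| ≤ √(S.e j u u) * √(S.e j w w) := by
  have h1 := abs_le_sqrt_mul_sqrt (S.a_symm j) (S.a_nonneg j) u w
  have h2 := abs_le_sqrt_mul_sqrt (S.s_symm j) (S.s_nonneg j) u w
  have h3 := sqrt_two_le _ _ _ _ (S.a_nonneg j u) (S.a_nonneg j w) (S.s_nonneg j u)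
    (S.s_nonneg j w)
  rw [bAt_apply, abs_mul, sgn_abs, one_mul, e_apply, e_apply]
  refine le_trans ?_ h3
  refine (abs_sub _ _).trans (add_le_add h1 ?_)
  rw [abs_mul, abs_of_nonneg (S.ω_nonneg j)]
  refine le_trans ?_ h2
  exact mul_le_of_le_one_left (abs_nonneg _) ((S.ω_le j).trans hq)

theorem abs_bpAt_le (hq : q ≤ 1) (j : ι) (u w : V) :
    |S.bpAt j u w| ≤ 2 * (√(S.e j u u) * √(S.e j w w)) := by
  have h1 := S.abs_bAt_le hq j u w
  have h2 := abs_le_sqrt_mul_sqrt (S.p_symm j) (S.p_nonneg j) u w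
  have h3 : ∀ u, √(S.p j u u) ≤ √(S.e j u u) := fun u => by
    refine Real.sqrt_le_sqrt ((S.p_le j u).trans ?_)
    rw [e_apply]; linarith [S.a_nonneg j u]
  have h4 : √(S.p j u u) * √(S.p j w w) ≤ √(S.e j u u) * √(S.e j w w) :=
    mul_le_mul (h3 u) (h3 w) (Real.sqrt_nonneg _) (Real.sqrt_nonneg _)
  rw [bpAt, LinearMap.add_apply, LinearMap.add_apply, LinearMap.smul_apply, LinearMap.smul_apply,
    smul_eq_mul]
  refine (abs_add_le _ _).trans ?_
  rw [abs_mul, sgn_abs]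
  linarith

theorem abs_b_le (hq : q ≤ 1) (u w : V) : |S.b u w| ≤ S.nE u * S.nE w := by
  rw [b_apply, nE, nE, eTot_apply, eTot_apply]
  refine (Finset.abs_sum_le_sum_abs _ _).trans ?_
  refine (Finset.sum_le_sum fun j _ => S.abs_bAt_le hq j u w).trans ?_
  exact sum_mul_le_sqrt _ (fun j => S.e_nonneg j u) fun j => S.e_nonneg j w

theorem e_null {j : ι} {u : V} (h : S.s j u u = 0) : S.e j u u = 0 := by
  rw [e_apply, h, S.a_eq_zero j u h, add_zero]

theorem bpAt_null {j : ι} {u w : V} (hq : q ≤ 1) (h : S.s j u u = 0 ∨ S.s j w w = 0) :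
    S.bpAt j u w = 0 := by
  have := S.abs_bpAt_le hq j u w
  rcases h with h | h <;> rw [S.e_null h] at this <;> simpa using this

/-- The stabilized form only sees the elements in which neither argument vanishes. -/
theorem abs_bp_le_of_support (hq : q ≤ 1) (I : Finset ι) {u w : V}
    (h : ∀ j ∉ I, S.s j u u = 0 ∨ S.s j w w = 0) :
    |S.bp u w| ≤ 2 * (√(∑ j ∈ I, S.e j u u) * √(∑ j ∈ I, S.e j w w)) := by
  rw [bp_apply, ← Finset.sum_subset (Finset.subset_univ I)
    fun j _ hj => S.bpAt_null hq (h j hj)]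
  refine (Finset.abs_sum_le_sum_abs _ _).trans ?_
  refine (Finset.sum_le_sum fun j _ => S.abs_bpAt_le hq j u w).trans ?_
  rw [← Finset.mul_sum]
  exact mul_le_mul_of_nonneg_left
    (sum_mul_le_sqrt _ (fun j => S.e_nonneg j u) fun j => S.e_nonneg j w) (by norm_num)

theorem abs_bp_le (hq : q ≤ 1) (u w : V) : |S.bp u w| ≤ 2 * (S.nE u * S.nE w) := by
  have := S.abs_bp_le_of_support hq Finset.univ (u := u) (w := w) (by simp)
  rwa [← eTot_apply, ← eTot_apply] at this

theorem coef_null {j : ι} {u : V} (h : S.s j u u = 0) (k : κ) : S.coef j k u = 0 := by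
  have h1 := S.coef_le j u
  rw [h] at h1
  have h2 := Finset.single_le_sum (f := fun k => S.coef j k u ^ 2)
    (fun k _ => sq_nonneg _) (Finset.mem_univ k)
  have : S.coef j k u ^ 2 ≤ 0 := h2.trans h1
  simpa using this

/-! ### Coercivity after reflection -/

theorem sum_sgn (f : ι → ℝ) :
    ∑ j, f j = ∑ j with S.sgn j = 1, f j + ∑ j with S.sgn j = -1, f j := by
  rw [← Finset.sum_filter_add_sum_filter_not Finset.univ (fun j => S.sgn j = 1)]
  congr 1
  refine Finset.sum_congr (Finset.filter_congr fun j _ => ?_) fun _ _ => rfl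
  rcases S.sgn_eq j with h | h <;> rw [h] <;> norm_num

theorem T_plus {j : ι} (h : S.sgn j = 1) (u : V) : S.s j (S.T u - u) (S.T u - u) = 0 := by
  have e : S.T u - u = (2 : ℝ) • (S.R u - u) := by rw [T_apply]; module
  rw [e, map_smul, map_smul, LinearMap.smul_apply, S.R_plus j u h, smul_zero, smul_zero]

/-- The cross terms between `u` and its extension: one factor `τ` of the bound of the extension
remains after the Cauchy-Schwarz inequality. -/
theorem sum_minus_le {f : ι → LinearMap.BilinForm ℝ V} (hs : ∀ j u w, f j u w = f j w u)
    (hf : ∀ j u, 0 ≤ f j u u) (hτ : 0 ≤ τ) {u : V} {Y : ℝ} (hY : ∑ j, f j u u ≤ Y)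
    (hR : ∑ j with S.sgn j = -1, f j (S.R u) (S.R u) ≤ τ ^ 2 * Y) :
    ∑ j with S.sgn j = -1, |f j u (S.R u)| ≤ τ * Y := by
  have hY0 : 0 ≤ Y := (Finset.sum_nonneg fun j _ => hf j u).trans hY
  calc ∑ j with S.sgn j = -1, |f j u (S.R u)|
      ≤ ∑ j with S.sgn j = -1, √(f j u u) * √(f j (S.R u) (S.R u)) :=
        Finset.sum_le_sum fun j _ => abs_le_sqrt_mul_sqrt (hs j) (hf j) _ _
    _ ≤ √(∑ j with S.sgn j = -1, f j u u) * √(∑ j with S.sgn j = -1, f j (S.R u) (S.R u)) :=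
        sum_mul_le_sqrt _ (fun j => hf j u) fun j => hf j _
    _ ≤ √Y * √(τ ^ 2 * Y) := by
        refine mul_le_mul (Real.sqrt_le_sqrt (le_trans ?_ hY)) (Real.sqrt_le_sqrt hR)
          (Real.sqrt_nonneg _) (Real.sqrt_nonneg _)
        exact Finset.sum_le_univ_sum_of_nonneg fun j => hf j u
    _ = τ * Y := by
        rw [Real.sqrt_mul (sq_nonneg τ), Real.sqrt_sq hτ]
        nlinarith [Real.mul_self_sqrt hY0]

/-- Reflection turns the local contribution into `a + p - q s`, since it acts as the identity where
`σ` is positive and as a change of sign, up to the extension, where `σ` is negative. -/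
theorem bpAt_T_ge (hq : q ≤ 1) (j : ι) (u : V) :
    S.a j u u + S.p j u u - q * S.s j u u -
      (if S.sgn j = -1 then 2 * |S.a j u (S.R u)| + 2 * |S.s j u (S.R u)|
        + 2 * |S.p j u (S.R u)| else 0) ≤ S.bpAt j u (S.T u) := by
  have hω := mul_le_mul_of_nonneg_right (S.ω_le j) (S.s_nonneg j u)
  rcases S.sgn_eq j with h | h
  · rw [if_neg (by rw [h]; norm_num)]
    have e : S.bpAt j u (S.T u) = S.bpAt j u u := by
      have := S.bpAt_null (u := u) hq (Or.inr (S.T_plus h u))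
      rw [map_sub] at this; linarith
    rw [e, bpAt_apply, h]; linarith
  · rw [if_pos h, bpAt_apply, h, T_apply]
    simp only [map_add, map_neg, map_smul, smul_eq_mul]
    have h1 := le_abs_self (S.a j u (S.R u))
    have h2 := neg_abs_le (S.s j u (S.R u))
    have h3 := le_abs_self (S.p j u (S.R u))
    have h4 : -|S.s j u (S.R u)| ≤ S.ω j * S.s j u (S.R u) := by
      have := abs_nonneg (S.s j u (S.R u))
      have h5 := mul_le_mul_of_nonneg_left h2 (S.ω_nonneg j)
      nlinarith [S.ω_le j, S.ω_nonneg j]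
    linarith

/-- The stabilized form is coercive after composition with the reflection operator. The elementwise
bound leaves `A + P - q S` minus cross terms of size `2 τ A + 4 τ S`, where `A`, `P`, `S` stand for
the energy, the projection and the weighted `L²` norm. By `S ≤ P + A` the first part is at least
`(1 - q) (A + P) ≥ (1 - q) (A + S) / 2`, and for small `τ` half of this lower bound remains. -/
theorem coercive (hq0 : 0 ≤ q) (hq : q < 1) (hτ0 : 0 ≤ τ) (hτ : τ ≤ (1 - q) / 16) (u : V) :
    (1 - q) / 4 * S.nE u ^ 2 ≤ S.bp u (S.T u) := by
  have hA : ∑ j with S.sgn j = -1, |S.a j u (S.R u)| ≤ τ * S.aTot u u := by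
    refine S.sum_minus_le S.a_symm S.a_nonneg hτ0 (S.aTot_apply u u).ge ?_
    rw [aTot_apply]; exact S.R_a u
  have hS : ∑ j with S.sgn j = -1, |S.s j u (S.R u)| ≤ τ * S.sTot u u := by
    refine S.sum_minus_le S.s_symm S.s_nonneg hτ0 (S.sTot_apply u u).ge ?_
    rw [sTot_apply]; exact S.R_s u
  have hP : ∑ j with S.sgn j = -1, |S.p j u (S.R u)| ≤ τ * S.sTot u u := by
    refine S.sum_minus_le S.p_symm S.p_nonneg hτ0 ?_ ?_
    · rw [sTot_apply]; exact Finset.sum_le_sum fun j _ => S.p_le j u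
    · rw [sTot_apply]
      exact (Finset.sum_le_sum fun j _ => S.p_le j _).trans (S.R_s u)
  have key := Finset.sum_le_sum fun j (_ : j ∈ Finset.univ) => S.bpAt_T_ge hq.le j u
  rw [← bp_apply, Finset.sum_sub_distrib, Finset.sum_sub_distrib, Finset.sum_add_distrib,
    ← aTot_apply, ← Finset.mul_sum, ← sTot_apply, ← Finset.sum_filter, Finset.sum_add_distrib,
    Finset.sum_add_distrib, ← Finset.mul_sum, ← Finset.mul_sum, ← Finset.mul_sum] at key
  have h1 := S.sTot_le u
  have h2 := S.sTot_nonneg u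
  have h3 := S.aTot_nonneg u
  have h4 : 0 ≤ ∑ j, S.p j u u := Finset.sum_nonneg fun j _ => S.p_nonneg j u
  rw [nE_sq, eTot_eq]
  have h5 : τ * S.aTot u u ≤ (1 - q) / 16 * S.aTot u u := mul_le_mul_of_nonneg_right hτ h3
  have h6 : τ * S.sTot u u ≤ (1 - q) / 16 * S.sTot u u := mul_le_mul_of_nonneg_right hτ h2
  have h7 : q * S.sTot u u ≤ q * (∑ j, S.p j u u + S.aTot u u) :=
    mul_le_mul_of_nonneg_left h1 hq0
  have h8 : (1 - q) * S.sTot u u ≤ (1 - q) * (∑ j, S.p j u u + S.aTot u u) :=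
    mul_le_mul_of_nonneg_left h1 (by linarith)
  have h9 : 0 ≤ (1 - q) * S.aTot u u := mul_nonneg (by linarith) h3
  have h10 : 0 ≤ (1 - q) * ∑ j, S.p j u u := mul_nonneg (by linarith) h4
  linarith

/-- The reflected function in `Ω⁻` is `-u + 2 R u`, which costs a factor `2` and an extension of
norm at most `1 / 8`: altogether `2 + 8 / 64 ≤ 3`. -/
theorem sum_T_le {f : ι → LinearMap.BilinForm ℝ V} (hs : ∀ j u w, f j u w = f j w u)
    (hf : ∀ j u, 0 ≤ f j u u) (hnull : ∀ j u, S.s j u u = 0 → f j u u = 0)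
    (hτ0 : 0 ≤ τ) (hτ : τ ≤ 1 / 8) (u : V)
    (hR : ∑ j with S.sgn j = -1, f j (S.R u) (S.R u) ≤ τ ^ 2 * ∑ j, f j u u) :
    ∑ j, f j (S.T u) (S.T u) ≤ 3 * ∑ j, f j u u := by
  have h0 : 0 ≤ ∑ j, f j u u := Finset.sum_nonneg fun j _ => hf j u
  have h0' : 0 ≤ ∑ j with S.sgn j = 1, f j u u := Finset.sum_nonneg fun j _ => hf j u
  have hτ2 : τ ^ 2 * ∑ j, f j u u ≤ 1 / 64 * ∑ j, f j u u :=
    mul_le_mul_of_nonneg_right (by nlinarith) h0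
  have hp : ∑ j with S.sgn j = 1, f j (S.T u) (S.T u) = ∑ j with S.sgn j = 1, f j u u := by
    refine Finset.sum_congr rfl fun j hj => ?_
    have := form_add_eq_of_null (hs j) (hf j) u
      (hnull j _ (S.T_plus (Finset.mem_filter.1 hj).2 u))
    rwa [add_sub_cancel] at this
  have hm : ∑ j with S.sgn j = -1, f j (S.T u) (S.T u) ≤
      2 * ∑ j with S.sgn j = -1, f j u u + 8 * ∑ j with S.sgn j = -1, f j (S.R u) (S.R u) := by
    rw [Finset.mul_sum, Finset.mul_sum, ← Finset.sum_add_distrib]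
    refine Finset.sum_le_sum fun j _ => ?_
    have := form_add_le (hs j) (hf j) (-u) ((2 : ℝ) • S.R u)
    rw [T_apply]
    simp only [map_neg, LinearMap.neg_apply, neg_neg, map_smul, LinearMap.smul_apply,
      smul_eq_mul] at this
    linarith
  have h1 := S.sum_sgn fun j => f j (S.T u) (S.T u)
  have h2 := S.sum_sgn fun j => f j u u
  linarith

theorem nE_T_sq_le (hτ0 : 0 ≤ τ) (hτ : τ ≤ 1 / 8) (u : V) :
    S.nE (S.T u) ^ 2 ≤ 3 * S.nE u ^ 2 := by
  rw [nE_sq, nE_sq, eTot_eq, eTot_eq]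
  simp only [aTot_apply, sTot_apply]
  have h1 := S.sum_T_le S.a_symm S.a_nonneg S.a_eq_zero hτ0 hτ u (S.R_a u)
  have h2 := S.sum_T_le S.s_symm S.s_nonneg (fun _ _ h => h) hτ0 hτ u (S.R_s u)
  linarith

theorem nE_T_le (hτ0 : 0 ≤ τ) (hτ : τ ≤ 1 / 8) (u : V) :
    S.nE (S.T u) ≤ √3 * S.nE u := by
  refine abs_le_of_sq_le_sq' ?_ (mul_nonneg (Real.sqrt_nonneg _) (S.nE_nonneg u)) |>.2
  rw [mul_pow, Real.sq_sqrt (by norm_num)]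
  exact S.nE_T_sq_le hτ0 hτ u

end LocalizedSystem
/-! ### The spectral gap in Courant-Fischer form -/

section Spectral

variable {X : Type*} [AddCommGroup X] [Module ℝ X] {a s : LinearMap.BilinForm ℝ X}
  {H : Submodule ℝ X} {l : ℕ} {ψ : Fin l → X} {ev : ℕ → ℝ}

theorem form_sum_left {κ : Type*} [Fintype κ] (f : LinearMap.BilinForm ℝ X) (c : κ → ℝ) (φ : κ → X)
    (w : X) : f (∑ k, c k • φ k) w = ∑ k, c k * f (φ k) w := by
  simp [map_sum, LinearMap.sum_apply]

theorem form_sum_right {κ : Type*} [Fintype κ] (f : LinearMap.BilinForm ℝ X) (c : κ → ℝ) (φ : κ → X)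
    (w : X) : f w (∑ k, c k • φ k) = ∑ k, c k * f w (φ k) := by
  simp [map_sum]

/-- If `v` is orthogonal to the eigenvectors `ψ`, its Rayleigh quotient bounds the first `l + 1`
eigenvalues: by induction, `v` and the first `j` eigenvectors span a space of dimension `j + 1` on
which the Rayleigh quotient is at most that of `v`. -/
theorem eigenvalue_le (as : ∀ u w, a u w = a w u) (ha : ∀ u, 0 ≤ a u u)
    (ss : ∀ u w, s u w = s w u)
    (hψ : ∀ j, ψ j ∈ H) (hon : ∀ j j', s (ψ j) (ψ j') = if j = j' then 1 else 0)
    (heig : ∀ (j : Fin l), ∀ w ∈ H, a (ψ j) w = ev (j + 1) * s (ψ j) w)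
    (hev : ∀ j, ev j = sInf {t : ℝ | ∃ W : Submodule ℝ X, Module.finrank ℝ W = j ∧
      ∀ v ∈ W, v ∈ H ∧ a v v ≤ t * s v v})
    {v : X} (hv : v ∈ H) (horth : ∀ k, s (ψ k) v = 0) (hpos : 0 < s v v) {j : ℕ} (hj : j ≤ l) :
    ev (j + 1) ≤ a v v / s v v := by
  induction j using Nat.strong_induction_on with
  | _ j ih =>
  set t := a v v / s v v with ht
  have ht0 : 0 ≤ t := div_nonneg (ha v) hpos.le
  have htv : a v v = t * s v v := by rw [ht, div_mul_cancel₀ _ hpos.ne']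
  let ι' : Fin j → Fin l := Fin.castLE hj
  have hinj' : Function.Injective ι' := Fin.castLE_injective hj
  let Y : (Fin j → ℝ) →ₗ[ℝ] X := Fintype.linearCombination ℝ fun k => ψ (ι' k)
  have hY : ∀ c, Y c = ∑ k, c k • ψ (ι' k) := fun c => Fintype.linearCombination_apply _ _ _
  let Φ : (Fin j → ℝ) × ℝ →ₗ[ℝ] X := Y.coprod (LinearMap.toSpanSingleton ℝ _ v)
  have hΦ : ∀ x, Φ x = Y x.1 + x.2 • v := fun x => rfl
  have hYH : ∀ c, Y c ∈ H := fun c => by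
    rw [hY]; exact Submodule.sum_mem _ fun k _ => Submodule.smul_mem _ _ (hψ _)
  have hSψ : ∀ c k, s (ψ (ι' k)) (Y c) = c k := by
    intro c k
    rw [hY, form_sum_right]
    simp [hon, hinj'.eq_iff]
  have hSyv : ∀ c, s (Y c) v = 0 := fun c => by
    rw [hY, form_sum_left]; simp [horth]
  have hSyy : ∀ c, s (Y c) (Y c) = ∑ k, c k ^ 2 := fun c => by
    nth_rewrite 1 [hY]
    rw [form_sum_left]
    exact Finset.sum_congr rfl fun k _ => by rw [hSψ, sq]
  have hA : ∀ c, ∀ w ∈ H, a (Y c) w = ∑ k, c k * (ev (k + 1) * s (ψ (ι' k)) w) := by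
    intro c w hw
    rw [hY, form_sum_left]
    exact Finset.sum_congr rfl fun k _ => by rw [heig _ w hw]; rfl
  have hS : ∀ x, s (Φ x) (Φ x) = ∑ k, x.1 k ^ 2 + x.2 ^ 2 * s v v := by
    intro x
    rw [hΦ]
    simp only [map_add, LinearMap.add_apply, hSyy, map_smul, LinearMap.smul_apply, smul_eq_mul,
      hSyv, ss v (Y x.1)]
    ring
  have hAΦ : ∀ x, a (Φ x) (Φ x) ≤ t * s (Φ x) (Φ x) := by
    intro x
    rw [hS, hΦ]
    have e1 := hA x.1 _ (hYH x.1)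
    have e2 := hA x.1 v hv
    simp only [hSψ] at e1
    simp only [horth, mul_zero, Finset.sum_const_zero] at e2
    simp only [map_add, LinearMap.add_apply, e1, e2, map_smul, LinearMap.smul_apply, smul_eq_mul,
      as v (Y x.1)]
    have h1 : ∑ k : Fin j, x.1 k * (ev (k + 1) * x.1 k) ≤ t * ∑ k, x.1 k ^ 2 := by
      rw [Finset.mul_sum]
      refine Finset.sum_le_sum fun k _ => ?_
      have := mul_le_mul_of_nonneg_right (ih k k.2 (k.2.le.trans hj)) (sq_nonneg (x.1 k))
      linarith
    rw [htv]
    linarith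
  have hinj : Function.Injective Φ := by
    rw [← LinearMap.ker_eq_bot, LinearMap.ker_eq_bot']
    intro x hx
    have h1 := hS x
    rw [hx, map_zero] at h1
    have h2 : 0 ≤ ∑ k, x.1 k ^ 2 := Finset.sum_nonneg fun k _ => sq_nonneg _
    have h3 : 0 ≤ x.2 ^ 2 * s v v := by positivity
    have h4 : ∑ k, x.1 k ^ 2 = 0 := by linarith
    have h5 : x.2 ^ 2 * s v v = 0 := by linarith
    refine Prod.ext (funext fun k => ?_) ?_
    · have := (Finset.sum_eq_zero_iff_of_nonneg fun k _ => sq_nonneg (x.1 k)).1 h4 k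
        (Finset.mem_univ k)
      simpa using this
    · simpa [hpos.ne'] using h5
  have hmem : t ∈ {t : ℝ | ∃ W : Submodule ℝ X, Module.finrank ℝ W = j + 1 ∧
      ∀ v ∈ W, v ∈ H ∧ a v v ≤ t * s v v} := by
    refine ⟨LinearMap.range Φ, ?_, ?_⟩
    · rw [LinearMap.finrank_range_of_inj hinj]; simp
    · rintro _ ⟨x, rfl⟩
      exact ⟨Submodule.add_mem H (hYH x.1) (Submodule.smul_mem _ _ hv), hAΦ x⟩
  rw [hev]
  -- a set that is not bounded below has the junk infimum `0 ≤ t`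
  by_cases hb : BddBelow {t : ℝ | ∃ W : Submodule ℝ X, Module.finrank ℝ W = j + 1 ∧
      ∀ v ∈ W, v ∈ H ∧ a v v ≤ t * s v v}
  · exact csInf_le hb hmem
  · rw [Real.sInf_of_not_bddBelow hb]; exact ht0

/-- Bessel's inequality for the projection onto the eigenvectors `ψ`, and the lower bound of the
energy by the first neglected eigenvalue. -/
theorem spectral_gap (as : ∀ u w, a u w = a w u) (ha : ∀ u, 0 ≤ a u u)
    (ss : ∀ u w, s u w = s w u) (hs : ∀ u, 0 ≤ s u u)
    (hψ : ∀ j, ψ j ∈ H) (hon : ∀ j j', s (ψ j) (ψ j') = if j = j' then 1 else 0)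
    (heig : ∀ (j : Fin l), ∀ w ∈ H, a (ψ j) w = ev (j + 1) * s (ψ j) w)
    (hev : ∀ j, ev j = sInf {t : ℝ | ∃ W : Submodule ℝ X, Module.finrank ℝ W = j ∧
      ∀ v ∈ W, v ∈ H ∧ a v v ≤ t * s v v})
    {v : X} (hv : v ∈ H) :
    ∑ k, s v (ψ k) ^ 2 ≤ s v v ∧ ev (l + 1) * (s v v - ∑ k, s v (ψ k) ^ 2) ≤ a v v := by
  set c : Fin l → ℝ := fun k => s v (ψ k) with hc
  set y := ∑ k, c k • ψ k with hy
  have hyH : y ∈ H := Submodule.sum_mem _ fun k _ => Submodule.smul_mem _ _ (hψ _)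
  have hvH : v - y ∈ H := Submodule.sub_mem _ hv hyH
  have hSψ : ∀ k, s (ψ k) y = c k := by
    intro k
    rw [hy, form_sum_right]; simp [hon]
  have horth : ∀ k, s (ψ k) (v - y) = 0 := fun k => by
    rw [map_sub, hSψ, ss, sub_self]
  have hyl : ∀ f : LinearMap.BilinForm ℝ X, ∀ w, f y w = ∑ k, c k * f (ψ k) w := fun f w => by
    rw [hy, form_sum_left]
  have hSyy : s y y = ∑ k, c k ^ 2 := by
    rw [hyl]
    exact Finset.sum_congr rfl fun k _ => by rw [hSψ, sq]
  have hSyv : s y v = ∑ k, c k ^ 2 := by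
    rw [hyl]
    exact Finset.sum_congr rfl fun k _ => by rw [ss, sq]
  have hS : s (v - y) (v - y) = s v v - ∑ k, c k ^ 2 := by
    simp only [map_sub, LinearMap.sub_apply]
    rw [ss v y, hSyy, hSyv]; ring
  have hAle : a (v - y) (v - y) ≤ a v v := by
    have e1 : a y (v - y) = 0 := by
      rw [hyl]
      exact Finset.sum_eq_zero fun k _ => by rw [heig _ _ hvH, horth]; ring
    have e2 : a v v = a (v - y) (v - y) + 2 * a y (v - y) + a y y := by
      simp only [map_sub, LinearMap.sub_apply]
      rw [as v y]; ring
    have := ha y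
    linarith
  have h0 := hs (v - y)
  refine ⟨by rw [hS] at h0; linarith, ?_⟩
  rw [← hS]
  refine le_trans ?_ hAle
  rcases h0.eq_or_lt with h | h
  · rw [← h, mul_zero]; exact ha _
  · have := eigenvalue_le as ha ss hψ hon heig hev hvH horth h le_rfl
    rwa [le_div_iff₀ h] at this

end Spectral
namespace LocalizedSystem

variable {V ι κ : Type*} [NormedAddCommGroup V] [InnerProductSpace ℝ V]
  [Fintype ι] [Fintype κ] [DecidableEq ι] {q τ Λ Cl Col : ℝ}
  (S : LocalizedSystem V ι κ q τ Λ Cl Col)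

/-! ### Existence and uniqueness in reflection-invariant subspaces -/

theorem exists_nE_le : ∃ C : ℝ, 0 < C ∧ ∀ u, S.nE u ≤ C * ‖u‖ := by
  obtain ⟨C, hC, hu⟩ := S.upper
  refine ⟨√C, Real.sqrt_pos.2 hC, fun u => ?_⟩
  have h := hu u
  refine Real.sqrt_le_iff.2 ⟨by positivity, ?_⟩
  rw [mul_pow, Real.sq_sqrt hC.le, eTot_apply]
  simpa only [e_apply] using h

theorem exists_norm_le : ∃ C : ℝ, 0 < C ∧ ∀ u, ‖u‖ ≤ C * S.nA u := by
  obtain ⟨C, hC, hu⟩ := S.lower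
  refine ⟨(√C)⁻¹, by positivity, fun u => ?_⟩
  have h := hu u
  rw [← aTot_apply] at h
  have hs := Real.sqrt_pos.2 hC
  rw [inv_mul_eq_div, le_div_iff₀ hs]
  refine Real.le_sqrt_of_sq_le ?_
  rw [mul_pow, Real.sq_sqrt hC.le]; linarith

/-- `X` is closed and mapped into itself by the reflection operator, which is an involution, so the
Lax-Milgram theorem applies to `(u, w) ↦ bp u (T w)`. -/
theorem existsUnique_solution [CompleteSpace V] (hq0 : 0 ≤ q) (hq : q < 1) (hτ0 : 0 ≤ τ)
    (hτ : τ ≤ (1 - q) / 16) (X : Submodule ℝ V) (hX : IsClosed (X : Set V))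
    (hT : ∀ u ∈ X, S.T u ∈ X) (F : V →ₗ[ℝ] ℝ) (hF : ∃ C, ∀ w, |F w| ≤ C * S.nE w) :
    ∃! φ : V, φ ∈ X ∧ ∀ w ∈ X, S.bp φ w = F w := by
  have hτ8 : τ ≤ 1 / 8 := by linarith
  obtain ⟨C₁, hC₁, h₁⟩ := S.exists_nE_le
  obtain ⟨C₂, hC₂, h₂⟩ := S.exists_norm_le
  obtain ⟨CF, hCF⟩ := hF
  have hcl : CompleteSpace X := hX.completeSpace_coe
  let f : X →ₗ[ℝ] X →ₗ[ℝ] ℝ := LinearMap.compl₁₂ S.bp X.subtype (S.T ∘ₗ X.subtype)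
  have hf : ∀ u w : X, f u w = S.bp u (S.T w) := fun u w => rfl
  have hfb : ∀ u w : X, ‖f u w‖ ≤ (2 * (C₁ * (√3 * C₁))) * ‖u‖ * ‖w‖ := fun u w => by
    rw [hf, Real.norm_eq_abs]
    refine (S.abs_bp_le hq.le _ _).trans ?_
    have a1 := h₁ u
    have a2 := (S.nE_T_le hτ0 hτ8 w).trans (mul_le_mul_of_nonneg_left (h₁ w) (Real.sqrt_nonneg 3))
    calc 2 * (S.nE u * S.nE (S.T w)) ≤ 2 * ((C₁ * ‖(u : V)‖) * (√3 * (C₁ * ‖(w : V)‖))) := by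
          refine mul_le_mul_of_nonneg_left ?_ (by norm_num)
          exact mul_le_mul a1 a2 (S.nE_nonneg _) (by positivity)
      _ = _ := by simp only [Submodule.coe_norm]; ring
  let Bc : X →L[ℝ] X →L[ℝ] ℝ := LinearMap.mkContinuous₂ f _ hfb
  have hBc : ∀ u w : X, Bc u w = S.bp u (S.T w) := fun u w => rfl
  have hco : IsCoercive Bc := by
    refine ⟨(1 - q) / 4 * (C₂⁻¹ * C₂⁻¹), ?_, fun u => ?_⟩
    · have : 0 < 1 - q := by linarith
      positivity
    · rw [hBc]
      refine le_trans ?_ (S.coercive hq0 hq hτ0 hτ u)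
      have h3 : C₂⁻¹ * ‖u‖ ≤ S.nE u := by
        rw [inv_mul_le_iff₀ hC₂]
        exact (h₂ u).trans (mul_le_mul_of_nonneg_left (S.nA_le_nE _) hC₂.le)
      have h4 : (C₂⁻¹ * ‖u‖) ^ 2 ≤ S.nE u ^ 2 :=
        pow_le_pow_left₀ (by positivity) h3 2
      have h5 : 0 ≤ (1 - q) / 4 := by linarith
      nlinarith [mul_le_mul_of_nonneg_left h4 h5]
  have hGb : ∀ w : X, ‖(F ∘ₗ S.T ∘ₗ X.subtype) w‖ ≤ (|CF| * (√3 * C₁)) * ‖w‖ := fun w => by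
    rw [Real.norm_eq_abs]
    refine (hCF _).trans ?_
    have a2 := (S.nE_T_le hτ0 hτ8 w).trans (mul_le_mul_of_nonneg_left (h₁ w) (Real.sqrt_nonneg 3))
    calc CF * S.nE (S.T w) ≤ |CF| * (√3 * (C₁ * ‖(w : V)‖)) :=
          mul_le_mul (le_abs_self _) a2 (S.nE_nonneg _) (abs_nonneg _)
      _ = _ := by simp only [Submodule.coe_norm]; ring
  let Gc : X →L[ℝ] ℝ := LinearMap.mkContinuous _ _ hGb
  have hGc : ∀ w : X, Gc w = F (S.T w) := fun w => rfl
  let g : X := (InnerProductSpace.toDual ℝ X).symm Gc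
  let φ : X := hco.continuousLinearEquivOfBilin.symm g
  have hφ : ∀ w : X, Bc φ w = F (S.T w) := fun w => by
    rw [← IsCoercive.continuousLinearEquivOfBilin_apply hco φ w,
      ContinuousLinearEquiv.apply_symm_apply, InnerProductSpace.toDual_symm_apply, hGc]
  refine ⟨φ, ⟨φ.2, fun w hw => ?_⟩, fun φ' hφ' => ?_⟩
  · have := hφ ⟨S.T w, hT w hw⟩
    rwa [hBc, T_T] at this
  · have hmem : φ' - φ ∈ X := X.sub_mem hφ'.1 φ.2
    have hz : S.bp (φ' - φ) (S.T (φ' - φ)) = 0 := by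
      have e1 := hφ'.2 _ (hT _ hmem)
      have e2 := hφ ⟨_, hmem⟩
      rw [hBc] at e2
      rw [map_sub, LinearMap.sub_apply, e1, e2, sub_self]
    have hc := S.coercive hq0 hq hτ0 hτ (φ' - φ)
    rw [hz] at hc
    have h0 : S.nE (φ' - φ) = 0 := by
      have : S.nE (φ' - φ) ^ 2 ≤ 0 := by
        by_contra! hpos
        have : 0 < (1 - q) / 4 := by linarith
        nlinarith
      exact pow_eq_zero_iff (two_ne_zero) |>.1 (le_antisymm this (sq_nonneg _))
    exact sub_eq_zero.1 (S.nE_eq_zero h0)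

theorem null_add {j : ι} {u w : V} (hu : S.s j u u = 0) (hw : S.s j w w = 0) :
    S.s j (u + w) (u + w) = 0 := by
  rw [form_add_eq_of_null (S.s_symm j) (S.s_nonneg j) u hw, hu]

/-- The subspace of the elements that vanish outside the patch `K̂_i^m`. -/
def localSub (i : ι) (m : ℕ) : Submodule ℝ V where
  carrier := {u | ∀ j ∉ S.patch i m, S.s j u u = 0}
  add_mem' hu hw j hj := S.null_add (hu j hj) (hw j hj)
  zero_mem' j _ := by simp
  smul_mem' c u hu j hj := by simp [hu j hj]

theorem mem_localSub {i : ι} {m : ℕ} {u : V} :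
    u ∈ S.localSub i m ↔ ∀ j ∉ S.patch i m, S.s j u u = 0 := Iff.rfl

theorem e_le_eTot (j : ι) (u : V) : S.e j u u ≤ S.eTot u u := by
  rw [eTot_apply]
  exact Finset.single_le_sum (f := fun j => S.e j u u) (fun j _ => S.e_nonneg j u)
    (Finset.mem_univ j)

theorem s_le_e (j : ι) (u : V) : S.s j u u ≤ S.e j u u := by
  rw [e_apply]; linarith [S.a_nonneg j u]

/-- The map `u ↦ √(s j u u)` is a seminorm dominated by the norm of `V`. -/
theorem continuous_sqrt_s (j : ι) : Continuous fun u => √(S.s j u u) := by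
  obtain ⟨C, hC, h⟩ := S.exists_nE_le
  have hb : ∀ u, √(S.s j u u) ≤ C * ‖u‖ := fun u =>
    (Real.sqrt_le_sqrt ((S.s_le_e j u).trans (S.e_le_eTot j u))).trans (h u)
  refine (LipschitzWith.of_le_add_mul (K := ⟨C, hC.le⟩) fun u w => ?_).continuous
  have h1 := sqrt_form_add_le (S.s_symm j) (S.s_nonneg j) w (u - w)
  rw [add_sub_cancel] at h1
  rw [dist_eq_norm]
  exact h1.trans (by gcongr; exact hb _)

theorem isClosed_localSub (i : ι) (m : ℕ) : IsClosed (S.localSub i m : Set V) := by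
  have : (S.localSub i m : Set V) = ⋂ j ∈ {j | j ∉ S.patch i m}, {u | √(S.s j u u) = 0} := by
    ext u
    simp only [SetLike.mem_coe, mem_localSub, Set.mem_ofPred_eq, Set.mem_iInter]
    refine forall₂_congr fun j _ => ?_
    rw [Real.sqrt_eq_zero (S.s_nonneg j u)]
  rw [this]
  exact isClosed_biInter fun j _ => isClosed_eq (S.continuous_sqrt_s j) continuous_const

theorem T_mem_localSub {i : ι} {m : ℕ} (hm : 1 ≤ m) {u : V} (hu : u ∈ S.localSub i m) :
    S.T u ∈ S.localSub i m := by
  rw [T_apply]; exact S.T_inside i m hm u hu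

/-- The right-hand side `s(∑_k x_k ψ_i^k, π w)`. -/
def loadAt (i : ι) (x : κ → ℝ) : V →ₗ[ℝ] ℝ := S.sgn i • ∑ k, x k • S.coef i k

theorem loadAt_apply (i : ι) (x : κ → ℝ) (w : V) :
    S.loadAt i x w = S.sgn i * ∑ k, x k * S.coef i k w := by simp [loadAt, LinearMap.sum_apply]

theorem sum_coef_sq_le (i : ι) (w : V) : ∑ k, S.coef i k w ^ 2 ≤ S.nE w ^ 2 := by
  rw [nE_sq]
  exact (S.coef_le i w).trans ((S.s_le_e i w).trans (S.e_le_eTot i w))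

theorem abs_loadAt_le (i : ι) (x : κ → ℝ) (w : V) :
    |S.loadAt i x w| ≤ √(∑ k, x k ^ 2) * S.nE w := by
  rw [loadAt_apply, abs_mul, sgn_abs, one_mul]
  refine abs_le_of_sq_le_sq ?_ (mul_nonneg (Real.sqrt_nonneg _) (S.nE_nonneg w))
  rw [mul_pow, Real.sq_sqrt (Finset.sum_nonneg fun k _ => sq_nonneg (x k))]
  refine (Finset.sum_mul_sq_le_sq_mul_sq _ _ _).trans ?_
  exact mul_le_mul_of_nonneg_left (S.sum_coef_sq_le i w)
    (Finset.sum_nonneg fun k _ => sq_nonneg (x k))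

theorem loadAt_null {i : ι} {w : V} (h : S.s i w w = 0) (x : κ → ℝ) : S.loadAt i x w = 0 := by
  rw [loadAt_apply]
  simp [S.coef_null h]

theorem patch_mono (i : ι) {m n : ℕ} (hm : 1 ≤ m) (hmn : m ≤ n) : S.patch i m ⊆ S.patch i n := by
  induction n, hmn using Nat.le_induction with
  | base => exact subset_rfl
  | succ n hn ih => exact ih.trans (S.mono i n (hm.trans hn))

theorem mem_patch (i : ι) {m : ℕ} (hm : 1 ≤ m) : i ∈ S.patch i m :=
  S.patch_mono i le_rfl hm (S.self_mem i)

/-! ### Exponential decay and localization -/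

/-- The energy outside the patch `K̂_i^m`. -/
def out (i : ι) (m : ℕ) (u : V) : ℝ := ∑ j with j ∉ S.patch i m, S.e j u u

theorem out_nonneg (i : ι) (m : ℕ) (u : V) : 0 ≤ S.out i m u :=
  Finset.sum_nonneg fun j _ => S.e_nonneg j u

theorem out_le (i : ι) (m : ℕ) (u : V) : S.out i m u ≤ S.nE u ^ 2 := by
  rw [nE_sq, eTot_apply]
  exact Finset.sum_le_univ_sum_of_nonneg fun j => S.e_nonneg j u

theorem e_congr {j : ι} {u w : V} (h : S.s j (u - w) (u - w) = 0) : S.e j u u = S.e j w w := by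
  have := form_add_eq_of_null (S.e_symm j) (S.e_nonneg j) w (S.e_null h)
  rwa [add_sub_cancel] at this

/-- If `φ` solves the homogeneous equation away from the patch `K̂_i^m`, then the energy of `φ - z`,
where `z` is a cutoff of `φ` at this patch, is controlled by that of `φ` in the layer between
`K̂_i^m` and `K̂_i^{m+1}`. The test function is the reflection of `φ - z`. -/
theorem cutoff_energy_le (hq0 : 0 ≤ q) (hq : q < 1) (hτ0 : 0 ≤ τ) (hτ : τ ≤ (1 - q) / 16)
    {i : ι} {m : ℕ} (hm : 1 ≤ m) {φ z : V}
    (hφ : ∀ w, (∀ j ∈ S.patch i m, S.s j w w = 0) → S.bp φ w = 0)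
    (hz₁ : ∀ j ∈ S.patch i m, S.s j (φ - z) (φ - z) = 0)
    (hz₂ : ∀ j ∉ S.patch i (m + 1), S.s j z z = 0)
    (hz₃ : ∀ j, S.a j z z + S.s j z z ≤ 19 * (S.a j φ φ + S.s j φ φ)) :
    ((1 - q) / 4) ^ 2 * S.nE (φ - z) ^ 2 ≤ 228 * (S.out i m φ - S.out i (m + 1) φ) := by
  set v := φ - z with hv
  set I := S.patch i (m + 1) \ S.patch i m with hI
  have hTv : ∀ j ∈ S.patch i m, S.s j (S.T v) (S.T v) = 0 := by
    intro j hj; rw [T_apply]; exact S.T_outside i m hm v hz₁ j hj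
  have hlayer : ∑ j ∈ I, S.e j φ φ = S.out i m φ - S.out i (m + 1) φ := by
    have hsub : (Finset.univ.filter fun j => j ∉ S.patch i (m + 1)) ⊆
        Finset.univ.filter fun j => j ∉ S.patch i m := by
      intro j hj
      simp only [Finset.mem_filter, Finset.mem_univ, true_and] at hj ⊢
      exact fun h => hj (S.mono i m hm h)
    rw [out, out, ← Finset.sum_sdiff hsub, add_sub_cancel_right]
    refine Finset.sum_congr ?_ fun _ _ => rfl
    ext j
    simp only [hI, Finset.mem_sdiff, Finset.mem_filter, Finset.mem_univ, true_and, not_not]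
    tauto
  have h1 : S.bp v (S.T v) = -S.bp z (S.T v) := by
    rw [hv, map_sub, LinearMap.sub_apply, ← hv, hφ _ hTv, zero_sub]
  have h2 := S.coercive hq0 hq hτ0 hτ v
  have h3 : |S.bp z (S.T v)| ≤ 2 * (√(∑ j ∈ I, S.e j z z) *
      √(∑ j ∈ I, S.e j (S.T v) (S.T v))) := by
    refine S.abs_bp_le_of_support hq.le I fun j hj => ?_
    by_cases h : j ∈ S.patch i m
    · exact Or.inr (hTv j h)
    · refine Or.inl (hz₂ j fun h' => hj ?_)
      exact Finset.mem_sdiff.2 ⟨h', h⟩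
  have h4 : ∑ j ∈ I, S.e j z z ≤ 19 * (S.out i m φ - S.out i (m + 1) φ) := by
    rw [← hlayer, Finset.mul_sum]
    refine Finset.sum_le_sum fun j _ => ?_
    simpa only [e_apply] using hz₃ j
  have h5 : ∑ j ∈ I, S.e j (S.T v) (S.T v) ≤ 3 * S.nE v ^ 2 := by
    refine le_trans ?_ (S.nE_T_sq_le hτ0 (by linarith) v)
    rw [nE_sq, eTot_apply]
    exact Finset.sum_le_univ_sum_of_nonneg fun j => S.e_nonneg j _
  have hL : 0 ≤ S.out i m φ - S.out i (m + 1) φ := by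
    rw [← hlayer]; exact Finset.sum_nonneg fun j _ => S.e_nonneg j φ
  set L := S.out i m φ - S.out i (m + 1) φ with hLdef
  have h6 : (1 - q) / 4 * S.nE v ^ 2 ≤ 2 * (√(19 * L) * √(3 * S.nE v ^ 2)) := by
    refine h2.trans ?_
    rw [h1]
    refine (neg_le_abs _).trans (h3.trans ?_)
    gcongr
  rw [Real.sqrt_mul (by norm_num : (0:ℝ) ≤ 3), Real.sqrt_sq (S.nE_nonneg v)] at h6
  have h7 : (1 - q) / 4 * S.nE v ≤ 2 * (√(19 * L) * √3) := by
    rcases (S.nE_nonneg v).eq_or_lt with h0 | h0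
    · rw [← h0]; simp only [mul_zero]; positivity
    · refine le_of_mul_le_mul_right ?_ h0
      nlinarith
  have h8 := pow_le_pow_left₀ (mul_nonneg (by linarith) (S.nE_nonneg v)) h7 2
  rw [mul_pow, mul_pow, mul_pow, Real.sq_sqrt (by positivity),
    Real.sq_sqrt (by norm_num : (0:ℝ) ≤ 3)] at h8
  linarith

/-- The decay rate. With `γ = (1 - q) / 4`, the cutoff estimate reads `γ² y ≤ 228 (x - y)` for the
energies `x`, `y` outside consecutive patches, hence `y ≤ 228 / (γ² + 228) x`. The constant is
`228 = 2² * 19 * 3`, from the bounds of the stabilized form, the cutoff and the reflection. -/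
noncomputable def rate (q : ℝ) : ℝ := 228 / (((1 - q) / 4) ^ 2 + 228)

theorem rate_pos (q : ℝ) : 0 < rate q := by unfold rate; positivity

theorem rate_lt_one (hq : q < 1) : rate q < 1 := by
  have : 0 < ((1 - q) / 4) ^ 2 := by
    have : 0 < 1 - q := by linarith
    positivity
  unfold rate
  rw [div_lt_one (by positivity)]; linarith

/-- The cutoff estimate bounds the energy outside the next patch by the energy of the layer, that is,
by a difference of consecutive values of `out`; solving for the later value gives a fixed factor
`rate q` for each layer. -/
theorem out_decay (hq0 : 0 ≤ q) (hq : q < 1) (hτ0 : 0 ≤ τ) (hτ : τ ≤ (1 - q) / 16)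
    {i : ι} {φ : V} (hφ : ∀ w, S.s i w w = 0 → S.bp φ w = 0) (m : ℕ) :
    S.out i (m + 1) φ ≤ rate q ^ m * S.nE φ ^ 2 := by
  induction m with
  | zero => simpa using S.out_le i 1 φ
  | succ m ih =>
    obtain ⟨z, hz₁, hz₂, hz₃⟩ := S.cutoff i (m + 1) (by omega) φ
    have h1 := S.cutoff_energy_le hq0 hq hτ0 hτ (by omega)
      (fun w hw => hφ w (hw i (S.mem_patch i (by omega)))) hz₁ hz₂ hz₃
    have h2 : S.out i (m + 1 + 1) φ ≤ S.nE (φ - z) ^ 2 := by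
      refine le_trans (le_of_eq ?_) (S.out_le i (m + 1 + 1) (φ - z))
      refine Finset.sum_congr rfl fun j hj => ?_
      refine S.e_congr ?_
      rw [sub_sub_cancel]
      exact hz₂ j (Finset.mem_filter.1 hj).2
    have h3 := mul_le_mul_of_nonneg_left h2 (sq_nonneg ((1 - q) / 4))
    have h4 : S.out i (m + 1 + 1) φ ≤ rate q * S.out i (m + 1) φ := by
      rw [rate, div_mul_eq_mul_div, le_div_iff₀ (by positivity)]
      linarith
    refine h4.trans ?_
    rw [pow_succ]
    have := mul_le_mul_of_nonneg_left ih (rate_pos q).le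
    linarith

/-- Céa's lemma for the stabilized problem in the patch, combined with the decay of the global
solution `φ`. -/
theorem localization_error (hq0 : 0 ≤ q) (hq : q < 1) (hτ0 : 0 ≤ τ) (hτ : τ ≤ (1 - q) / 16)
    {i : ι} {m : ℕ} (hm : 1 ≤ m) {φ φm : V} (hφ : ∀ w, S.s i w w = 0 → S.bp φ w = 0)
    (hφm : φm ∈ S.localSub i m) (horth : ∀ w ∈ S.localSub i m, S.bp (φ - φm) w = 0) :
    S.nE (φ - φm) ^ 2 ≤
      5725 / ((1 - q) / 4) ^ 4 * (rate q ^ (m - 1) * S.nE φ ^ 2) := by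
  set γ := (1 - q) / 4 with hγ
  have hγ0 : 0 < γ := by rw [hγ]; linarith
  have hγ1 : γ ≤ 1 / 4 := by rw [hγ]; linarith
  -- quasi-optimality in the patch
  have hcea : ∀ z ∈ S.localSub i m, S.nE (φ - φm) ≤ 5 / γ * S.nE (φ - z) := by
    intro z hz
    have hd : z - φm ∈ S.localSub i m := Submodule.sub_mem _ hz hφm
    have h1 := S.coercive hq0 hq hτ0 hτ (z - φm)
    rw [← hγ] at h1
    have h2 : S.bp (z - φm) (S.T (z - φm)) = -S.bp (φ - z) (S.T (z - φm)) := by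
      have := horth _ (S.T_mem_localSub hm hd)
      have e : z - φm = (φ - φm) - (φ - z) := by abel
      conv_lhs => rw [e, map_sub, LinearMap.sub_apply, ← e, this, zero_sub]
    have h3 := S.abs_bp_le hq.le (φ - z) (S.T (z - φm))
    have h4 := S.nE_T_le hτ0 (by linarith) (z - φm)
    have hs3 : √3 ≤ 2 := by rw [Real.sqrt_le_left (by norm_num)]; norm_num
    have n1 := S.nE_nonneg (φ - z)
    have n2 := S.nE_nonneg (z - φm)
    have h5 : γ * S.nE (z - φm) ^ 2 ≤ 2 * (S.nE (φ - z) * (2 * S.nE (z - φm))) := by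
      rw [h2] at h1
      refine h1.trans ((neg_le_abs _).trans (h3.trans ?_))
      refine mul_le_mul_of_nonneg_left (mul_le_mul_of_nonneg_left ?_ n1) (by norm_num)
      exact h4.trans (mul_le_mul_of_nonneg_right hs3 n2)
    have h6 : γ * S.nE (z - φm) ≤ 4 * S.nE (φ - z) := by
      rcases n2.eq_or_lt with h0 | h0
      · rw [← h0]; simpa using n1
      · refine le_of_mul_le_mul_right ?_ h0
        nlinarith
    have h7 : S.nE (φ - φm) ≤ S.nE (φ - z) + S.nE (z - φm) := by
      have := S.nE_add_le (φ - z) (z - φm)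
      rwa [sub_add_sub_cancel] at this
    rw [div_mul_eq_mul_div, le_div_iff₀ hγ0]
    nlinarith
  have hcea2 : ∀ z ∈ S.localSub i m, S.nE (φ - φm) ^ 2 ≤ 25 / γ ^ 2 * S.nE (φ - z) ^ 2 := by
    intro z hz
    have := pow_le_pow_left₀ (S.nE_nonneg _) (hcea z hz) 2
    rw [mul_pow, div_pow] at this
    norm_num at this ⊢
    exact this
  have hr := rate_pos q
  rcases Nat.exists_eq_add_of_le' hm with ⟨n, rfl⟩
  rcases n with _ | n
  -- on the first patch the comparison function is zero
  · have h1 := hcea2 0 (Submodule.zero_mem _)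
    rw [sub_zero] at h1
    refine h1.trans ?_
    simp only [Nat.zero_add, Nat.sub_self, pow_zero, one_mul]
    refine mul_le_mul_of_nonneg_right ?_ (sq_nonneg _)
    rw [div_le_div_iff₀ (by positivity) (by positivity)]
    have : γ ^ 2 ≤ 1 := by nlinarith
    nlinarith [sq_nonneg γ, mul_nonneg (sq_nonneg γ) (sub_nonneg.2 this)]
  · obtain ⟨z, hz₁, hz₂, hz₃⟩ := S.cutoff i (n + 1) (by omega) φ
    have h1 := S.cutoff_energy_le hq0 hq hτ0 hτ (by omega)
      (fun w hw => hφ w (hw i (S.mem_patch i (by omega)))) hz₁ hz₂ hz₃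
    rw [← hγ] at h1
    have h2 := hcea2 z hz₂
    have h3 := S.out_decay hq0 hq hτ0 hτ hφ n
    have h4 := S.out_nonneg i (n + 1 + 1) φ
    have h5 : γ ^ 2 * S.nE (φ - z) ^ 2 ≤ 228 * (rate q ^ n * S.nE φ ^ 2) := by linarith
    have e1 : n + 1 + 1 - 1 = n + 1 := by omega
    rw [e1, pow_succ]
    -- one power of the rate is absorbed by the constant, `5725 = 25 * 229`
    have h6 : 228 ≤ 229 * rate q := by
      rw [rate, ← hγ, mul_div_assoc', le_div_iff₀ (by positivity)]
      nlinarith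
    have h7 : 0 ≤ rate q ^ n * S.nE φ ^ 2 := by positivity
    have h8 : γ ^ 2 * S.nE (φ - z) ^ 2 ≤ 229 * (rate q ^ n * rate q * S.nE φ ^ 2) := by
      refine h5.trans ?_
      nlinarith
    calc S.nE (φ - φm) ^ 2 ≤ 25 / γ ^ 2 * S.nE (φ - z) ^ 2 := h2
      _ = 25 / γ ^ 4 * (γ ^ 2 * S.nE (φ - z) ^ 2) := by field_simp
      _ ≤ 25 / γ ^ 4 * (229 * (rate q ^ n * rate q * S.nE φ ^ 2)) := by gcongr
      _ = _ := by ring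

end LocalizedSystem
namespace LocalizedSystem

variable {V ι κ : Type*} [NormedAddCommGroup V] [InnerProductSpace ℝ V]
  [Fintype ι] [Fintype κ] [DecidableEq ι] {q τ Λ Cl Col : ℝ}
  (S : LocalizedSystem V ι κ q τ Λ Cl Col)

/-! ### Comparison of the global and the localized basis functions -/

/-- The linear combination of a family with given coefficients. -/
def comb (φ : ι → κ → V) : (ι → κ → ℝ) →ₗ[ℝ] V where
  toFun c := ∑ i, ∑ k, c i k • φ i k
  map_add' c d := by simp [add_smul, Finset.sum_add_distrib]
  map_smul' r c := by simp [mul_smul, Finset.smul_sum]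

omit [DecidableEq ι] in
theorem comb_apply (φ : ι → κ → V) (c : ι → κ → ℝ) : comb φ c = ∑ i, ∑ k, c i k • φ i k := rfl

/-- The family `φ` consists of the global basis functions. -/
def IsGlo (φ : ι → κ → V) : Prop := ∀ i k w, S.bp (φ i k) w = S.sgn i * S.coef i k w

/-- The family `φ` consists of the basis functions localized to the patches `K̂_i^m`. -/
def IsLoc (m : ℕ) (φ : ι → κ → V) : Prop := ∀ i k, φ i k ∈ S.localSub i m ∧
  ∀ w ∈ S.localSub i m, S.bp (φ i k) w = S.sgn i * S.coef i k w

variable {S}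

theorem bp_sum_left (c : κ → ℝ) (φ : κ → V) (w : V) :
    S.bp (∑ k, c k • φ k) w = ∑ k, c k * S.bp (φ k) w := by
  simp [map_sum, LinearMap.sum_apply]

theorem IsGlo.bp_sum {φ : ι → κ → V} (h : S.IsGlo φ) (i : ι) (x : κ → ℝ) (w : V) :
    S.bp (∑ k, x k • φ i k) w = S.loadAt i x w := by
  rw [bp_sum_left, loadAt_apply, Finset.mul_sum]
  exact Finset.sum_congr rfl fun k _ => by rw [h]; ring

theorem IsLoc.bp_sum {m : ℕ} {φ : ι → κ → V} (h : S.IsLoc m φ) (i : ι) (x : κ → ℝ) {w : V}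
    (hw : w ∈ S.localSub i m) :
    S.bp (∑ k, x k • φ i k) w = S.loadAt i x w := by
  rw [bp_sum_left, loadAt_apply, Finset.mul_sum]
  exact Finset.sum_congr rfl fun k _ => by rw [(h i k).2 w hw]; ring

theorem IsLoc.sum_mem {m : ℕ} {φ : ι → κ → V} (h : S.IsLoc m φ) (i : ι) (x : κ → ℝ) :
    ∑ k, x k • φ i k ∈ S.localSub i m :=
  Submodule.sum_mem _ fun k _ => Submodule.smul_mem _ _ (h i k).1

theorem IsGlo.bp_comb {φ : ι → κ → V} (h : S.IsGlo φ) (c : ι → κ → ℝ) (w : V) :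
    S.bp (comb φ c) w = ∑ i, S.loadAt i (c i) w := by
  rw [comb_apply, map_sum, LinearMap.sum_apply]
  exact Finset.sum_congr rfl fun i _ => h.bp_sum i (c i) w

/-- Stability of the stabilized problem with data in a single element. -/
theorem IsGlo.nE_sum_sq_le (hq0 : 0 ≤ q) (hq : q < 1) (hτ0 : 0 ≤ τ) (hτ : τ ≤ (1 - q) / 16)
    {φ : ι → κ → V} (h : S.IsGlo φ) (i : ι) (x : κ → ℝ) :
    S.nE (∑ k, x k • φ i k) ^ 2 ≤ 3 / ((1 - q) / 4) ^ 2 * ∑ k, x k ^ 2 := by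
  set u := ∑ k, x k • φ i k with hu
  have hγ0 : 0 < (1 - q) / 4 := by linarith
  have h1 := S.coercive hq0 hq hτ0 hτ u
  rw [hu, h.bp_sum, ← hu] at h1
  have h2 := (le_abs_self _).trans (S.abs_loadAt_le i x (S.T u))
  have h3 := S.nE_T_le hτ0 (by linarith) u
  have hx0 : 0 ≤ ∑ k, x k ^ 2 := Finset.sum_nonneg fun k _ => sq_nonneg _
  have h4 : (1 - q) / 4 * S.nE u ≤ √(∑ k, x k ^ 2) * √3 := by
    rcases (S.nE_nonneg u).eq_or_lt with h0 | h0
    · rw [← h0, mul_zero]; positivity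
    · refine le_of_mul_le_mul_right ?_ h0
      have := mul_le_mul_of_nonneg_left h3 (Real.sqrt_nonneg (∑ k, x k ^ 2))
      nlinarith
  have h5 := pow_le_pow_left₀ (mul_nonneg hγ0.le (S.nE_nonneg u)) h4 2
  rw [mul_pow, mul_pow, Real.sq_sqrt hx0, Real.sq_sqrt (by norm_num : (0:ℝ) ≤ 3)] at h5
  rw [div_mul_eq_mul_div, le_div_iff₀ (by positivity)]
  linarith

/-- Summation of the localization errors. The error on the `i`-th patch only interacts with a layer
around that patch, so the bounded overlap of the patches applies. -/
theorem nE_comb_sub_sq_le (hq0 : 0 ≤ q) (hq : q < 1) (hτ0 : 0 ≤ τ) (hτ : τ ≤ (1 - q) / 16)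
    (hCol : 0 ≤ Col) {m : ℕ} (hm : 1 ≤ m) {φ ψ : ι → κ → V} (hφ : S.IsGlo φ) (hψ : S.IsLoc m ψ)
    (c : ι → κ → ℝ) :
    S.nE (comb φ c - comb ψ c) ^ 2 ≤ 3915900 * Col / ((1 - q) / 4) ^ 8 * ((m : ℝ) + 1) ^ 2 *
      rate q ^ (m - 1) * ∑ i, ∑ k, c i k ^ 2 := by
  set γ := (1 - q) / 4 with hγ
  have hγ0 : 0 < γ := by rw [hγ]; linarith
  set d : ι → V := fun i => ∑ k, c i k • φ i k - ∑ k, c i k • ψ i k with hd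
  set D := comb φ c - comb ψ c with hD
  have hDd : D = ∑ i, d i := by
    rw [hD, comb_apply, comb_apply, hd, Finset.sum_sub_distrib]
  -- the single errors
  have h1 : ∀ i, S.nE (d i) ^ 2 ≤
      17175 / γ ^ 6 * rate q ^ (m - 1) * ∑ k, c i k ^ 2 := by
    intro i
    have a1 := S.localization_error hq0 hq hτ0 hτ hm
      (φ := ∑ k, c i k • φ i k) (φm := ∑ k, c i k • ψ i k)
      (fun w hw => by rw [hφ.bp_sum, S.loadAt_null hw]) (hψ.sum_mem i _)
      (fun w hw => by rw [map_sub, LinearMap.sub_apply, hφ.bp_sum, hψ.bp_sum i _ hw, sub_self])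
    rw [← hγ] at a1
    refine a1.trans ?_
    have a2 := hφ.nE_sum_sq_le hq0 hq hτ0 hτ i (c i)
    rw [← hγ] at a2
    have hr := (pow_pos (rate_pos q) (m - 1)).le
    calc 5725 / γ ^ 4 * (rate q ^ (m - 1) * S.nE (∑ k, c i k • φ i k) ^ 2)
        ≤ 5725 / γ ^ 4 * (rate q ^ (m - 1) * (3 / γ ^ 2 * ∑ k, c i k ^ 2)) := by gcongr
      _ = _ := by field_simp; ring
  have h2 : ∑ i, S.nE (d i) ^ 2 ≤ 17175 / γ ^ 6 * rate q ^ (m - 1) * ∑ i, ∑ k, c i k ^ 2 := by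
    rw [Finset.mul_sum]; exact Finset.sum_le_sum fun i _ => h1 i
  -- interaction of one error with the test function
  have h3 : ∀ i, S.bp (d i) (S.T D) ≤
      2 * (√(S.nE (d i) ^ 2) * √(19 * ∑ j ∈ S.patch i (m + 1), S.e j (S.T D) (S.T D))) := by
    intro i
    obtain ⟨z, hz₁, hz₂, hz₃⟩ := S.cutoff i m hm (S.T D)
    have a1 : S.bp (d i) (S.T D - z) = 0 := by
      change S.bp (_ - _) _ = 0
      rw [LinearMap.map_sub₂, hφ.bp_sum, S.loadAt_null (hz₁ i (S.mem_patch i hm))]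
      have : |S.bp (∑ k, c i k • ψ i k) (S.T D - z)| ≤ _ :=
        S.abs_bp_le_of_support hq.le ∅ fun j _ => by
          by_cases hj : j ∈ S.patch i m
          · exact Or.inr (hz₁ j hj)
          · exact Or.inl (hψ.sum_mem i _ j hj)
      simp only [Finset.sum_empty, Real.sqrt_zero, mul_zero] at this
      rw [abs_nonpos_iff.1 this, sub_zero]
    have a2 : S.bp (d i) (S.T D) = S.bp (d i) z := by
      rw [map_sub] at a1; linarith
    have a3 := S.abs_bp_le_of_support hq.le (S.patch i (m + 1)) (u := d i) (w := z)
      fun j hj => Or.inr (hz₂ j hj)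
    rw [a2]
    refine (le_abs_self _).trans (a3.trans ?_)
    gcongr
    · rw [nE_sq, eTot_apply]
      exact Finset.sum_le_univ_sum_of_nonneg fun j => S.e_nonneg j _
    · rw [Finset.mul_sum]
      exact Finset.sum_le_sum fun j _ => by simpa only [e_apply] using hz₃ j
  have h4 : ∑ i, ∑ j ∈ S.patch i (m + 1), S.e j (S.T D) (S.T D) ≤
      Col * ((m : ℝ) + 1) ^ 2 * (3 * S.nE D ^ 2) := by
    calc ∑ i, ∑ j ∈ S.patch i (m + 1), S.e j (S.T D) (S.T D)
        = ∑ j, ∑ i with j ∈ S.patch i (m + 1), S.e j (S.T D) (S.T D) := by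
          refine Finset.sum_comm' fun i j => ?_
          simp
      _ ≤ ∑ j, Col * ((m : ℝ) + 1) ^ 2 * S.e j (S.T D) (S.T D) := by
          refine Finset.sum_le_sum fun j _ => ?_
          rw [Finset.sum_const, nsmul_eq_mul]
          have := S.overlap j (m + 1) (by omega)
          push_cast at this
          exact mul_le_mul_of_nonneg_right this (S.e_nonneg j _)
      _ ≤ _ := by
          rw [← Finset.mul_sum, ← eTot_apply, ← nE_sq]
          exact mul_le_mul_of_nonneg_left (S.nE_T_sq_le hτ0 (by linarith) D) (by positivity)
  have h5 : γ * S.nE D ^ 2 ≤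
      2 * (√(∑ i, S.nE (d i) ^ 2) * √(19 * (Col * ((m : ℝ) + 1) ^ 2 * (3 * S.nE D ^ 2)))) := by
    have a1 := S.coercive hq0 hq hτ0 hτ D
    rw [← hγ] at a1
    have a2 : S.bp D (S.T D) = ∑ i, S.bp (d i) (S.T D) := by
      conv_lhs => rw [hDd, map_sum, LinearMap.sum_apply, ← hDd]
    rw [a2] at a1
    refine a1.trans ((Finset.sum_le_sum fun i _ => h3 i).trans ?_)
    rw [← Finset.mul_sum]
    refine mul_le_mul_of_nonneg_left ?_ (by norm_num)
    refine (sum_mul_le_sqrt _ (fun i => sq_nonneg _) fun i => ?_).trans ?_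
    · exact mul_nonneg (by norm_num) (Finset.sum_nonneg fun j _ => S.e_nonneg j _)
    · rw [← Finset.mul_sum]; gcongr
  have e1 : 19 * (Col * ((m : ℝ) + 1) ^ 2 * (3 * S.nE D ^ 2)) =
      57 * Col * ((m : ℝ) + 1) ^ 2 * S.nE D ^ 2 := by ring
  rw [e1, Real.sqrt_mul (by positivity), Real.sqrt_sq (S.nE_nonneg D)] at h5
  have h6 : γ * S.nE D ≤
      2 * (√(∑ i, S.nE (d i) ^ 2) * √(57 * Col * ((m : ℝ) + 1) ^ 2)) := by
    rcases (S.nE_nonneg D).eq_or_lt with h0 | h0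
    · rw [← h0, mul_zero]; positivity
    · refine le_of_mul_le_mul_right ?_ h0
      nlinarith
  have h7 := pow_le_pow_left₀ (mul_nonneg hγ0.le (S.nE_nonneg D)) h6 2
  rw [mul_pow, mul_pow, mul_pow, Real.sq_sqrt (Finset.sum_nonneg fun i _ => sq_nonneg _),
    Real.sq_sqrt (by positivity)] at h7
  have h8 : 0 ≤ 57 * Col * ((m : ℝ) + 1) ^ 2 := by positivity
  calc S.nE D ^ 2 = (γ ^ 2 * S.nE D ^ 2) / γ ^ 2 := by field_simp
    _ ≤ (2 ^ 2 * ((17175 / γ ^ 6 * rate q ^ (m - 1) * ∑ i, ∑ k, c i k ^ 2) *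
        (57 * Col * ((m : ℝ) + 1) ^ 2))) / γ ^ 2 := by
        exact div_le_div_of_nonneg_right (h7.trans (by gcongr)) (by positivity)
    _ = _ := by field_simp; ring

/-- Every element of the auxiliary space is the projection of some `w ∈ V` with a comparable full
energy. -/
theorem exists_lift (c : ι → κ → ℝ) : ∃ w, (∀ j k, S.coef j k w = c j k) ∧
    S.nE w ^ 2 ≤ (2 * Cl ^ 2 + 1) * ∑ i, ∑ k, c i k ^ 2 := by
  obtain ⟨w, h1, h2⟩ := S.lift c
  refine ⟨w, h1, ?_⟩
  have h3 := S.sTot_le w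
  have h4 : ∑ j, S.p j w w = ∑ i, ∑ k, c i k ^ 2 := by simp only [p_self, h1]
  rw [← aTot_apply] at h2
  rw [nE_sq, eTot_eq]
  linarith

/-- The coefficients of a combination of global basis functions are bounded by its energy: tested with
a lifting of the coefficients `± c`, the stabilized form returns the sum of their squares. -/
theorem IsGlo.sum_sq_le (hq : q < 1) {φ : ι → κ → V} (hφ : S.IsGlo φ) (c : ι → κ → ℝ) :
    ∑ i, ∑ k, c i k ^ 2 ≤ 4 * (2 * Cl ^ 2 + 1) * S.nE (comb φ c) ^ 2 := by
  obtain ⟨w, h1, h2⟩ := S.exists_lift fun i k => S.sgn i * c i k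
  have h3 : ∑ i, ∑ k, (S.sgn i * c i k) ^ 2 = ∑ i, ∑ k, c i k ^ 2 := by
    refine Finset.sum_congr rfl fun i _ => Finset.sum_congr rfl fun k _ => ?_
    rw [mul_pow, sq (S.sgn i), S.sgn_mul_self, one_mul]
  rw [h3] at h2
  have h4 : S.bp (comb φ c) w = ∑ i, ∑ k, c i k ^ 2 := by
    rw [hφ.bp_comb]
    refine Finset.sum_congr rfl fun i _ => ?_
    rw [loadAt_apply, Finset.mul_sum]
    refine Finset.sum_congr rfl fun k _ => ?_
    rw [h1]
    linear_combination c i k ^ 2 * S.sgn_mul_self i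
  have h5 := (le_abs_self _).trans (S.abs_bp_le hq.le (comb φ c) w)
  rw [h4] at h5
  set N := ∑ i, ∑ k, c i k ^ 2
  have hN : 0 ≤ N := Finset.sum_nonneg fun i _ => Finset.sum_nonneg fun k _ => sq_nonneg _
  have h6 := pow_le_pow_left₀ hN h5 2
  have h7 : N ^ 2 ≤ (4 * (2 * Cl ^ 2 + 1) * S.nE (comb φ c) ^ 2) * N := by
    refine h6.trans ?_
    rw [mul_pow, mul_pow]
    have := mul_le_mul_of_nonneg_left h2 (sq_nonneg (S.nE (comb φ c)))
    linarith
  rcases hN.eq_or_lt with h0 | h0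
  · rw [← h0]; positivity
  · refine le_of_mul_le_mul_right ?_ h0
    rwa [← sq]

/-- The constant of the localization error: the square root of the factor in the summed error,
`3915900 = 4 * 17175 * 57`, times the bound of the coefficients by the energy. -/
noncomputable def locConst (q Cl Col : ℝ) : ℝ :=
  √(3915900 * Col / ((1 - q) / 4) ^ 8 * (4 * (2 * Cl ^ 2 + 1)))

/-- Global functions and their localized counterparts differ by an exponentially small relative
error. -/
theorem nE_comb_sub_le (hq0 : 0 ≤ q) (hq : q < 1) (hτ0 : 0 ≤ τ) (hτ : τ ≤ (1 - q) / 16)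
    (hCol : 0 ≤ Col) {m : ℕ} (hm : 1 ≤ m) {φ ψ : ι → κ → V} (hφ : S.IsGlo φ) (hψ : S.IsLoc m ψ)
    (c : ι → κ → ℝ) :
    S.nE (comb φ c - comb ψ c) ≤ locConst q Cl Col * ((m : ℝ) + 1) * √(rate q ^ (m - 1)) *
      S.nE (comb φ c) := by
  have hγ0 : 0 < (1 - q) / 4 := by linarith
  have h1 := nE_comb_sub_sq_le hq0 hq hτ0 hτ hCol hm hφ hψ c
  have h2 := hφ.sum_sq_le hq c
  have hr := (pow_pos (rate_pos q) (m - 1)).le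
  refine abs_le_of_sq_le_sq' ?_ ?_ |>.2
  · rw [mul_pow, mul_pow, mul_pow, Real.sq_sqrt hr, locConst, Real.sq_sqrt (by positivity)]
    refine h1.trans ?_
    calc _ ≤ 3915900 * Col / ((1 - q) / 4) ^ 8 * ((m : ℝ) + 1) ^ 2 *
        rate q ^ (m - 1) * (4 * (2 * Cl ^ 2 + 1) * S.nE (comb φ c) ^ 2) := by gcongr
      _ = _ := by ring
  · have := S.nE_nonneg (comb φ c)
    unfold locConst
    positivity

/-! ### Inf-sup conditions -/

variable (S)

/-- The inf-sup condition with the constant `β` on `X`: a bound on the functional `b u` restricted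
to `X` bounds `u`. -/
def InfSup (X : Set V) (β : ℝ) : Prop :=
  ∀ u ∈ X, ∀ t, 0 ≤ t → (∀ w ∈ X, S.b u w ≤ t * S.nA w) → β * S.nA u ≤ t

/-- The space of the elements with a vanishing projection. -/
def ker : Submodule ℝ V where
  carrier := {u | ∀ j k, S.coef j k u = 0}
  add_mem' hu hw j k := by simp [hu j k, hw j k]
  zero_mem' j k := by simp
  smul_mem' c u hu j k := by simp [hu j k]

variable {S}

theorem mem_ker {u : V} : u ∈ S.ker ↔ ∀ j k, S.coef j k u = 0 := Iff.rfl

theorem p_of_mem_ker {u : V} (hu : u ∈ S.ker) (j : ι) (w : V) : S.p j w u = 0 := by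
  rw [p_apply]; simp [mem_ker.1 hu]

theorem bp_of_mem_ker {u : V} (hu : u ∈ S.ker) (w : V) : S.bp w u = S.b w u := by
  rw [bp_eq]; simp [p_of_mem_ker hu]

/-- On the kernel of the projection, the reflected function leaves the kernel only by an amount that
is small for a large contrast; the local liftings correct it. -/
theorem infSup_ker (hq0 : 0 ≤ q) (hq : q < 1) (hτ0 : 0 ≤ τ) (hτ : τ ≤ (1 - q) / 16)
    (hτ2 : (2 * Cl ^ 2 + 1) * (4 * τ ^ 2) ≤ ((1 - q) / 4 / 4) ^ 2) :
    S.InfSup (S.ker : Set V) ((1 - q) / 4 / 6) := by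
  intro u hu t ht hw
  set γ := (1 - q) / 4 with hγ
  have hγ0 : 0 < γ := by rw [hγ]; linarith
  obtain ⟨z, hz1, hz2⟩ := S.exists_lift fun j k => S.coef j k (S.T u)
  have hP : ∑ j, ∑ k, S.coef j k (S.T u) ^ 2 ≤ 4 * τ ^ 2 * S.nE u ^ 2 := by
    rw [S.sum_sgn]
    have hp : ∑ j with S.sgn j = 1, ∑ k, S.coef j k (S.T u) ^ 2 = 0 := by
      refine Finset.sum_eq_zero fun j hj => Finset.sum_eq_zero fun k _ => ?_
      have := S.coef_null (S.T_plus (Finset.mem_filter.1 hj).2 u) k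
      rw [map_sub, mem_ker.1 hu, sub_zero] at this
      rw [this]; norm_num
    have hm : ∑ j with S.sgn j = -1, ∑ k, S.coef j k (S.T u) ^ 2 ≤
        4 * ∑ j with S.sgn j = -1, S.s j (S.R u) (S.R u) := by
      rw [Finset.mul_sum]
      refine Finset.sum_le_sum fun j _ => ?_
      refine le_trans (le_of_eq ?_) (mul_le_mul_of_nonneg_left (S.coef_le j (S.R u))
        (by norm_num : (0:ℝ) ≤ 4))
      rw [Finset.mul_sum]
      refine Finset.sum_congr rfl fun k _ => ?_
      rw [T_apply, map_add, map_neg, mem_ker.1 hu, map_smul, smul_eq_mul]; ring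
    have hs := S.R_s u
    rw [← sTot_apply] at hs
    have h1 := S.aTot_nonneg u
    have h2 := mul_nonneg (sq_nonneg τ) h1
    rw [hp, zero_add, nE_sq, eTot_eq]
    linarith
  have hzE : S.nE z ≤ γ / 4 * S.nE u := by
    refine abs_le_of_sq_le_sq' ?_ (mul_nonneg (by linarith) (S.nE_nonneg u)) |>.2
    rw [mul_pow]
    calc S.nE z ^ 2 ≤ (2 * Cl ^ 2 + 1) * (4 * τ ^ 2 * S.nE u ^ 2) :=
          hz2.trans (mul_le_mul_of_nonneg_left hP (by positivity))
      _ = ((2 * Cl ^ 2 + 1) * (4 * τ ^ 2)) * S.nE u ^ 2 := by ring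
      _ ≤ _ := mul_le_mul_of_nonneg_right hτ2 (sq_nonneg _)
  have hmem : S.T u - z ∈ S.ker := fun j k => by rw [map_sub, hz1, sub_self]
  have h1 := hw _ hmem
  have h2 := S.coercive hq0 hq hτ0 hτ u
  rw [bp_symm, bp_of_mem_ker hu, b_symm, ← hγ] at h2
  have h3 := (le_abs_self _).trans (S.abs_b_le hq.le u z)
  have n0 := S.nE_nonneg u
  have h4 : S.nA (S.T u - z) ≤ 3 * S.nE u := by
    have a1 := S.nE_T_le hτ0 (by linarith) u
    have hs3 : √3 ≤ 2 := by rw [Real.sqrt_le_left (by norm_num)]; norm_num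
    have a2 := mul_le_mul_of_nonneg_right hs3 n0
    have a3 := (S.nA_le_nE _).trans (S.nE_sub_le (S.T u) z)
    have a4 : γ / 4 * S.nE u ≤ 1 * S.nE u := mul_le_mul_of_nonneg_right (by linarith) n0
    linarith
  have h5 := mul_le_mul_of_nonneg_left h4 ht
  have h6 := mul_le_mul_of_nonneg_left hzE n0
  rw [map_sub] at h1
  have h7 : γ / 6 * S.nE u ≤ t := by
    rcases n0.eq_or_lt with h0 | h0
    · rw [← h0, mul_zero]; exact ht
    · refine le_of_mul_le_mul_right ?_ h0
      nlinarith [sq_nonneg (S.nE u)]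
  exact (mul_le_mul_of_nonneg_left (S.nA_le_nE u) (by linarith)).trans h7

theorem InfSup.eq_zero {X : Set V} {β : ℝ} (h : S.InfSup X β) (hβ : 0 < β) {u : V} (hu : u ∈ X)
    (h0 : ∀ w ∈ X, S.b u w = 0) : u = 0 := by
  have := h u hu 0 le_rfl fun w hw => by rw [h0 w hw]; simp
  exact S.nA_eq_zero (le_antisymm (by nlinarith) (S.nA_nonneg u))

/-- The global functions are orthogonal to the kernel of the projection in the sign-changing form,
because there the stabilization vanishes. -/
theorem IsGlo.b_comb_ker {φ : ι → κ → V} (hφ : S.IsGlo φ) (c : ι → κ → ℝ) {w : V}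
    (hw : w ∈ S.ker) : S.b (comb φ c) w = 0 := by
  rw [← bp_of_mem_ker hw, hφ.bp_comb]
  simp [loadAt_apply, mem_ker.1 hw]

/-- The space `V` is the sum of the kernel of the projection and of the span of the global basis
functions. -/
theorem IsGlo.exists_decomp (hq : q < 1) {φ : ι → κ → V} (hφ : S.IsGlo φ) {β : ℝ} (hβ : 0 < β)
    (hker : S.InfSup (S.ker : Set V) β) (v : V) : ∃ u ∈ S.ker, ∃ c, v = u + comb φ c := by
  let f : (ι → κ → ℝ) →ₗ[ℝ] (ι → κ → ℝ) :=
    LinearMap.pi fun i => LinearMap.pi fun k => S.coef i k ∘ₗ comb φ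
  have hf : ∀ c i k, f c i k = S.coef i k (comb φ c) := fun c i k => rfl
  have hinj : Function.Injective f := by
    rw [← LinearMap.ker_eq_bot, LinearMap.ker_eq_bot']
    intro c hc
    have h1 : comb φ c ∈ S.ker := fun j k => by rw [← hf, hc]; rfl
    have h2 := hker.eq_zero hβ h1 fun w hw => hφ.b_comb_ker c hw
    have h3 := hφ.sum_sq_le hq c
    rw [h2, nE_zero] at h3
    have h4 : ∑ i, ∑ k, c i k ^ 2 = 0 := le_antisymm (by linarith)
      (Finset.sum_nonneg fun i _ => Finset.sum_nonneg fun k _ => sq_nonneg _)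
    funext i k
    rw [Finset.sum_eq_zero_iff_of_nonneg
      fun i _ => Finset.sum_nonneg fun k _ => sq_nonneg _] at h4
    have h5 := h4 i (Finset.mem_univ i)
    rw [Finset.sum_eq_zero_iff_of_nonneg fun k _ => sq_nonneg _] at h5
    simpa using h5 k (Finset.mem_univ k)
  -- the coefficients of `v` are those of some combination by a dimension count
  obtain ⟨c, hc⟩ := LinearMap.surjective_of_injective hinj fun i k => S.coef i k v
  refine ⟨v - comb φ c, fun j k => ?_, c, by abel⟩
  rw [map_sub, ← hf, hc, sub_self]

/-- A nondegenerate form on a finite-dimensional space satisfies an inf-sup condition. -/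
theorem exists_infSup_of_finiteDimensional (X : Submodule ℝ V) [FiniteDimensional ℝ X]
    (h : ∀ u ∈ X, (∀ w ∈ X, S.b u w = 0) → u = 0) : ∃ β, 0 < β ∧ S.InfSup (X : Set V) β := by
  obtain ⟨C₁, hC₁, h₁⟩ := S.exists_nE_le
  let g : X →ₗ[ℝ] (X →L[ℝ] ℝ) :=
    LinearMap.toContinuousLinearMap.toLinearMap ∘ₗ (S.b.domRestrict₁₂ X X)
  have hg : ∀ u w : X, g u w = S.b u w := fun u w => rfl
  have hker : LinearMap.ker g = ⊥ := by
    rw [LinearMap.ker_eq_bot']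
    intro u hu
    have := h u u.2 fun w hw => by
      rw [← hg u ⟨w, hw⟩, hu]; rfl
    exact Subtype.ext this
  obtain ⟨K, hK, hanti⟩ := LinearMap.exists_antilipschitzWith (𝕜 := ℝ) (E := X) (F := X →L[ℝ] ℝ) g hker
  have hKr : (0 : ℝ) < K := hK
  refine ⟨(C₁ * (K * C₁))⁻¹, by positivity, fun u hu t ht hw => ?_⟩
  have a1 : ‖g ⟨u, hu⟩‖ ≤ t * C₁ := by
    refine ContinuousLinearMap.opNorm_le_bound _ (by positivity) fun w => ?_
    rw [hg, Real.norm_eq_abs]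
    have b1 := (S.nA_le_nE (w : V)).trans (h₁ w)
    have b2 : t * S.nA (w : V) ≤ t * C₁ * ‖w‖ := by
      rw [mul_assoc]; exact mul_le_mul_of_nonneg_left b1 ht
    refine abs_le.2 ⟨?_, (hw w w.2).trans b2⟩
    have b3 := hw (-w : X) (-w).2
    rw [Submodule.coe_neg, map_neg, nA, sqrt_form_neg, ← nA] at b3
    linarith
  have a2 : ‖u‖ ≤ K * ‖g ⟨u, hu⟩‖ := ZeroHomClass.bound_of_antilipschitz g hanti ⟨u, hu⟩
  have a3 := (S.nA_le_nE u).trans (h₁ u)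
  rw [inv_mul_le_iff₀ (by positivity)]
  refine a3.trans ?_
  rw [mul_assoc]
  refine mul_le_mul_of_nonneg_left ?_ hC₁.le
  refine a2.trans ?_
  rw [mul_assoc]
  exact mul_le_mul_of_nonneg_left (a1.trans_eq (mul_comm _ _)) hKr.le

/-- As `V` splits into the kernel and the span of the global functions, orthogonally for `b`, the form
inherits its nondegeneracy on that finite-dimensional span. The constant is not explicit. -/
theorem IsGlo.exists_infSup_range (hq : q < 1) {φ : ι → κ → V} (hφ : S.IsGlo φ) {β : ℝ}
    (hβ : 0 < β) (hker : S.InfSup (S.ker : Set V) β)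
    (hwp : ∀ u, (∀ w, S.b u w = 0) → u = 0) :
    ∃ β, 0 < β ∧ S.InfSup (LinearMap.range (comb φ) : Set V) β := by
  refine exists_infSup_of_finiteDimensional _ fun u hu h0 => hwp u fun w => ?_
  obtain ⟨c, rfl⟩ := hu
  obtain ⟨v, hv, d, rfl⟩ := hφ.exists_decomp hq hβ hker w
  rw [map_add, hφ.b_comb_ker c hv, zero_add]
  exact h0 _ ⟨d, rfl⟩

theorem InfSup.existsUnique {X : Submodule ℝ V} [FiniteDimensional ℝ X] {β : ℝ}
    (h : S.InfSup (X : Set V) β) (hβ : 0 < β) (F : V →ₗ[ℝ] ℝ) :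
    ∃! u, u ∈ X ∧ ∀ w ∈ X, S.b u w = F w := by
  let g : X →ₗ[ℝ] Module.Dual ℝ X := S.b.domRestrict₁₂ X X
  have hg : ∀ u w : X, g u w = S.b u w := fun u w => rfl
  have hinj : Function.Injective g := by
    rw [← LinearMap.ker_eq_bot, LinearMap.ker_eq_bot']
    intro u hu
    refine Subtype.ext (h.eq_zero hβ u.2 fun w hw => ?_)
    rw [← hg u ⟨w, hw⟩, hu]; rfl
  have hsurj := (LinearMap.injective_iff_surjective_of_finrank_eq_finrank
    (Subspace.dual_finrank_eq (K := ℝ) (V := X)).symm).1 hinj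
  obtain ⟨u, hu⟩ := hsurj (F ∘ₗ X.subtype)
  refine ⟨u, ⟨u.2, fun w hw => ?_⟩, fun u' hu' => ?_⟩
  · rw [← hg u ⟨w, hw⟩, hu]; rfl
  · have : (⟨u', hu'.1⟩ : X) = u := hinj <| by
      rw [hu]; ext w; exact hu'.2 w w.2
    rw [← this]

/-! ### Transfer to the localized space and quasi-optimality -/

/-- Continuity of the form limits every inf-sup constant of a nontrivial space. -/
theorem InfSup.le_sq {X : Set V} {β x : ℝ} (h : S.InfSup X β) (hq : q ≤ 1) (hx : 0 ≤ x)
    (hnE : ∀ u, S.nE u ≤ x * S.nA u) {u : V} (hu : u ∈ X) (hu0 : u ≠ 0) : β ≤ x ^ 2 := by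
  have h1 := h u hu (x ^ 2 * S.nA u) (mul_nonneg (sq_nonneg x) (S.nA_nonneg u)) fun w _ => by
    refine (le_abs_self _).trans ((S.abs_b_le hq u w).trans ?_)
    refine (mul_le_mul (hnE u) (hnE w) (S.nE_nonneg w)
      (mul_nonneg hx (S.nA_nonneg u))).trans_eq ?_
    ring
  exact le_of_mul_le_mul_right h1 (S.nA_pos hu0)

/-- As the sign-changing form is bounded by `x²`, the smallness of `α η` relative to `β` makes the
localization error small in absolute terms. -/
theorem locError_small {α β η ε x : ℝ} (hq : q < 1) {φ : ι → κ → V} (hφ : S.IsGlo φ) (hx : 1 ≤ x)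
    (hα : 1 ≤ α) (hε : 0 ≤ ε) (hη : 100 * x ^ 2 * ε ≤ η) (hβ : 0 < β / 4 - 9 * α * η / 4 - 3 * α * η / 2)
    (hnE : ∀ u, S.nE u ≤ x * S.nA u) (hker : S.InfSup (S.ker : Set V) β)
    (hglo : S.InfSup (LinearMap.range (comb φ) : Set V) β) {v : V} (hv : v ≠ 0) :
    ε ≤ 1 / 4 := by
  have hη0 : 0 ≤ η := le_trans (by positivity) hη
  have hαη : η ≤ α * η := le_mul_of_one_le_left hη0 hα
  have hβ0 : 0 < β := by nlinarith
  have hx0 : 0 ≤ x := by linarith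
  have hβx : β ≤ x ^ 2 := by
    obtain ⟨u, hu, c, huc⟩ := hφ.exists_decomp hq hβ0 hker v
    by_cases hu0 : u = 0
    · have : comb φ c ≠ 0 := fun h => hv (by rw [huc, hu0, h, add_zero])
      exact hglo.le_sq hq.le hx0 hnE ⟨c, rfl⟩ this
    · exact hker.le_sq hq.le hx0 hnE hu hu0
  have h1 : 0 < x ^ 2 := by positivity
  by_contra! h2
  nlinarith

/-- The inf-sup condition on the span of the global functions passes to the span of the localized
ones: a test function of the former is replaced by its localized counterpart, and the three errors
are absorbed by `η`. -/
theorem infSup_range_of_close {α β η ε x : ℝ} (hq : q < 1) {φ ψ : ι → κ → V} (hφ : S.IsGlo φ)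
    (hx : 1 ≤ x) (hα : 1 ≤ α) (hε : 0 ≤ ε) (hη : 100 * x ^ 2 * ε ≤ η)
    (hβ : 0 < β / 4 - 9 * α * η / 4 - 3 * α * η / 2)
    (hnE : ∀ u, S.nE u ≤ x * S.nA u) (hker : S.InfSup (S.ker : Set V) β)
    (hglo : S.InfSup (LinearMap.range (comb φ) : Set V) β)
    (hclose : ∀ c, S.nE (comb φ c - comb ψ c) ≤ ε * S.nA (comb φ c)) :
    S.InfSup (LinearMap.range (comb ψ) : Set V) (β / 4 - 9 * α * η / 4 - 3 * α * η / 2) := by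
  rintro _ ⟨c, rfl⟩ t ht hw
  by_cases h0 : comb ψ c = 0
  · rw [h0, nA_zero, mul_zero]; exact ht
  have hε1 := locError_small hq hφ hx hα hε hη hβ hnE hker hglo h0
  have hη0 : 0 ≤ η := le_trans (by positivity) hη
  have hαη : η ≤ α * η := le_mul_of_one_le_left hη0 hα
  have hx0 : 0 ≤ x := by linarith
  set g := comb φ c with hg
  set u := comb ψ c with hu
  have ng := S.nA_nonneg g
  have hgu := hclose c
  have huE : S.nE u ≤ (x + ε) * S.nA g := by
    have := S.nE_sub_le g (g - u)
    rw [sub_sub_cancel] at this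
    have := hnE g
    linarith
  have huA : S.nA u ≤ (1 + ε) * S.nA g := by
    have h1 := S.nA_sub_le g (g - u)
    rw [sub_sub_cancel] at h1
    have := S.nA_le_nE (g - u)
    linarith
  have h1 := hglo g ⟨c, rfl⟩ (t * (1 + ε) + (x + ε) * ε * S.nA g + ε * x * S.nA g)
    (by positivity) (by
      rintro _ ⟨d, rfl⟩
      set wg := comb φ d
      set wm := comb ψ d
      have nw := S.nA_nonneg wg
      have e : S.b g wg = S.b u wm + S.b u (wg - wm) + S.b (g - u) wg := by
        simp only [map_sub, LinearMap.sub_apply]; ring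
      have a1 := hw wm ⟨d, rfl⟩
      have a2 := (le_abs_self _).trans (S.abs_b_le hq.le u (wg - wm))
      have a3 := (le_abs_self _).trans (S.abs_b_le hq.le (g - u) wg)
      have a4 : S.nA wm ≤ (1 + ε) * S.nA wg := by
        have h1 := S.nA_sub_le wg (wg - wm)
        rw [sub_sub_cancel] at h1
        have := S.nA_le_nE (wg - wm)
        have := hclose d
        linarith
      have a5 := mul_le_mul_of_nonneg_left a4 ht
      have a6 := mul_le_mul huE (hclose d) (S.nE_nonneg _) (by positivity)
      have a7 := mul_le_mul hgu (hnE wg) (S.nE_nonneg _) (by positivity)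
      rw [e]
      linarith)
  have hxε : x * ε ≤ x ^ 2 * ε :=
    mul_le_mul_of_nonneg_right (by rw [sq]; exact le_mul_of_one_le_left hx0 hx) hε
  have hεx : ε ≤ x * ε := le_mul_of_one_le_left hε hx
  have hεε : ε * ε ≤ 1 / 4 * ε := mul_le_mul_of_nonneg_right hε1 hε
  have h2 : (x + ε) * ε + ε * x ≤ η := by linarith
  have h3 : (β - η) * S.nA g ≤ 2 * t := by nlinarith
  have h4 : (β - η) * S.nA u ≤ 4 * t := by
    have h5 : 0 ≤ β - η := by nlinarith
    have h6 := mul_le_mul_of_nonneg_left huA h5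
    nlinarith [mul_nonneg h5 ng]
  have nu := S.nA_nonneg u
  nlinarith [mul_nonneg (sub_nonneg.2 hαη) nu, mul_nonneg hη0 nu]

/-- Quasi-optimality. The error `e` is split along `ker` and the span of the global basis functions:
the second part is small since `e` is orthogonal to the localized space, and on the first part the
form is bounded by `α`. -/
theorem cea_of_close {α β η ε x : ℝ} (hq : q < 1) {φ ψ : ι → κ → V} (hφ : S.IsGlo φ)
    (hx : 1 ≤ x) (hα : 1 ≤ α) (hε : 0 ≤ ε) (hη : 100 * x ^ 2 * ε ≤ η)
    (hβ : 0 < β / 4 - 9 * α * η / 4 - 3 * α * η / 2)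
    (hnE : ∀ u, S.nE u ≤ x * S.nA u) (hker : S.InfSup (S.ker : Set V) β)
    (hglo : S.InfSup (LinearMap.range (comb φ) : Set V) β)
    (hclose : ∀ c, S.nE (comb φ c - comb ψ c) ≤ ε * S.nA (comb φ c))
    (hαb : ∀ u, ∀ w ∈ S.ker, |S.b u w| ≤ α * S.nA u * S.nA w)
    {e z : V} (he : ∀ w ∈ LinearMap.range (comb ψ), S.b e w = 0)
    (hz : z ∈ LinearMap.range (comb ψ)) :
    S.nA e ≤ α / (β / 4 - 9 * α * η / 4 - 3 * α * η / 2) * S.nA (e + z) := by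
  rw [div_mul_eq_mul_div, le_div_iff₀ hβ]
  have ny := S.nA_nonneg (e + z)
  by_cases h0 : e = 0
  · rw [h0, nA_zero, zero_mul, zero_add]
    exact mul_nonneg (by linarith) (S.nA_nonneg z)
  have hε1 := locError_small hq hφ hx hα hε hη hβ hnE hker hglo h0
  have hη0 : 0 ≤ η := le_trans (by positivity) hη
  have hαη : η ≤ α * η := le_mul_of_one_le_left hη0 hα
  have hβ0 : 0 < β := by nlinarith
  have hx0 : 0 ≤ x := by linarith
  have ne := S.nA_nonneg e
  obtain ⟨e₁, he₁, c, hec⟩ := hφ.exists_decomp hq hβ0 hker e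
  obtain ⟨d, rfl⟩ := hz
  have h1 : β * S.nA (comb φ c) ≤ x * ε * S.nA e := by
    refine hglo _ ⟨c, rfl⟩ _ (by positivity) ?_
    rintro _ ⟨w, rfl⟩
    have a1 : S.b (comb φ c) (comb φ w) = S.b e (comb φ w - comb ψ w) := by
      rw [map_sub, he _ ⟨w, rfl⟩, sub_zero]
      conv_rhs => rw [hec, map_add, LinearMap.add_apply, S.b_symm e₁, hφ.b_comb_ker w he₁, zero_add]
    rw [a1]
    refine (le_abs_self _).trans ((S.abs_b_le hq.le _ _).trans ?_)
    refine (mul_le_mul (hnE e) (hclose w) (S.nE_nonneg _) (by positivity)).trans_eq ?_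
    ring
  have nz := S.nA_nonneg (comb φ d)
  have h2 : β * S.nA e₁ ≤ α * S.nA (e + comb ψ d) + α * (ε * S.nA (comb φ d)) := by
    refine hker _ he₁ _ (by positivity) fun w hw => ?_
    have a1 : S.b e₁ w = S.b (e + comb ψ d) w + S.b (comb φ d - comb ψ d) w := by
      have : S.b e w = S.b e₁ w := by
        rw [hec, map_add, LinearMap.add_apply, hφ.b_comb_ker c hw, add_zero]
      simp only [map_add, map_sub, LinearMap.add_apply, LinearMap.sub_apply, this,
        hφ.b_comb_ker d hw]
      ring
    have a2 := (le_abs_self _).trans (hαb (e + comb ψ d) w hw)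
    have a3 := (le_abs_self _).trans (hαb (comb φ d - comb ψ d) w hw)
    have a4 := (S.nA_le_nE (comb φ d - comb ψ d)).trans (hclose d)
    have a5 := mul_le_mul_of_nonneg_right
      (mul_le_mul_of_nonneg_left a4 (by linarith : 0 ≤ α)) (S.nA_nonneg w)
    rw [a1]
    linarith
  have h3 : S.nA (comb φ d) ≤ 2 * (S.nA e + S.nA (e + comb ψ d)) := by
    have a1 := (S.nA_le_nE (comb φ d - comb ψ d)).trans (hclose d)
    have a2 := S.nA_add_le (comb φ d - comb ψ d) (comb ψ d)
    rw [sub_add_cancel] at a2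
    have a3 := S.nA_sub_le (e + comb ψ d) e
    rw [add_sub_cancel_left] at a3
    have a4 := mul_le_mul_of_nonneg_right hε1 nz
    linarith
  have h4 : S.nA e ≤ S.nA e₁ + S.nA (comb φ c) := by
    conv_lhs => rw [hec]
    exact S.nA_add_le _ _
  have hxε : x * ε ≤ x ^ 2 * ε :=
    mul_le_mul_of_nonneg_right (by rw [sq]; exact le_mul_of_one_le_left hx0 hx) hε
  have hεx : ε ≤ x * ε := le_mul_of_one_le_left hε hx
  have hεη : ε ≤ η / 100 := by linarith
  have hxεη : x * ε ≤ η / 100 := by linarith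
  have h5 := mul_le_mul_of_nonneg_left h4 hβ0.le
  have h6 : α * (ε * S.nA (comb φ d)) ≤
      α * η / 50 * S.nA e + α / 2 * S.nA (e + comb ψ d) := by
    have a1 : ε * S.nA (comb φ d) ≤ ε * (2 * (S.nA e + S.nA (e + comb ψ d))) :=
      mul_le_mul_of_nonneg_left h3 hε
    have a2 : ε * S.nA e ≤ η / 100 * S.nA e := mul_le_mul_of_nonneg_right hεη ne
    have a3 : ε * S.nA (e + comb ψ d) ≤ 1 / 4 * S.nA (e + comb ψ d) :=
      mul_le_mul_of_nonneg_right hε1 ny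
    have a4 : ε * S.nA (comb φ d) ≤ η / 50 * S.nA e + 1 / 2 * S.nA (e + comb ψ d) := by linarith
    have := mul_le_mul_of_nonneg_left a4 (by linarith : 0 ≤ α)
    linarith
  have h7 : x * ε * S.nA e ≤ α * η / 100 * S.nA e :=
    mul_le_mul_of_nonneg_right (by linarith) ne
  have h8 : 0 ≤ α * η * S.nA e := by positivity
  have h9 : 0 ≤ α * S.nA (e + comb ψ d) := by positivity
  nlinarith

end LocalizedSystem
/-! ### Weak gradients and multiplication in `H¹₀` -/

/-- The restriction to a set of pairs of square-integrable functions. -/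
noncomputable def restr (K : Set E2) (x : L2Pair volume) : L2Pair (volume.restrict K) :=
  WithLp.toLp 2 (LpToLpRestrictCLM E2 ℝ ℝ volume 2 K x.fst, LpToLpRestrictCLM E2 E2 ℝ volume 2 K x.snd)

theorem restr_fst (K : Set E2) (x : L2Pair volume) :
    (restr K x).fst =ᵐ[volume.restrict K] x.fst := LpToLpRestrictCLM_coeFn ℝ K x.fst

theorem restr_snd (K : Set E2) (x : L2Pair volume) :
    (restr K x).snd =ᵐ[volume.restrict K] x.snd := LpToLpRestrictCLM_coeFn ℝ K x.snd

/-- `x` is given by a test function in `Ω` and its gradient. -/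
def IsTest (Ω : Set E2) (x : L2Pair volume) : Prop := ∃ φ : E2 → ℝ,
    ContDiff ℝ (⊤ : ℕ∞) φ ∧ HasCompactSupport φ ∧ tsupport φ ⊆ Ω ∧
    x.fst =ᵐ[volume] φ ∧ x.snd =ᵐ[volume] gradient φ

theorem fderiv_eq_inner_gradient (φ : E2 → ℝ) (p e : E2) :
    fderiv ℝ φ p e = inner ℝ (gradient φ p) e := (inner_gradient_left).symm

theorem gradient_eq_symm (φ : E2 → ℝ) (p : E2) :
    gradient φ p = (InnerProductSpace.toDual ℝ E2).symm (fderiv ℝ φ p) := rfl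

theorem norm_gradient (φ : E2 → ℝ) (p : E2) : ‖gradient φ p‖ = ‖fderiv ℝ φ p‖ := by
  rw [gradient_eq_symm, LinearIsometryEquiv.norm_map]

theorem gradient_add' {φ ψ : E2 → ℝ} (hφ : Differentiable ℝ φ) (hψ : Differentiable ℝ ψ) :
    gradient (φ + ψ) = gradient φ + gradient ψ := by
  funext p
  rw [Pi.add_apply, gradient_eq_symm, fderiv_add (hφ p) (hψ p), map_add]; rfl

theorem gradient_const_smul' (c : ℝ) {φ : E2 → ℝ} (hφ : Differentiable ℝ φ) :
    gradient (c • φ) = c • gradient φ := by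
  funext p
  rw [Pi.smul_apply, gradient_eq_symm, fderiv_const_smul (hφ p), map_smul]; rfl

theorem gradient_mul' {φ ψ : E2 → ℝ} (hφ : Differentiable ℝ φ) (hψ : Differentiable ℝ ψ) (p : E2) :
    gradient (fun q => φ q * ψ q) p = φ p • gradient ψ p + ψ p • gradient φ p := by
  rw [gradient_eq_symm, fderiv_fun_mul (hφ p) (hψ p), map_add, map_smul, map_smul]; rfl

theorem continuous_gradient {φ : E2 → ℝ} (hφ : ContDiff ℝ (⊤ : ℕ∞) φ) :
    Continuous (gradient φ) :=
  (InnerProductSpace.toDual ℝ E2).symm.continuous.comp (hφ.continuous_fderiv (by simp))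

theorem tsupport_gradient_subset (φ : E2 → ℝ) : tsupport (gradient φ) ⊆ tsupport φ := by
  refine closure_minimal ?_ (isClosed_tsupport φ)
  intro p hp
  refine support_fderiv_subset ℝ (fun h => hp ?_)
  rw [gradient_eq_symm, h, map_zero]

theorem hasCompactSupport_gradient {φ : E2 → ℝ} (h : HasCompactSupport φ) :
    HasCompactSupport (gradient φ) :=
  IsCompact.of_isClosed_subset h (isClosed_tsupport _) (tsupport_gradient_subset φ)

/-- The element of `H¹₀` given by a test function. -/
noncomputable def testPair (φ : E2 → ℝ) (h₁ : ContDiff ℝ (⊤ : ℕ∞) φ) (h₂ : HasCompactSupport φ) :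
    L2Pair volume :=
  WithLp.toLp 2 (MemLp.toLp φ (h₁.continuous.memLp_of_hasCompactSupport h₂),
    MemLp.toLp (gradient φ)
      ((continuous_gradient h₁).memLp_of_hasCompactSupport (hasCompactSupport_gradient h₂)))

theorem testPair_fst {φ : E2 → ℝ} (h₁ : ContDiff ℝ (⊤ : ℕ∞) φ) (h₂ : HasCompactSupport φ) :
    (testPair φ h₁ h₂).fst =ᵐ[volume] φ :=
  MemLp.coeFn_toLp (h₁.continuous.memLp_of_hasCompactSupport h₂)

theorem testPair_snd {φ : E2 → ℝ} (h₁ : ContDiff ℝ (⊤ : ℕ∞) φ) (h₂ : HasCompactSupport φ) :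
    (testPair φ h₁ h₂).snd =ᵐ[volume] gradient φ :=
  MemLp.coeFn_toLp
    ((continuous_gradient h₁).memLp_of_hasCompactSupport (hasCompactSupport_gradient h₂))

theorem testPair_mem {Ω : Set E2} {φ : E2 → ℝ} (h₁ : ContDiff ℝ (⊤ : ℕ∞) φ)
    (h₂ : HasCompactSupport φ) (h₃ : tsupport φ ⊆ Ω) : testPair φ h₁ h₂ ∈ H10 Ω :=
  Submodule.le_topologicalClosure _
    (Submodule.subset_span ⟨φ, h₁, h₂, h₃, testPair_fst h₁ h₂, testPair_snd h₁ h₂⟩)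

/-- The test functions form a linear subspace. -/
def testSub (Ω : Set E2) : Submodule ℝ (L2Pair volume) where
  carrier := {x | IsTest Ω x}
  add_mem' := by
    rintro x y ⟨φ, h₁, h₂, h₃, h₄, h₅⟩ ⟨ψ, k₁, k₂, k₃, k₄, k₅⟩
    refine ⟨φ + ψ, h₁.add k₁, h₂.add k₂, ?_, ?_, ?_⟩
    · exact (tsupport_add φ ψ).trans (Set.union_subset h₃ k₃)
    · exact (Lp.coeFn_add x.fst y.fst).trans (h₄.add k₄)
    · rw [gradient_add' (h₁.differentiable (by simp)) (k₁.differentiable (by simp))]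
      exact (Lp.coeFn_add x.snd y.snd).trans (h₅.add k₅)
  zero_mem' := by
    refine ⟨0, contDiff_const, HasCompactSupport.zero, by simp, Lp.coeFn_zero _ _ _, ?_⟩
    refine (Lp.coeFn_zero E2 2 volume).trans (Filter.Eventually.of_forall fun p => ?_)
    rw [gradient_eq_symm, fderiv_zero]
    simp
  smul_mem' := by
    rintro c x ⟨φ, h₁, h₂, h₃, h₄, h₅⟩
    refine ⟨c • φ, contDiff_const.smul h₁, h₂.smul_left, ?_, ?_, ?_⟩
    · exact (tsupport_smul_subset_right (fun _ => c) φ).trans h₃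
    · exact (Lp.coeFn_smul c x.fst).trans (h₄.const_smul c)
    · rw [gradient_const_smul' c (h₁.differentiable (by simp))]
      exact (Lp.coeFn_smul c x.snd).trans (h₅.const_smul c)

theorem H10_eq_closure (Ω : Set E2) : (H10 Ω : Set (L2Pair volume)) = closure {x | IsTest Ω x} := by
  have h : Submodule.span ℝ {x : L2Pair volume | IsTest Ω x} = testSub Ω :=
    Submodule.span_eq (testSub Ω)
  have h2 : H10 Ω = (testSub Ω).topologicalClosure := by rw [← h]; rfl
  rw [h2, Submodule.topologicalClosure_coe]; rfl

/-- A closed property of test functions holds in `H¹₀`. -/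
theorem H10_induction {Ω : Set E2} {p : L2Pair volume → Prop} (hp : IsClosed {x | p x})
    (h : ∀ x, IsTest Ω x → p x) {x : L2Pair volume} (hx : x ∈ H10 Ω) : p x := by
  have h1 : x ∈ closure {x | IsTest Ω x} := by rw [← H10_eq_closure]; exact hx
  exact closure_minimal (t := {x | p x}) h hp h1

theorem memLp_fst (x : L2Pair volume) : MemLp x.fst 2 volume := Lp.memLp _
theorem memLp_snd (x : L2Pair volume) : MemLp x.snd 2 volume := Lp.memLp _

theorem ae_zero_outside {Ω : Set E2} (hΩ : MeasurableSet Ω) {x : L2Pair volume} (hx : x ∈ H10 Ω) :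
    ∀ᵐ p ∂volume.restrict Ωᶜ, x.fst p = 0 ∧ x.snd p = 0 := by
  have key : LpToLpRestrictCLM E2 ℝ ℝ volume 2 Ωᶜ x.fst = 0 ∧
      LpToLpRestrictCLM E2 E2 ℝ volume 2 Ωᶜ x.snd = 0 := by
    refine H10_induction (p := fun x => LpToLpRestrictCLM E2 ℝ ℝ volume 2 Ωᶜ x.fst = 0 ∧
      LpToLpRestrictCLM E2 E2 ℝ volume 2 Ωᶜ x.snd = 0) ?_ ?_ hx
    · refine IsClosed.inter (isClosed_eq ?_ continuous_const) (isClosed_eq ?_ continuous_const)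
      · exact (LpToLpRestrictCLM E2 ℝ ℝ volume 2 Ωᶜ).continuous.comp (WithLp.continuous_fst 2 _ _)
      · exact (LpToLpRestrictCLM E2 E2 ℝ volume 2 Ωᶜ).continuous.comp (WithLp.continuous_snd 2 _ _)
    · rintro x ⟨φ, h₁, h₂, h₃, h₄, h₅⟩
      constructor
      · refine Lp.ext ?_
        filter_upwards [LpToLpRestrictCLM_coeFn ℝ Ωᶜ x.fst, ae_restrict_of_ae h₄,
          ae_restrict_mem hΩ.compl, Lp.coeFn_zero ℝ 2 (volume.restrict Ωᶜ)] with p a1 a2 a3 a4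
        rw [a1, a2, a4]
        exact image_eq_zero_of_notMem_tsupport fun h => a3 (h₃ h)
      · refine Lp.ext ?_
        filter_upwards [LpToLpRestrictCLM_coeFn ℝ Ωᶜ x.snd, ae_restrict_of_ae h₅,
          ae_restrict_mem hΩ.compl, Lp.coeFn_zero E2 2 (volume.restrict Ωᶜ)] with p a1 a2 a3 a4
        rw [a1, a2, a4]
        exact image_eq_zero_of_notMem_tsupport fun h => a3 (h₃ (tsupport_gradient_subset φ h))
  filter_upwards [LpToLpRestrictCLM_coeFn ℝ Ωᶜ x.fst, LpToLpRestrictCLM_coeFn ℝ Ωᶜ x.snd,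
    Lp.coeFn_zero ℝ 2 (volume.restrict Ωᶜ), Lp.coeFn_zero E2 2 (volume.restrict Ωᶜ)]
    with p a1 a2 a3 a4
  rw [← a1, ← a2, key.1, key.2, a3, a4]
  exact ⟨rfl, rfl⟩

theorem continuous_fderiv_apply' {φ : E2 → ℝ} (h₁ : ContDiff ℝ (⊤ : ℕ∞) φ) (e : E2) :
    Continuous fun p => fderiv ℝ φ p e :=
  (h₁.continuous_fderiv (by simp)).clm_apply continuous_const

theorem hasCompactSupport_fderiv_apply' {φ : E2 → ℝ} (h₂ : HasCompactSupport φ) (e : E2) :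
    HasCompactSupport fun p => fderiv ℝ φ p e :=
  h₂.fderiv_apply ℝ e

/-- The second component of an element of `H¹₀` is the weak gradient in the plane of the first. -/
theorem integral_fst_mul_fderiv {Ω : Set E2} {x : L2Pair volume} (hx : x ∈ H10 Ω) {φ : E2 → ℝ}
    (h₁ : ContDiff ℝ (⊤ : ℕ∞) φ) (h₂ : HasCompactSupport φ) (e : E2) :
    ∫ p, x.fst p * fderiv ℝ φ p e = - ∫ p, inner ℝ (x.snd p) e * φ p := by
  have m₁ : MemLp (fun p => fderiv ℝ φ p e) 2 volume :=
    (continuous_fderiv_apply' h₁ e).memLp_of_hasCompactSupport (hasCompactSupport_fderiv_apply' h₂ e)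
  have m₂ : MemLp (fun p => φ p • e) 2 volume :=
    (h₁.continuous.smul continuous_const).memLp_of_hasCompactSupport h₂.smul_right
  let z : L2Pair volume := WithLp.toLp 2 (m₁.toLp _, m₂.toLp _)
  have hz : ∀ x : L2Pair volume, inner ℝ x z =
      (∫ p, x.fst p * fderiv ℝ φ p e) + ∫ p, inner ℝ (x.snd p) e * φ p := by
    intro x
    rw [WithLp.prod_inner_apply, L2.inner_def, L2.inner_def]
    congr 1
    · refine integral_congr_ae ?_
      filter_upwards [m₁.coeFn_toLp] with p hp
      change inner ℝ (x.fst p) ((m₁.toLp _) p) = _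
      rw [hp, real_inner_comm]; rfl
    · refine integral_congr_ae ?_
      filter_upwards [m₂.coeFn_toLp] with p hp
      change inner ℝ (x.snd p) ((m₂.toLp _) p) = _
      rw [hp, real_inner_smul_right, mul_comm]
  have key : inner ℝ x z = 0 := by
    refine H10_induction (p := fun x => inner ℝ x z = 0)
      (isClosed_eq (by fun_prop) continuous_const) ?_ hx
    rintro x ⟨ψ, k₁, k₂, k₃, k₄, k₅⟩
    rw [hz]
    have e1 : ∫ p, x.fst p * fderiv ℝ φ p e = ∫ p, ψ p * fderiv ℝ φ p e :=
      integral_congr_ae (k₄.mono fun p hp => by simp only [hp])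
    have e2 : ∫ p, inner ℝ (x.snd p) e * φ p = ∫ p, fderiv ℝ ψ p e * φ p :=
      integral_congr_ae (k₅.mono fun p hp => by simp only [hp, fderiv_eq_inner_gradient])
    rw [e1, e2, integral_mul_fderiv_eq_neg_fderiv_mul_of_integrable]
    · ring
    · exact ((continuous_fderiv_apply' k₁ e).mul h₁.continuous).integrable_of_hasCompactSupport
        h₂.mul_left
    · exact (k₁.continuous.mul (continuous_fderiv_apply' h₁ e)).integrable_of_hasCompactSupport
        k₂.mul_right
    · exact (k₁.continuous.mul h₁.continuous).integrable_of_hasCompactSupport k₂.mul_right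
    · exact fun p _ => k₁.differentiable (by simp) p
    · exact fun p _ => h₁.differentiable (by simp) p
  rw [hz] at key
  linarith

/-- Restrictions of functions of `H¹₀(Ω)` to an arbitrary set `K` belong to `H¹(K)`. -/
theorem memH1_restr {Ω : Set E2} (K : Set E2) {x : L2Pair volume} (hx : x ∈ H10 Ω) :
    MemH1 K (restr K x) := by
  intro φ h₁ h₂ h₃ e
  have hout : ∀ p ∉ K, φ p = 0 ∧ fderiv ℝ φ p e = 0 := fun p hp => by
    have : p ∉ tsupport φ := fun h => hp (h₃ h)
    refine ⟨image_eq_zero_of_notMem_tsupport this, ?_⟩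
    have h := image_eq_zero_of_notMem_tsupport (fun h => this (tsupport_fderiv_subset ℝ h))
    rw [h]; rfl
  have e1 : ∫ p in K, (restr K x).fst p * fderiv ℝ φ p e = ∫ p, x.fst p * fderiv ℝ φ p e := by
    rw [integral_congr_ae ((restr_fst K x).mono fun p hp => by simp only [hp] :
      (fun p => (restr K x).fst p * fderiv ℝ φ p e) =ᵐ[volume.restrict K]
        fun p => x.fst p * fderiv ℝ φ p e)]
    exact setIntegral_eq_integral_of_forall_compl_eq_zero fun p hp => by simp [(hout p hp).2]
  have e2 : ∫ p in K, inner ℝ ((restr K x).snd p) e * φ p = ∫ p, inner ℝ (x.snd p) e * φ p := by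
    rw [integral_congr_ae ((restr_snd K x).mono fun p hp => by simp only [hp] :
      (fun p => inner ℝ ((restr K x).snd p) e * φ p) =ᵐ[volume.restrict K]
        fun p => inner ℝ (x.snd p) e * φ p)]
    exact setIntegral_eq_integral_of_forall_compl_eq_zero fun p hp => by simp [(hout p hp).1]
  rw [e1, e2, integral_fst_mul_fderiv hx h₁ h₂ e]

/-- The weak gradient is local. -/
theorem snd_ae_zero_of_fst {Ω U : Set E2} (hU : IsOpen U) {x : L2Pair volume} (hx : x ∈ H10 Ω)
    (h : ∀ᵐ p ∂volume.restrict U, x.fst p = 0) : ∀ᵐ p ∂volume.restrict U, x.snd p = 0 := by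
  rw [ae_restrict_iff' hU.measurableSet] at h ⊢
  have hloc : LocallyIntegrable x.snd volume := (memLp_snd x).locallyIntegrable (by norm_num)
  refine hU.ae_eq_zero_of_integral_contDiff_smul_eq_zero (hloc.locallyIntegrableOn U) ?_
  intro g g₁ g₂ g₃
  refine ext_inner_right ℝ fun e => ?_
  have hint : Integrable (fun p => g p • x.snd p) volume :=
    hloc.integrable_smul_left_of_hasCompactSupport g₁.continuous g₂
  rw [inner_zero_left, real_inner_comm, ← integral_inner hint]
  have e1 : ∫ p, inner ℝ e (g p • x.snd p) = ∫ p, inner ℝ (x.snd p) e * g p := by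
    refine integral_congr_ae (Filter.Eventually.of_forall fun p => ?_)
    simp only [real_inner_smul_right, real_inner_comm, mul_comm]
  have e2 := integral_fst_mul_fderiv hx g₁ g₂ e
  have e3 : ∫ p, x.fst p * fderiv ℝ g p e = 0 := by
    refine integral_eq_zero_of_ae ?_
    filter_upwards [h] with p hp
    by_cases hpU : p ∈ U
    · rw [hp hpU, zero_mul]; rfl
    · have : fderiv ℝ g p = 0 :=
        image_eq_zero_of_notMem_tsupport fun h => hpU (g₃ (tsupport_fderiv_subset ℝ h))
      rw [this]; simp
  rw [e1]; linarith

/-- The Poincaré inequality for a test function, from `∫ φ² = -2 ∫ p₀ φ ∂₀ φ`. -/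
theorem poincare_test {φ : E2 → ℝ} {r : ℝ} (hr : ∀ p ∈ tsupport φ, ‖p‖ ≤ r)
    (h₁ : ContDiff ℝ (⊤ : ℕ∞) φ) (h₂ : HasCompactSupport φ) :
    ∫ p, φ p ^ 2 ≤ 4 * r ^ 2 * ∫ p, ‖gradient φ p‖ ^ 2 := by
  have hd := h₁.differentiable (by simp)
  let e : E2 := EuclideanSpace.single 0 1
  have he : ‖e‖ = 1 := by simp [e]
  have hfd : ∀ p, fderiv ℝ (fun p => φ p ^ 2) p e = 2 * φ p * fderiv ℝ φ p e := fun p => by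
    rw [fderiv_fun_pow 2 (hd p)]; simp
  have hcoord : ∀ p, fderiv ℝ (fun p : E2 => inner ℝ e p) p e = 1 := fun p => by
    have : (fun p : E2 => inner ℝ e p) = innerSL ℝ e := rfl
    rw [this, ContinuousLinearMap.fderiv, innerSL_apply_apply, real_inner_self_eq_norm_sq, he]
    norm_num
  have csq : HasCompactSupport fun p => φ p ^ 2 := by
    simp only [sq]; exact h₂.mul_left
  have hc0 : Continuous fun p : E2 => (inner ℝ e p : ℝ) := by fun_prop
  have hip := integral_mul_fderiv_eq_neg_fderiv_mul_of_integrable (μ := (volume : Measure E2))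
    (f := fun p => φ p ^ 2) (g := fun p : E2 => (inner ℝ e p : ℝ)) (v := e) (𝕜 := ℝ)
    (by
      simp only [hfd]
      exact (((continuous_const.mul h₁.continuous).mul (continuous_fderiv_apply' h₁ e)).mul
        hc0).integrable_of_hasCompactSupport
        ((hasCompactSupport_fderiv_apply' h₂ e).mul_left.mul_right))
    (by
      simp only [hcoord, mul_one]
      exact (h₁.continuous.pow 2).integrable_of_hasCompactSupport csq)
    (((h₁.continuous.pow 2).mul hc0).integrable_of_hasCompactSupport csq.mul_right)
    (fun p _ => (hd p).pow 2) (fun p _ => (innerSL ℝ e).differentiableAt)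
  simp only [hcoord, mul_one, hfd] at hip
  have i1 : Integrable (fun p => φ p ^ 2) volume :=
    (h₁.continuous.pow 2).integrable_of_hasCompactSupport csq
  have i2 : Integrable (fun p => ‖gradient φ p‖ ^ 2) volume := by
    refine ((continuous_gradient h₁).norm.pow 2).integrable_of_hasCompactSupport ?_
    simp only [sq]
    exact (hasCompactSupport_gradient h₂).norm.mul_left
  have i3 : Integrable (fun p => 2 * φ p * fderiv ℝ φ p e * inner ℝ e p) volume :=
    (((continuous_const.mul h₁.continuous).mul (continuous_fderiv_apply' h₁ e)).mul
        hc0).integrable_of_hasCompactSupport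
        ((hasCompactSupport_fderiv_apply' h₂ e).mul_left.mul_right)
  have hle : ∀ p, -(2 * φ p * fderiv ℝ φ p e * inner ℝ e p) ≤
      1 / 2 * φ p ^ 2 + 2 * r ^ 2 * ‖gradient φ p‖ ^ 2 := by
    intro p
    by_cases hp : p ∈ tsupport φ
    · have b1 : |fderiv ℝ φ p e| ≤ ‖gradient φ p‖ := by
        rw [norm_gradient]
        have := (fderiv ℝ φ p).le_opNorm e
        rwa [he, mul_one, Real.norm_eq_abs] at this
      have b2 : |inner ℝ e p| ≤ r := by
        have := abs_real_inner_le_norm e p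
        rw [he, one_mul] at this
        exact this.trans (hr p hp)
      have b3 : |fderiv ℝ φ p e * inner ℝ e p| ≤ ‖gradient φ p‖ * r := by
        rw [abs_mul]; exact mul_le_mul b1 b2 (abs_nonneg _) (norm_nonneg _)
      have b4 : (fderiv ℝ φ p e * inner ℝ e p) ^ 2 ≤ (‖gradient φ p‖ * r) ^ 2 :=
        sq_le_sq' (abs_le.1 b3).1 (abs_le.1 b3).2
      nlinarith [sq_nonneg (φ p + 2 * (fderiv ℝ φ p e * inner ℝ e p))]
    · rw [image_eq_zero_of_notMem_tsupport hp]
      simp only [mul_zero, zero_mul, neg_zero]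
      positivity
  have := integral_mono i3.neg ((i1.const_mul (1 / 2)).add (i2.const_mul (2 * r ^ 2))) hle
  have e3 : ∫ p, (1 / 2 * φ p ^ 2 + 2 * r ^ 2 * ‖gradient φ p‖ ^ 2) =
      (1 / 2 * ∫ p, φ p ^ 2) + 2 * r ^ 2 * ∫ p, ‖gradient φ p‖ ^ 2 := by
    rw [integral_add (i1.const_mul _) (i2.const_mul _), integral_const_mul, integral_const_mul]
  have e4 : ∫ p, φ p ^ 2 ≤ (1 / 2 * ∫ p, φ p ^ 2) + 2 * r ^ 2 * ∫ p, ‖gradient φ p‖ ^ 2 := by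
    rw [← e3, hip, ← integral_neg]; exact this
  linarith

/-- The Poincaré inequality in a bounded set. -/
theorem poincare {Ω : Set E2} {r : ℝ} (hr : ∀ p ∈ Ω, ‖p‖ ≤ r) {x : L2Pair volume}
    (hx : x ∈ H10 Ω) : ‖x.fst‖ ^ 2 ≤ 4 * r ^ 2 * ‖x.snd‖ ^ 2 := by
  refine H10_induction (p := fun x => ‖x.fst‖ ^ 2 ≤ 4 * r ^ 2 * ‖x.snd‖ ^ 2) ?_ ?_ hx
  · refine isClosed_le ?_ ?_
    · exact ((WithLp.continuous_fst 2 _ _)).norm.pow 2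
    · exact continuous_const.mul (((WithLp.continuous_snd 2 _ _)).norm.pow 2)
  rintro x ⟨φ, h₁, h₂, h₃, h₄, h₅⟩
  have n1 : ‖x.fst‖ ^ 2 = ∫ p, φ p ^ 2 := by
    rw [← real_inner_self_eq_norm_sq, L2.inner_def]
    refine integral_congr_ae (h₄.mono fun p hp => ?_)
    simp only [hp, real_inner_self_eq_norm_sq, Real.norm_eq_abs, sq_abs]
  have n2 : ‖x.snd‖ ^ 2 = ∫ p, ‖gradient φ p‖ ^ 2 := by
    rw [← real_inner_self_eq_norm_sq, L2.inner_def]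
    refine integral_congr_ae (h₅.mono fun p hp => ?_)
    simp only [hp, real_inner_self_eq_norm_sq]
  rw [n1, n2]
  exact poincare_test (fun p hp => hr p (h₃ hp)) h₁ h₂

/-- Multiplication by a bounded smooth function with a bounded gradient preserves `H¹₀`. -/
theorem exists_mul {Ω : Set E2} {χ : E2 → ℝ} (hχ : ContDiff ℝ (⊤ : ℕ∞) χ) {L : ℝ}
    (hb : ∀ p, |χ p| ≤ 1) (hL : ∀ p, ‖gradient χ p‖ ≤ L) {x : L2Pair volume} (hx : x ∈ H10 Ω) :
    ∃ y ∈ H10 Ω, (y.fst =ᵐ[volume] fun p => χ p * x.fst p) ∧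
      y.snd =ᵐ[volume] fun p => χ p • x.snd p + x.fst p • gradient χ p := by
  have mX : MemLp χ ∞ volume := memLp_top_of_bound hχ.continuous.aestronglyMeasurable 1
    (Filter.Eventually.of_forall hb)
  have mG : MemLp (gradient χ) ∞ volume :=
    memLp_top_of_bound (continuous_gradient hχ).aestronglyMeasurable L
      (Filter.Eventually.of_forall hL)
  let A₁ : Lp ℝ 2 (volume : Measure E2) →L[ℝ] Lp ℝ 2 (volume : Measure E2) :=
    (ContinuousLinearMap.lsmul ℝ ℝ).holderL volume ∞ 2 2 (mX.toLp χ)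
  let A₂ : Lp E2 2 (volume : Measure E2) →L[ℝ] Lp E2 2 (volume : Measure E2) :=
    (ContinuousLinearMap.lsmul ℝ ℝ).holderL volume ∞ 2 2 (mX.toLp χ)
  let A₃ : Lp ℝ 2 (volume : Measure E2) →L[ℝ] Lp E2 2 (volume : Measure E2) :=
    (ContinuousLinearMap.lsmul ℝ ℝ).flip.holderL volume ∞ 2 2 (mG.toLp (gradient χ))
  have hA₁ : ∀ f, A₁ f =ᵐ[volume] fun p => χ p * f p := fun f => by
    filter_upwards [(ContinuousLinearMap.lsmul ℝ ℝ).coeFn_holder (r := 2) (mX.toLp χ) f,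
      mX.coeFn_toLp] with p a1 a2
    exact a1.trans (by rw [a2]; rfl)
  have hA₂ : ∀ f, A₂ f =ᵐ[volume] fun p => χ p • f p := fun f => by
    filter_upwards [(ContinuousLinearMap.lsmul ℝ ℝ).coeFn_holder (r := 2) (mX.toLp χ) f,
      mX.coeFn_toLp] with p a1 a2
    exact a1.trans (by rw [a2]; rfl)
  have hA₃ : ∀ f, A₃ f =ᵐ[volume] fun p => f p • gradient χ p := fun f => by
    filter_upwards [(ContinuousLinearMap.lsmul ℝ ℝ).flip.coeFn_holder (r := 2)
      (mG.toLp (gradient χ)) f, mG.coeFn_toLp] with p a1 a2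
    exact a1.trans (by rw [a2]; rfl)
  let F : L2Pair volume → L2Pair volume := fun x =>
    WithLp.toLp 2 (A₁ x.fst, A₂ x.snd + A₃ x.fst)
  have hF : Continuous F := by
    refine (WithLp.prod_continuous_toLp 2 _ _).comp (Continuous.prodMk ?_ ?_)
    · exact A₁.continuous.comp (WithLp.continuous_fst 2 _ _)
    · exact (A₂.continuous.comp (WithLp.continuous_snd 2 _ _)).add
        (A₃.continuous.comp (WithLp.continuous_fst 2 _ _))
  have hF₁ : ∀ x, (F x).fst =ᵐ[volume] fun p => χ p * x.fst p := fun x => hA₁ x.fst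
  have hF₂ : ∀ x, (F x).snd =ᵐ[volume] fun p => χ p • x.snd p + x.fst p • gradient χ p :=
    fun x => (Lp.coeFn_add _ _).trans ((hA₂ x.snd).add (hA₃ x.fst))
  refine ⟨F x, ?_, hF₁ x, hF₂ x⟩
  have h1 : x ∈ closure {x | IsTest Ω x} := by rw [← H10_eq_closure]; exact hx
  change F x ∈ (H10 Ω : Set (L2Pair volume))
  rw [H10_eq_closure]
  refine map_mem_closure hF h1 ?_
  rintro x ⟨φ, h₁, h₂, h₃, h₄, h₅⟩
  refine ⟨fun p => χ p * φ p, hχ.mul h₁, h₂.mul_left, ?_, ?_, ?_⟩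
  · exact (tsupport_mul_subset_right (f := χ)).trans h₃
  · filter_upwards [hF₁ x, h₄] with p a1 a2
    rw [a1, a2]
  · filter_upwards [hF₂ x, h₄, h₅] with p a1 a2 a3
    rw [a1, a2, a3, gradient_mul' (hχ.differentiable (by simp)) (h₁.differentiable (by simp))]

/-- A smooth cutoff function between sets of positive distance, obtained by mollifying a piecewise
linear function of the distance. -/
theorem exists_smooth_cutoff {A B : Set E2} (hA : A.Nonempty) {δ : ℝ} (hδ : 0 < δ)
    (hAB : ∀ x ∈ A, ∀ y ∈ B, δ ≤ dist x y) :
    ∃ χ : E2 → ℝ, ContDiff ℝ (⊤ : ℕ∞) χ ∧ (∀ p ∈ A, χ p = 1) ∧ (∀ p ∈ B, χ p = 0) ∧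
      (∀ p, 0 ≤ χ p ∧ χ p ≤ 1) ∧ ∀ p, ‖gradient χ p‖ ≤ 3 / δ := by
  let g : E2 → ℝ := fun p => max 0 (min 1 (2 - 3 / δ * Metric.infDist p A))
  have hδ' : 0 < δ / 3 := by positivity
  have hg0 : ∀ p, 0 ≤ g p := fun p => le_max_left _ _
  have hg1 : ∀ p, g p ≤ 1 := fun p => max_le zero_le_one (min_le_left _ _)
  have hglip : LipschitzWith ⟨3 / δ, by positivity⟩ g := by
    have h0 : LipschitzWith ⟨3 / δ, by positivity⟩ fun p => 2 - 3 / δ * Metric.infDist p A := by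
      refine LipschitzWith.of_dist_le_mul fun x y => ?_
      have h := (Metric.lipschitz_infDist_pt A).dist_le_mul x y
      rw [Real.dist_eq] at h ⊢
      have e : 2 - 3 / δ * Metric.infDist x A - (2 - 3 / δ * Metric.infDist y A) =
        -(3 / δ * (Metric.infDist x A - Metric.infDist y A)) := by ring
      rw [e, abs_neg, abs_mul, abs_of_pos (by positivity : 0 < 3 / δ)]
      refine mul_le_mul_of_nonneg_left ?_ (by positivity)
      simpa using h
    exact (h0.const_min 1).const_max 0
  have hgA : ∀ p, Metric.infDist p A < δ / 3 → g p = 1 := fun p hp => by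
    have : 3 / δ * Metric.infDist p A ≤ 1 := by
      rw [div_mul_eq_mul_div, div_le_one hδ]; linarith
    simp only [g]
    rw [min_eq_left (by linarith), max_eq_right zero_le_one]
  have hgB : ∀ p, 2 * (δ / 3) ≤ Metric.infDist p A → g p = 0 := fun p hp => by
    have : 2 ≤ 3 / δ * Metric.infDist p A := by
      rw [div_mul_eq_mul_div, le_div_iff₀ hδ]; linarith
    simp only [g]
    rw [max_eq_left]
    exact (min_le_right _ _).trans (by linarith)
  let ρ : ContDiffBump (0 : E2) := ⟨δ / 6, δ / 3, by positivity, by linarith⟩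
  let χ : E2 → ℝ := convolution (ρ.normed volume) g (ContinuousLinearMap.lsmul ℝ ℝ) volume
  have hχ : ∀ p, χ p = ∫ t, ρ.normed volume t * g (p - t) := fun p => rfl
  have hgloc : LocallyIntegrable g volume := hglip.continuous.locallyIntegrable
  have hint : ∀ p, Integrable (fun t => ρ.normed volume t * g (p - t)) volume := fun p =>
    (ρ.continuous_normed.mul (hglip.continuous.comp (continuous_const.sub continuous_id))
      ).integrable_of_hasCompactSupport ρ.hasCompactSupport_normed.mul_right
  have hlip : LipschitzWith ⟨3 / δ, by positivity⟩ χ := by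
    refine LipschitzWith.of_dist_le_mul fun x y => ?_
    rw [Real.dist_eq, hχ, hχ, ← integral_sub (hint x) (hint y)]
    refine (abs_integral_le_integral_abs).trans ?_
    have : ∀ t, |ρ.normed volume t * g (x - t) - ρ.normed volume t * g (y - t)| ≤
        ρ.normed volume t * (3 / δ * dist x y) := fun t => by
      rw [← mul_sub, abs_mul, abs_of_nonneg (ρ.nonneg_normed t)]
      refine mul_le_mul_of_nonneg_left ?_ (ρ.nonneg_normed t)
      have := hglip.dist_le_mul (x - t) (y - t)
      rwa [dist_sub_right, Real.dist_eq] at this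
    refine (integral_mono ((hint x).sub (hint y)).abs
      (ρ.integrable_normed.mul_const _) this).trans_eq ?_
    rw [integral_mul_const, ρ.integral_normed, one_mul]; rfl
  refine ⟨χ, ?_, fun p hp => ?_, fun p hp => ?_, fun p => ⟨?_, ?_⟩, fun p => ?_⟩
  · exact ρ.hasCompactSupport_normed.contDiff_convolution_left _ ρ.contDiff_normed hgloc
  · have h0 : Metric.infDist p A = 0 := Metric.infDist_zero_of_mem hp
    have h1 := ρ.normed_convolution_eq_right (μ := volume) (g := g) (x₀ := p) fun x hx => by
      have hx' : dist x p < δ / 3 := hx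
      rw [hgA x, hgA p (by rw [h0]; exact hδ')]
      exact (Metric.infDist_le_dist_of_mem hp).trans_lt hx'
    exact h1.trans (hgA p (by rw [h0]; exact hδ'))
  · have h0 : δ ≤ Metric.infDist p A := (Metric.le_infDist hA).2 fun y hy => by
      rw [dist_comm]; exact hAB y hy p hp
    have h1 := ρ.normed_convolution_eq_right (μ := volume) (g := g) (x₀ := p) fun x hx => by
      have hx' : dist x p < δ / 3 := hx
      rw [hgB x, hgB p (by linarith)]
      have := Metric.infDist_le_infDist_add_dist (s := A) (x := p) (y := x)
      rw [dist_comm] at this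
      linarith
    exact h1.trans (hgB p (by linarith))
  · rw [hχ]
    exact integral_nonneg fun t => mul_nonneg (ρ.nonneg_normed t) (hg0 _)
  · rw [hχ, ← ρ.integral_normed (μ := volume)]
    exact integral_mono (hint p) ρ.integrable_normed fun t =>
      mul_le_of_le_one_right (ρ.nonneg_normed t) (hg1 _)
  · rw [norm_gradient]
    exact norm_fderiv_le_of_lipschitz ℝ hlip

/-! ### Weighted inner products -/

section Weight

variable {E : Type*} [NormedAddCommGroup E] [InnerProductSpace ℝ E] {ν : Measure E2}

theorem integrable_weight_inner {w : E2 → ℝ} (hw : AEStronglyMeasurable w ν)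
    (hC : ∃ C, ∀ᵐ p ∂ν, ‖w p‖ ≤ C) {f g : E2 → E} (hf : MemLp f 2 ν) (hg : MemLp g 2 ν) :
    Integrable (fun p => w p * inner ℝ (f p) (g p)) ν := by
  obtain ⟨C, hC⟩ := hC
  refine Integrable.bdd_mul (c := C) ?_ hw hC
  refine (L2.integrable_inner (𝕜 := ℝ) (hf.toLp f) (hg.toLp g)).congr ?_
  filter_upwards [hf.coeFn_toLp, hg.coeFn_toLp] with p h1 h2
  rw [h1, h2]

/-- The bilinear form `(f, g) ↦ ∫ w ⟨f, g⟩` on `L²`. -/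
noncomputable def weightForm (w : E2 → ℝ) (hw : AEStronglyMeasurable w ν)
    (hC : ∃ C, ∀ᵐ p ∂ν, ‖w p‖ ≤ C) : LinearMap.BilinForm ℝ (Lp E 2 ν) :=
  LinearMap.mk₂ ℝ (fun f g => ∫ p, w p * inner ℝ (f p) (g p) ∂ν)
    (fun f f' g => by
      rw [← integral_add (integrable_weight_inner hw hC (Lp.memLp f) (Lp.memLp g))
        (integrable_weight_inner hw hC (Lp.memLp f') (Lp.memLp g))]
      refine integral_congr_ae ((Lp.coeFn_add f f').mono fun p hp => ?_)
      simp only [hp, Pi.add_apply, inner_add_left, mul_add])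
    (fun c f g => by
      rw [smul_eq_mul, ← integral_const_mul]
      refine integral_congr_ae ((Lp.coeFn_smul c f).mono fun p hp => ?_)
      simp only [hp, Pi.smul_apply, real_inner_smul_left]; ring)
    (fun f g g' => by
      rw [← integral_add (integrable_weight_inner hw hC (Lp.memLp f) (Lp.memLp g))
        (integrable_weight_inner hw hC (Lp.memLp f) (Lp.memLp g'))]
      refine integral_congr_ae ((Lp.coeFn_add g g').mono fun p hp => ?_)
      simp only [hp, Pi.add_apply, inner_add_right, mul_add])
    (fun c f g => by
      rw [smul_eq_mul, ← integral_const_mul]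
      refine integral_congr_ae ((Lp.coeFn_smul c g).mono fun p hp => ?_)
      simp only [hp, Pi.smul_apply, real_inner_smul_right]; ring)

end Weight

/-- The projection of a pair to its first component. -/
def fstL (μ : Measure E2) : L2Pair μ →ₗ[ℝ] Lp ℝ 2 μ where
  toFun := WithLp.fst
  map_add' _ _ := rfl
  map_smul' _ _ := rfl

/-- The projection of a pair to its second component. -/
def sndL (μ : Measure E2) : L2Pair μ →ₗ[ℝ] Lp E2 2 μ where
  toFun := WithLp.snd
  map_add' _ _ := rfl
  map_smul' _ _ := rfl

/-- The restriction as a linear map. -/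
noncomputable def restrL (K : Set E2) : L2Pair volume →ₗ[ℝ] L2Pair (volume.restrict K) where
  toFun := restr K
  map_add' x y := by
    simp only [restr, WithLp.add_fst, WithLp.add_snd, map_add]
    rfl
  map_smul' c x := by
    simp only [restr, WithLp.smul_fst, WithLp.smul_snd, map_smul]
    rfl

theorem integrable_mul_test {ν : Measure E2} {f : E2 → ℝ} (hf : MemLp f 2 ν) {g : E2 → ℝ}
    (hg : MemLp g 2 ν) : Integrable (fun p => f p * g p) ν :=
  MemLp.integrable_mul hf hg

/-- `H¹(K)` as a linear subspace. -/
def H1sub (K : Set E2) : Submodule ℝ (L2Pair (volume.restrict K)) where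
  carrier := {x | MemH1 K x}
  zero_mem' := fun φ h₁ h₂ h₃ e => by
    have e1 : (0 : L2Pair (volume.restrict K)).fst =ᵐ[volume.restrict K] 0 :=
      Lp.coeFn_zero ℝ 2 (volume.restrict K)
    have e2 : (0 : L2Pair (volume.restrict K)).snd =ᵐ[volume.restrict K] 0 :=
      Lp.coeFn_zero E2 2 (volume.restrict K)
    rw [integral_eq_zero_of_ae, integral_eq_zero_of_ae, neg_zero]
    · filter_upwards [e2] with p hp; rw [hp]; simp
    · filter_upwards [e1] with p hp; rw [hp]; simp
  add_mem' := by
    intro x y hx hy φ h₁ h₂ h₃ e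
    have m₁ : MemLp (fun p => fderiv ℝ φ p e) 2 (volume.restrict K) :=
      ((continuous_fderiv_apply' h₁ e).memLp_of_hasCompactSupport
        (hasCompactSupport_fderiv_apply' h₂ e)).restrict K
    have m₂ : MemLp φ 2 (volume.restrict K) :=
      (h₁.continuous.memLp_of_hasCompactSupport h₂).restrict K
    have i₁ : ∀ x : L2Pair (volume.restrict K),
        Integrable (fun p => x.fst p * fderiv ℝ φ p e) (volume.restrict K) :=
      fun x => integrable_mul_test (Lp.memLp x.fst) m₁
    have i₂ : ∀ x : L2Pair (volume.restrict K),
        Integrable (fun p => inner ℝ (x.snd p) e * φ p) (volume.restrict K) :=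
      fun x => integrable_mul_test ((Lp.memLp x.snd).inner_const e) m₂
    have e1 : ∫ p in K, (x + y).fst p * fderiv ℝ φ p e =
        (∫ p in K, x.fst p * fderiv ℝ φ p e) + ∫ p in K, y.fst p * fderiv ℝ φ p e := by
      rw [← integral_add (i₁ x) (i₁ y)]
      refine integral_congr_ae ((Lp.coeFn_add x.fst y.fst).mono fun p hp => ?_)
      simp only [WithLp.add_fst, hp, Pi.add_apply, add_mul]
    have e2 : ∫ p in K, inner ℝ ((x + y).snd p) e * φ p =
        (∫ p in K, inner ℝ (x.snd p) e * φ p) + ∫ p in K, inner ℝ (y.snd p) e * φ p := by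
      rw [← integral_add (i₂ x) (i₂ y)]
      refine integral_congr_ae ((Lp.coeFn_add x.snd y.snd).mono fun p hp => ?_)
      simp only [WithLp.add_snd, hp, Pi.add_apply, inner_add_left, add_mul]
    rw [e1, e2, hx φ h₁ h₂ h₃ e, hy φ h₁ h₂ h₃ e]; ring
  smul_mem' := by
    intro c x hx φ h₁ h₂ h₃ e
    have e1 : ∫ p in K, (c • x).fst p * fderiv ℝ φ p e =
        c * ∫ p in K, x.fst p * fderiv ℝ φ p e := by
      rw [← integral_const_mul]
      refine integral_congr_ae ((Lp.coeFn_smul c x.fst).mono fun p hp => ?_)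
      simp only [WithLp.smul_fst, hp, Pi.smul_apply, smul_eq_mul, mul_assoc]
    have e2 : ∫ p in K, inner ℝ ((c • x).snd p) e * φ p =
        c * ∫ p in K, inner ℝ (x.snd p) e * φ p := by
      rw [← integral_const_mul]
      refine integral_congr_ae ((Lp.coeFn_smul c x.snd).mono fun p hp => ?_)
      simp only [WithLp.smul_snd, hp, Pi.smul_apply, real_inner_smul_left, mul_assoc]
    rw [e1, e2, hx φ h₁ h₂ h₃ e]; ring

namespace CoarseMesh

variable {P : Problem} (M : CoarseMesh P)

/-! ### Coefficients and geometry of the mesh -/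

theorem isOpen_elem (i : Fin M.N) : IsOpen (M.elem i) := by
  rw [M.elem_eq]; exact isOpen_interior

theorem isBounded_elem (i : Fin M.N) : Bornology.IsBounded (M.elem i) :=
  P.bounded_Ω.subset (M.elem_subset i)

theorem diam_pos (i : Fin M.N) : 0 < Metric.diam (M.elem i) := by
  obtain ⟨x, hx⟩ := M.elem_nonempty i
  obtain ⟨ε, hε, hb⟩ := Metric.isOpen_iff.1 (M.isOpen_elem i) x hx
  let y : E2 := x + (ε / 2) • EuclideanSpace.single 0 1
  have hd : dist y x = ε / 2 := by
    rw [dist_eq_norm]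
    simp only [y, add_sub_cancel_left, norm_smul]
    simp [abs_of_pos hε]
  have hy : y ∈ M.elem i := hb (by rw [Metric.mem_ball, hd]; linarith)
  have := Metric.dist_le_diam_of_mem (M.isBounded_elem i) hy hx
  linarith

theorem diam_le_size (i : Fin M.N) : Metric.diam (M.elem i) ≤ M.size :=
  le_ciSup (f := fun i => Metric.diam (M.elem i)) (Set.finite_range _).bddAbove i

theorem size_pos (i : Fin M.N) : 0 < M.size := (M.diam_pos i).trans_le (M.diam_le_size i)

theorem ae_elem {i : Fin M.N} {p : E2 → Prop} (h : ∀ᵐ x ∂volume.restrict P.Ω, p x) :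
    ∀ᵐ x ∂volume.restrict (M.elem i), p x := ae_restrict_of_ae_restrict_of_subset (M.elem_subset i) h

theorem ae_c_eq (i : Fin M.N) : ∀ᵐ p ∂volume.restrict (M.elem i), |P.c p| = P.κ * |P.σ p| := by
  filter_upwards [M.ae_elem P.c_eq] with p hp
  rw [hp, abs_mul, abs_of_pos P.κ_pos]

/-- The scalar factor of the weight `μ` in an element. -/
noncomputable def fac (i : Fin M.N) : ℝ := M.μmsh * (Metric.diam (M.elem i))⁻¹ ^ 2

theorem fac_pos (i : Fin M.N) : 0 < M.fac i := by
  have := M.diam_pos i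
  have := M.μmsh_pos
  unfold fac; positivity

theorem aesm_abs_σ (ν : Measure E2) : AEStronglyMeasurable (fun p => |P.σ p|) ν :=
  P.measurable_σ.abs.aestronglyMeasurable

theorem aesm_fac_c (i : Fin M.N) (ν : Measure E2) :
    AEStronglyMeasurable (fun p => M.fac i * |P.c p|) ν :=
  (P.measurable_c.abs.const_mul _).aestronglyMeasurable

theorem σ_bdd (i : Fin M.N) : ∃ C, ∀ᵐ p ∂volume.restrict (M.elem i), ‖|P.σ p|‖ ≤ C := by
  obtain ⟨lo, hi, _, h⟩ := P.σ_bounds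
  exact ⟨hi, (M.ae_elem h).mono fun p hp => by rw [Real.norm_eq_abs, abs_abs]; exact hp.2⟩

theorem fac_c_bdd (i : Fin M.N) : ∃ C, ∀ᵐ p ∂volume.restrict (M.elem i), ‖M.fac i * |P.c p|‖ ≤ C := by
  obtain ⟨C, hC⟩ := M.σ_bdd i
  refine ⟨M.fac i * (P.κ * C), ?_⟩
  filter_upwards [hC, M.ae_c_eq i] with p h1 h2
  rw [Real.norm_eq_abs, abs_abs] at h1
  rw [h2, Real.norm_eq_abs, abs_mul, abs_of_pos (M.fac_pos i), abs_mul, abs_abs,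
    abs_of_pos P.κ_pos]
  exact mul_le_mul_of_nonneg_left (mul_le_mul_of_nonneg_left h1 P.κ_pos.le) (M.fac_pos i).le

/-- `localA` as a bilinear form. -/
noncomputable def formA (i : Fin M.N) : LinearMap.BilinForm ℝ (L2Pair (volume.restrict (M.elem i))) :=
  (weightForm (fun p => |P.σ p|) (aesm_abs_σ _) (M.σ_bdd i)).compl₁₂ (sndL _) (sndL _)

/-- `localS` as a bilinear form. -/
noncomputable def formS (i : Fin M.N) : LinearMap.BilinForm ℝ (L2Pair (volume.restrict (M.elem i))) :=
  (weightForm (fun p => M.fac i * |P.c p|) (M.aesm_fac_c i _) (M.fac_c_bdd i)).compl₁₂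
    (fstL _) (fstL _)

theorem formA_apply (i : Fin M.N) (v w : L2Pair (volume.restrict (M.elem i))) :
    M.formA i v w = M.localA i v w := rfl

theorem formS_apply (i : Fin M.N) (v w : L2Pair (volume.restrict (M.elem i))) :
    M.formS i v w = M.localS i v.fst w.fst := by
  change ∫ p in M.elem i, (M.fac i * |P.c p|) * inner ℝ (v.fst p) (w.fst p) = _
  refine integral_congr_ae (Filter.Eventually.of_forall fun p => ?_)
  simp only [fac, RCLike.inner_apply, conj_trivial]
  ring

theorem formA_symm (i : Fin M.N) (v w : L2Pair (volume.restrict (M.elem i))) :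
    M.formA i v w = M.formA i w v := by
  simp only [formA_apply, localA, real_inner_comm]

theorem formS_symm (i : Fin M.N) (v w : L2Pair (volume.restrict (M.elem i))) :
    M.formS i v w = M.formS i w v := by
  simp only [formS_apply, localS]
  exact integral_congr_ae (Filter.Eventually.of_forall fun p => by ring)

theorem formA_nonneg (i : Fin M.N) (v : L2Pair (volume.restrict (M.elem i))) :
    0 ≤ M.formA i v v := by
  rw [formA_apply]
  refine integral_nonneg fun p => ?_
  simp only [real_inner_self_eq_norm_sq]
  positivity

theorem formS_nonneg (i : Fin M.N) (v : L2Pair (volume.restrict (M.elem i))) :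
    0 ≤ M.formS i v v := by
  change 0 ≤ ∫ p in M.elem i, (M.fac i * |P.c p|) * inner ℝ (v.fst p) (v.fst p)
  refine integral_nonneg fun p => ?_
  simp only [real_inner_self_eq_norm_sq]
  have := (M.fac_pos i).le
  positivity

end CoarseMesh

namespace AuxBasis

variable {P : Problem} {M : CoarseMesh P} {l : ℕ} (A : AuxBasis M l)

/-- The abstract spectral gap for the eigenvalue problem in an element. -/
theorem bessel_and_gap (i : Fin M.N) {v : L2Pair (volume.restrict (M.elem i))}
    (hv : v ∈ H1sub (M.elem i)) :
    ∑ k, M.formS i v (A.ψ i k) ^ 2 ≤ M.formS i v v ∧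
    M.eigenvalue i (l + 1) * (M.formS i v v - ∑ k, M.formS i v (A.ψ i k) ^ 2) ≤ M.formA i v v := by
  refine spectral_gap (H := H1sub (M.elem i)) (ψ := A.ψ i) (ev := M.eigenvalue i) (M.formA_symm i) (M.formA_nonneg i)
    (M.formS_symm i) (M.formS_nonneg i) (fun j => A.memH1 i j) (fun j j' => ?_) (fun j w hw => ?_)
    (fun j => ?_) hv
  · rw [M.formS_apply]; exact A.orthonormal i j j'
  · rw [M.formA_apply, M.formS_apply]; exact A.eigen i j w hw
  · simp only [M.formA_apply, M.formS_apply]; rfl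

end AuxBasis
namespace CoarseMesh

variable {P : Problem} (M : CoarseMesh P)

/-! ### Decomposition of the forms into contributions of the elements -/

/-- The restriction of elements of the energy space to a coarse element. -/
noncomputable def restrV (i : Fin M.N) : P.V →ₗ[ℝ] L2Pair (volume.restrict (M.elem i)) :=
  restrL (M.elem i) ∘ₗ P.V.subtype

/-- `∫_{K_i} |σ| ∇u · ∇w` on the energy space. -/
noncomputable def vA (i : Fin M.N) : LinearMap.BilinForm ℝ P.V :=
  (M.formA i).compl₁₂ (M.restrV i) (M.restrV i)

/-- `∫_{K_i} |μ| u w` on the energy space. -/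
noncomputable def vS (i : Fin M.N) : LinearMap.BilinForm ℝ P.V :=
  (M.formS i).compl₁₂ (M.restrV i) (M.restrV i)

theorem vA_eq (i : Fin M.N) (u w : P.V) :
    M.vA i u w = M.formA i (M.restrV i u) (M.restrV i w) := rfl

theorem vS_eq (i : Fin M.N) (u w : P.V) :
    M.vS i u w = M.formS i (M.restrV i u) (M.restrV i w) := rfl

theorem restrV_fst (i : Fin M.N) (u : P.V) :
    (M.restrV i u).fst =ᵐ[volume.restrict (M.elem i)] P.val u := restr_fst _ _

theorem restrV_snd (i : Fin M.N) (u : P.V) :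
    (M.restrV i u).snd =ᵐ[volume.restrict (M.elem i)] P.grad u := restr_snd _ _

theorem restrV_mem (i : Fin M.N) (u : P.V) : M.restrV i u ∈ H1sub (M.elem i) :=
  memH1_restr (M.elem i) u.2

theorem localS_congr {i : Fin M.N} {v v' w w' : E2 → ℝ}
    (hv : v =ᵐ[volume.restrict (M.elem i)] v') (hw : w =ᵐ[volume.restrict (M.elem i)] w') :
    M.localS i v w = M.localS i v' w' := by
  refine integral_congr_ae ?_
  filter_upwards [hv, hw] with p h1 h2
  rw [h1, h2]

theorem vA_apply (i : Fin M.N) (u w : P.V) :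
    M.vA i u w = ∫ p in M.elem i, |P.σ p| * inner ℝ (P.grad u p) (P.grad w p) := by
  rw [vA_eq, formA_apply]
  refine integral_congr_ae ?_
  filter_upwards [M.restrV_snd i u, M.restrV_snd i w] with p h1 h2
  rw [h1, h2]

theorem vS_apply (i : Fin M.N) (u w : P.V) : M.vS i u w = M.localS i (P.val u) (P.val w) := by
  rw [vS_eq, formS_apply]
  exact M.localS_congr (M.restrV_fst i u) (M.restrV_fst i w)

theorem localS_eq (i : Fin M.N) (v w : E2 → ℝ) :
    M.localS i v w = ∫ p in M.elem i, (M.fac i * |P.c p|) * (v p * w p) :=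
  integral_congr_ae (Filter.Eventually.of_forall fun p => by simp only [fac]; ring)

theorem integrableOn_S {i : Fin M.N} {v w : E2 → ℝ} (hv : MemLp v 2 (volume.restrict (M.elem i)))
    (hw : MemLp w 2 (volume.restrict (M.elem i))) :
    IntegrableOn (fun p => (M.fac i * |P.c p|) * (v p * w p)) (M.elem i) := by
  refine (integrable_weight_inner (M.aesm_fac_c i _) (M.fac_c_bdd i) hv hw).congr
    (Filter.Eventually.of_forall fun p => ?_)
  simp only [RCLike.inner_apply, conj_trivial]; ring

theorem memLp_val (u : P.V) : MemLp (P.val u) 2 volume := memLp_fst _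

theorem memLp_grad (u : P.V) : MemLp (P.grad u) 2 volume := memLp_snd _

theorem integrableOn_A (i : Fin M.N) (u w : P.V) :
    IntegrableOn (fun p => |P.σ p| * inner ℝ (P.grad u p) (P.grad w p)) (M.elem i) :=
  integrable_weight_inner (aesm_abs_σ _) (M.σ_bdd i) ((memLp_grad u).restrict _)
    ((memLp_grad w).restrict _)

theorem integral_split {f : E2 → ℝ} (hf : ∀ i, IntegrableOn f (M.elem i)) :
    ∫ p in P.Ω, f p = ∑ i, ∫ p in M.elem i, f p := by
  rw [← integral_iUnion_fintype (fun i => (M.isOpen_elem i).measurableSet) M.elem_disjoint hf]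
  refine setIntegral_congr_set ?_
  refine Filter.EventuallyLE.antisymm ?_ ?_
  · exact ae_le_set.2 M.elem_cover
  · exact (Set.iUnion_subset M.elem_subset).eventuallyLE

open Classical in
/-- The sign of `σ` in an element. -/
noncomputable def sgn (i : Fin M.N) : ℝ := if M.elem i ⊆ P.Ωp then 1 else -1

theorem sgn_eq (i : Fin M.N) : M.sgn i = 1 ∨ M.sgn i = -1 := by
  unfold sgn; split_ifs <;> simp

theorem subset_of_sgn_one {i : Fin M.N} (h : M.sgn i = 1) : M.elem i ⊆ P.Ωp := by
  by_contra h'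
  rw [sgn, if_neg h'] at h
  norm_num at h

theorem subset_of_sgn_neg {i : Fin M.N} (h : M.sgn i = -1) : M.elem i ⊆ P.Ωm := by
  rcases M.elem_side i with h' | h'
  · rw [sgn, if_pos h'] at h; norm_num at h
  · exact h'

theorem ae_σ_eq (i : Fin M.N) : ∀ᵐ p ∂volume.restrict (M.elem i), P.σ p = M.sgn i * |P.σ p| := by
  rcases M.sgn_eq i with h | h
  · filter_upwards [ae_restrict_of_ae_restrict_of_subset (M.subset_of_sgn_one h) P.σ_pos] with p hp
    rw [h, abs_of_pos hp, one_mul]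
  · filter_upwards [ae_restrict_of_ae_restrict_of_subset (M.subset_of_sgn_neg h) P.σ_neg] with p hp
    rw [h, abs_of_neg hp]; ring

theorem ae_c_eq_sgn (i : Fin M.N) :
    ∀ᵐ p ∂volume.restrict (M.elem i), P.c p = M.sgn i * |P.c p| := by
  filter_upwards [M.ae_elem P.c_eq, M.ae_c_eq i, M.ae_σ_eq i] with p h1 h2 h3
  rw [h2, h1]
  linear_combination P.κ * h3

/-- The ratio of `k² |c|` and `|μ|` in an element. -/
noncomputable def ratio (i : Fin M.N) : ℝ := P.k ^ 2 * (M.fac i)⁻¹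

theorem ratio_nonneg (i : Fin M.N) : 0 ≤ M.ratio i := by
  have := M.fac_pos i
  unfold ratio; positivity

theorem ratio_le (i : Fin M.N) : M.ratio i ≤ M.μmsh⁻¹ * P.k ^ 2 * M.size ^ 2 := by
  have h1 := M.diam_pos i
  have h2 := M.μmsh_pos
  have h3 := M.diam_le_size i
  have e : M.ratio i = M.μmsh⁻¹ * P.k ^ 2 * Metric.diam (M.elem i) ^ 2 := by
    unfold ratio fac; field_simp
  rw [e]
  gcongr

theorem integral_σ_eq (u w : P.V) :
    ∫ p in P.Ω, P.σ p * inner ℝ (P.grad u p) (P.grad w p) = ∑ i, M.sgn i * M.vA i u w := by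
  have a1 : ∀ i, (fun p => M.sgn i * (|P.σ p| * inner ℝ (P.grad u p) (P.grad w p)))
      =ᵐ[volume.restrict (M.elem i)] fun p => P.σ p * inner ℝ (P.grad u p) (P.grad w p) := fun i => by
    filter_upwards [M.ae_σ_eq i] with p hp
    rw [← mul_assoc, ← hp]
  rw [M.integral_split fun i => ((M.integrableOn_A i u w).const_mul _).congr (a1 i)]
  refine Finset.sum_congr rfl fun i _ => ?_
  rw [← integral_congr_ae (a1 i), integral_const_mul, ← M.vA_apply]

theorem integral_c_eq (u w : P.V) :
    ∫ p in P.Ω, P.c p * P.val u p * P.val w p = ∑ i, M.sgn i * (M.fac i)⁻¹ * M.vS i u w := by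
  have a2 : ∀ i, (fun p => M.sgn i * (M.fac i)⁻¹ * ((M.fac i * |P.c p|) * (P.val u p * P.val w p)))
      =ᵐ[volume.restrict (M.elem i)] fun p => P.c p * P.val u p * P.val w p := fun i => by
    filter_upwards [M.ae_c_eq_sgn i] with p hp
    have h1 : (M.fac i)⁻¹ * M.fac i = 1 := inv_mul_cancel₀ (M.fac_pos i).ne'
    linear_combination (M.sgn i * |P.c p| * P.val u p * P.val w p) * h1
      - P.val u p * P.val w p * hp
  rw [M.integral_split fun i => ((M.integrableOn_S ((memLp_val u).restrict _)
    ((memLp_val w).restrict _)).const_mul _).congr (a2 i)]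
  refine Finset.sum_congr rfl fun i _ => ?_
  rw [← integral_congr_ae (a2 i), integral_const_mul, ← M.localS_eq, ← M.vS_apply]

theorem form_eq (u w : P.V) :
    P.form u w = ∑ i, M.sgn i * (M.vA i u w - M.ratio i * M.vS i u w) := by
  have h1 : ∀ (g a r v : Fin M.N → ℝ) (k : ℝ), (∑ i, g i * a i) - k * ∑ i, g i * r i * v i =
      ∑ i, g i * (a i - k * r i * v i) := fun g a r v k => by
    rw [Finset.mul_sum, ← Finset.sum_sub_distrib]
    exact Finset.sum_congr rfl fun i _ => by ring
  exact (congrArg₂ (fun s t => s - P.k ^ 2 * t) (M.integral_σ_eq u w) (M.integral_c_eq u w)).trans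
    (h1 M.sgn (fun i => M.vA i u w) (fun i => (M.fac i)⁻¹) (fun i => M.vS i u w) (P.k ^ 2))

theorem normA_eq (v : P.V) : P.normA v = √(∑ i, M.vA i v v) := by
  unfold Problem.normA
  congr 1
  have e : ∀ p, |P.σ p| * ‖P.grad v p‖ ^ 2 = |P.σ p| * inner ℝ (P.grad v p) (P.grad v p) := fun p => by
    rw [real_inner_self_eq_norm_sq]
  simp only [e, M.vA_apply]
  exact M.integral_split fun i => M.integrableOn_A i v v

theorem weight_of_mem {i : Fin M.N} {p : E2} (hp : p ∈ M.elem i) :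
    M.weight p = M.fac i * P.c p := by
  unfold weight
  rw [Finset.sum_eq_single i]
  · rw [Set.indicator_of_mem hp]; rfl
  · intro j _ hj
    exact Set.indicator_of_notMem (fun h => Set.disjoint_left.1 (M.elem_disjoint hj) h hp) _
  · simp

theorem sForm_eq {v w : E2 → ℝ} (hv : MemLp v 2 volume) (hw : MemLp w 2 volume) :
    M.sForm v w = ∑ i, M.sgn i * M.localS i v w := by
  have a : ∀ i, (fun p => M.sgn i * ((M.fac i * |P.c p|) * (v p * w p)))
      =ᵐ[volume.restrict (M.elem i)] fun p => M.weight p * v p * w p := fun i => by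
    filter_upwards [M.ae_c_eq_sgn i, ae_restrict_mem (M.isOpen_elem i).measurableSet] with p h1 h2
    rw [M.weight_of_mem h2]
    linear_combination -(M.fac i * v p * w p) * h1
  unfold sForm
  rw [M.integral_split fun i =>
    ((M.integrableOn_S (hv.restrict _) (hw.restrict _)).const_mul _).congr (a i)]
  refine Finset.sum_congr rfl fun i _ => ?_
  rw [← integral_congr_ae (a i), integral_const_mul, ← M.localS_eq]

theorem normS_eq {v : E2 → ℝ} (hv : MemLp v 2 volume) :
    M.normS v = √(∑ i, M.localS i v v) := by
  have a : ∀ i, (fun p => (M.fac i * |P.c p|) * (v p * v p))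
      =ᵐ[volume.restrict (M.elem i)] fun p => |M.weight p| * v p ^ 2 := fun i => by
    filter_upwards [ae_restrict_mem (M.isOpen_elem i).measurableSet] with p h2
    rw [M.weight_of_mem h2, abs_mul, abs_of_pos (M.fac_pos i)]; ring
  unfold normS
  rw [M.integral_split fun i => (M.integrableOn_S (hv.restrict _) (hv.restrict _)).congr (a i)]
  congr 1
  refine Finset.sum_congr rfl fun i _ => ?_
  rw [← integral_congr_ae (a i), ← M.localS_eq]

theorem normS_val (v : P.V) : M.normS (P.val v) = √(∑ i, M.vS i v v) := by
  rw [M.normS_eq (memLp_val v)]; simp only [M.vS_apply]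

theorem ae_c_pos (i : Fin M.N) : ∀ᵐ p ∂volume.restrict (M.elem i), 0 < M.fac i * |P.c p| := by
  obtain ⟨lo, hi, hlo, h⟩ := P.σ_bounds
  filter_upwards [M.ae_elem h, M.ae_c_eq i] with p h1 h2
  rw [h2]
  exact mul_pos (M.fac_pos i) (mul_pos P.κ_pos (hlo.trans_le h1.1))

theorem localS_self_eq_zero {i : Fin M.N} {v : E2 → ℝ}
    (hv : MemLp v 2 (volume.restrict (M.elem i))) :
    M.localS i v v = 0 ↔ ∀ᵐ p ∂volume.restrict (M.elem i), v p = 0 := by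
  rw [M.localS_eq, setIntegral_eq_zero_iff_of_nonneg_ae ?_ (M.integrableOn_S hv hv)]
  · constructor
    · intro h
      filter_upwards [h, M.ae_c_pos i] with p h1 h2
      have h1' : (M.fac i * |P.c p|) * (v p * v p) = 0 := h1
      rcases mul_eq_zero.1 h1' with h | h
      · exact absurd h h2.ne'
      · exact mul_self_eq_zero.1 h
    · intro h
      filter_upwards [h] with p h1
      simp [h1]
  · filter_upwards [M.ae_c_pos i] with p h
    exact mul_nonneg h.le (mul_self_nonneg _)

theorem vS_eq_zero {i : Fin M.N} {u : P.V} :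
    M.vS i u u = 0 ↔ ∀ᵐ p ∂volume.restrict (M.elem i), P.val u p = 0 := by
  rw [M.vS_apply, M.localS_self_eq_zero ((memLp_val u).restrict _)]

theorem vA_eq_zero {i : Fin M.N} {u : P.V} (h : M.vS i u u = 0) : M.vA i u u = 0 := by
  have h1 := snd_ae_zero_of_fst (M.isOpen_elem i) u.2 (M.vS_eq_zero.1 h)
  rw [M.vA_apply]
  refine integral_eq_zero_of_ae ?_
  filter_upwards [h1] with p hp
  have : P.grad u p = 0 := hp
  rw [this]; simp

theorem vanishesOn_iff {I : Set (Fin M.N)} {v : P.V} :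
    Patches.VanishesOn M I v ↔ ∀ j ∈ I, M.vS j v v = 0 :=
  forall₂_congr fun _ _ => M.vS_eq_zero.symm

theorem vA_symm (i : Fin M.N) (u w : P.V) : M.vA i u w = M.vA i w u := M.formA_symm i _ _
theorem vS_symm (i : Fin M.N) (u w : P.V) : M.vS i u w = M.vS i w u := M.formS_symm i _ _
theorem vA_nonneg (i : Fin M.N) (u : P.V) : 0 ≤ M.vA i u u := M.formA_nonneg i _
theorem vS_nonneg (i : Fin M.N) (u : P.V) : 0 ≤ M.vS i u u := M.formS_nonneg i _

end CoarseMesh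

namespace AuxBasis

variable {P : Problem} {M : CoarseMesh P} {l : ℕ} (A : AuxBasis M l)

/-! ### The auxiliary space and its projection -/

/-- The coefficient of `ψ_i^k` in the projection of an element of the energy space. -/
noncomputable def coef (i : Fin M.N) (k : Fin l) : P.V →ₗ[ℝ] ℝ :=
  (M.formS i).flip (A.ψ i k) ∘ₗ M.restrV i

theorem coef_eq (i : Fin M.N) (k : Fin l) (u : P.V) :
    A.coef i k u = M.formS i (M.restrV i u) (A.ψ i k) := rfl

theorem fn_ae (i : Fin M.N) (k : Fin l) :
    A.fn i k =ᵐ[volume.restrict (M.elem i)] (A.ψ i k).fst :=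
  indicator_ae_eq_restrict (M.isOpen_elem i).measurableSet

theorem coef_apply (i : Fin M.N) (k : Fin l) (u : P.V) :
    A.coef i k u = M.localS i (P.val u) (A.fn i k) := by
  rw [coef_eq, M.formS_apply]
  exact M.localS_congr (M.restrV_fst i u) (A.fn_ae i k).symm

theorem memLp_fn (i : Fin M.N) (k : Fin l) : MemLp (A.fn i k) 2 volume :=
  (memLp_indicator_iff_restrict (M.isOpen_elem i).measurableSet).2 (Lp.memLp _)

/-- The function of the auxiliary space with given coefficients. -/
noncomputable def auxFn (b : Fin M.N → Fin l → ℝ) : E2 → ℝ := fun p =>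
  ∑ i, ∑ j, b i j * A.fn i j p

theorem proj_eq (u : P.V) : A.proj (P.val u) = A.auxFn fun i j => A.coef i j u := by
  funext p
  simp only [proj, auxFn, coef_apply]

theorem memLp_auxFn (b : Fin M.N → Fin l → ℝ) : MemLp (A.auxFn b) 2 volume :=
  memLp_finsetSum _ fun i _ => memLp_finsetSum _ fun j _ => (A.memLp_fn i j).const_mul _

theorem auxFn_of_mem (b : Fin M.N → Fin l → ℝ) {i : Fin M.N} {p : E2} (hp : p ∈ M.elem i) :
    A.auxFn b p = ∑ j, b i j * (A.ψ i j).fst p := by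
  unfold auxFn
  rw [Finset.sum_eq_single i]
  · exact Finset.sum_congr rfl fun j _ => by rw [fn, Set.indicator_of_mem hp]
  · intro i' _ hi
    refine Finset.sum_eq_zero fun j _ => ?_
    rw [fn, Set.indicator_of_notMem (fun h => Set.disjoint_left.1 (M.elem_disjoint hi) h hp),
      mul_zero]
  · simp

theorem fst_sum_ae (i : Fin M.N) (c : Fin l → ℝ) :
    (∑ k, c k • A.ψ i k).fst =ᵐ[volume.restrict (M.elem i)]
      fun p => ∑ k, c k * (A.ψ i k).fst p := by
  have h1 : (∑ k, c k • A.ψ i k).fst = ∑ k, c k • (A.ψ i k).fst := by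
    change fstL _ _ = _
    rw [map_sum]; rfl
  rw [h1]
  have h2 : ∀ s : Finset (Fin l), (∑ k ∈ s, c k • (A.ψ i k).fst : Lp ℝ 2 _)
      =ᵐ[volume.restrict (M.elem i)] fun p => ∑ k ∈ s, c k * (A.ψ i k).fst p := by
    intro s
    induction s using Finset.induction_on with
    | empty => simp only [Finset.sum_empty]; exact Lp.coeFn_zero ℝ 2 _
    | insert k s hk ih =>
      rw [Finset.sum_insert hk]
      filter_upwards [Lp.coeFn_add (c k • (A.ψ i k).fst) (∑ k ∈ s, c k • (A.ψ i k).fst), ih,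
        Lp.coeFn_smul (c k) (A.ψ i k).fst] with p h1 h2 h3
      rw [h1, Pi.add_apply, h2, h3, Finset.sum_insert hk]; rfl
  exact h2 Finset.univ

theorem auxFn_ae (b : Fin M.N → Fin l → ℝ) (i : Fin M.N) :
    A.auxFn b =ᵐ[volume.restrict (M.elem i)] (∑ k, b i k • A.ψ i k).fst := by
  filter_upwards [A.fst_sum_ae i (b i), ae_restrict_mem (M.isOpen_elem i).measurableSet] with p h1 h2
  rw [h1, A.auxFn_of_mem b h2]

theorem formS_ψ (i : Fin M.N) (j j' : Fin l) :
    M.formS i (A.ψ i j) (A.ψ i j') = if j = j' then 1 else 0 := by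
  rw [M.formS_apply]; exact A.orthonormal i j j'

theorem localS_auxFn (b d : Fin M.N → Fin l → ℝ) (i : Fin M.N) :
    M.localS i (A.auxFn b) (A.auxFn d) = ∑ k, b i k * d i k := by
  rw [M.localS_congr (A.auxFn_ae b i) (A.auxFn_ae d i), ← M.formS_apply, form_sum_left]
  refine Finset.sum_congr rfl fun k _ => ?_
  rw [form_sum_right]
  simp [A.formS_ψ]

theorem sForm_auxFn (b d : Fin M.N → Fin l → ℝ) :
    M.sForm (A.auxFn b) (A.auxFn d) = ∑ i, M.sgn i * ∑ k, b i k * d i k := by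
  rw [M.sForm_eq (A.memLp_auxFn b) (A.memLp_auxFn d)]
  simp only [A.localS_auxFn]

theorem normS_auxFn (b : Fin M.N → Fin l → ℝ) :
    M.normS (A.auxFn b) = √(∑ i, ∑ k, b i k ^ 2) := by
  rw [M.normS_eq (A.memLp_auxFn b)]
  simp only [A.localS_auxFn, sq]

theorem auxFn_sub (b d : Fin M.N → Fin l → ℝ) (p : E2) :
    A.auxFn (b - d) p = A.auxFn b p - A.auxFn d p := by
  simp [auxFn, sub_mul, Finset.sum_sub_distrib]

theorem auxFn_ae_eq_iff {b d : Fin M.N → Fin l → ℝ} :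
    A.auxFn b =ᵐ[volume.restrict P.Ω] A.auxFn d ↔ b = d := by
  refine ⟨fun h => ?_, fun h => by rw [h]⟩
  funext i k
  have h1 : ∀ᵐ p ∂volume.restrict (M.elem i), A.auxFn (b - d) p = 0 := by
    filter_upwards [M.ae_elem h] with p hp
    rw [A.auxFn_sub, hp, sub_self]
  have h2 := (M.localS_self_eq_zero ((A.memLp_auxFn (b - d)).restrict _)).2 h1
  rw [A.localS_auxFn] at h2
  have h3 := (Finset.sum_eq_zero_iff_of_nonneg
    (fun k _ => mul_self_nonneg ((b - d) i k))).1 h2 k (Finset.mem_univ k)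
  have := mul_self_eq_zero.1 h3
  simpa [sub_eq_zero] using this

theorem mem_kernel_iff {u : P.V} : u ∈ A.kernel ↔ ∀ i k, A.coef i k u = 0 := by
  have h0 : A.auxFn 0 = 0 := by funext p; simp [auxFn]
  change A.proj (P.val u) =ᵐ[volume.restrict P.Ω] 0 ↔ _
  rw [A.proj_eq, ← h0, A.auxFn_ae_eq_iff]
  exact ⟨fun h i k => congrFun (congrFun h i) k, fun h => funext fun i => funext fun k => h i k⟩

open Classical in
/-- The coefficients supported in a single element. -/
noncomputable def single (i : Fin M.N) (b : Fin l → ℝ) : Fin M.N → Fin l → ℝ := Pi.single i b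

theorem auxFn_single (i : Fin M.N) (b : Fin l → ℝ) :
    A.auxFn (single i b) = fun p => ∑ j, b j * A.fn i j p := by
  classical
  funext p
  unfold auxFn single
  rw [Finset.sum_eq_single i]
  · simp
  · intro j _ hj
    simp [Pi.single_eq_of_ne hj]
  · simp

theorem sum_single (i : Fin M.N) (b : Fin l → ℝ) (f : Fin M.N → (Fin l → ℝ) → ℝ)
    (hf : ∀ i, f i 0 = 0) : ∑ j, f j (single i b j) = f i b := by
  classical
  unfold single
  rw [Finset.sum_eq_single i]
  · simp
  · intro j _ hj
    rw [Pi.single_eq_of_ne hj, hf]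
  · simp

theorem sForm_proj (u w : P.V) : M.sForm (A.proj (P.val u)) (A.proj (P.val w)) =
    ∑ i, M.sgn i * ∑ k, A.coef i k u * A.coef i k w := by
  rw [A.proj_eq, A.proj_eq, A.sForm_auxFn]

theorem sForm_fn_proj (i : Fin M.N) (j : Fin l) (w : P.V) :
    M.sForm (A.fn i j) (A.proj (P.val w)) = M.sgn i * A.coef i j w := by
  classical
  have h : A.fn i j = A.auxFn (single i (Pi.single j 1)) := by
    rw [A.auxFn_single]
    funext p
    simp [Pi.single_apply]
  rw [h, A.proj_eq, A.sForm_auxFn,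
    sum_single i _ (fun i b => M.sgn i * ∑ k, b k * A.coef i k w) (by simp)]
  simp [Pi.single_apply]

end AuxBasis
namespace LocalizedSystem

variable {V ι κ : Type*} [NormedAddCommGroup V] [InnerProductSpace ℝ V]
  [Fintype ι] [Fintype κ] [DecidableEq ι] {q τ Λ Cl Col : ℝ} (S : LocalizedSystem V ι κ q τ Λ Cl Col)

/-! ### Continuity of the form on the kernel of the projection -/

/-- Where the projection vanishes, the spectral gap gains a factor `Λ⁻¹` in the weighted `L²` norm,
which compensates for half of the bound `C Λ` of the lower order term. -/
theorem abs_b_le_of_mem_ker {C y : ℝ} (hC : 0 ≤ C) (hω : ∀ j, S.ω j ≤ C * Λ) (hy : 0 ≤ y) {u w : V}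
    (hu : S.sTot u u ≤ y ^ 2 * S.aTot u u) (hw : w ∈ S.ker) :
    |S.b u w| ≤ (1 + C * √Λ * y) * S.nA u * S.nA w := by
  have hΛ : 0 < Λ := zero_lt_one.trans_le S.one_le_gap
  have h1 : √(S.sTot u u) ≤ y * S.nA u := by
    refine Real.sqrt_le_iff.2 ⟨mul_nonneg hy (S.nA_nonneg u), ?_⟩
    rw [mul_pow, S.nA_sq]; exact hu
  have h2 : √Λ * √(S.sTot w w) ≤ S.nA w := by
    rw [← Real.sqrt_mul hΛ.le]
    refine Real.sqrt_le_sqrt ?_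
    rw [sTot_apply, aTot_apply, Finset.mul_sum]
    refine Finset.sum_le_sum fun j _ => ?_
    have := S.gap_le j w
    rw [Finset.sum_eq_zero fun k _ => by rw [mem_ker.1 hw]; ring, sub_zero] at this
    exact this
  have h3 : |S.b u w| ≤ ∑ j, √(S.a j u u) * √(S.a j w w) +
      C * Λ * ∑ j, √(S.s j u u) * √(S.s j w w) := by
    rw [b_apply, Finset.mul_sum, ← Finset.sum_add_distrib]
    refine (Finset.abs_sum_le_sum_abs _ _).trans (Finset.sum_le_sum fun j _ => ?_)
    rw [bAt_apply, abs_mul, sgn_abs, one_mul]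
    refine (abs_sub _ _).trans (add_le_add
      (abs_le_sqrt_mul_sqrt (S.a_symm j) (S.a_nonneg j) u w) ?_)
    rw [abs_mul, abs_of_nonneg (S.ω_nonneg j)]
    exact mul_le_mul (hω j) (abs_le_sqrt_mul_sqrt (S.s_symm j) (S.s_nonneg j) u w)
      (abs_nonneg _) (mul_nonneg hC hΛ.le)
  have h4 := sum_mul_le_sqrt Finset.univ (fun j => S.a_nonneg j u) fun j => S.a_nonneg j w
  have h5 := sum_mul_le_sqrt Finset.univ (fun j => S.s_nonneg j u) fun j => S.s_nonneg j w
  rw [← aTot_apply, ← aTot_apply] at h4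
  rw [← sTot_apply, ← sTot_apply] at h5
  have h6 := mul_le_mul h1 h2 (by positivity) (mul_nonneg hy (S.nA_nonneg u))
  have h7 : C * Λ * (√(S.sTot u u) * √(S.sTot w w)) ≤ C * √Λ * (y * S.nA u * S.nA w) := by
    have e : C * Λ * (√(S.sTot u u) * √(S.sTot w w)) =
        C * √Λ * (√(S.sTot u u) * (√Λ * √(S.sTot w w))) := by
      linear_combination -(C * (√(S.sTot u u) * √(S.sTot w w))) * Real.mul_self_sqrt hΛ.le
    rw [e]
    exact mul_le_mul_of_nonneg_left h6 (mul_nonneg hC (Real.sqrt_nonneg _))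
  have h8 := mul_le_mul_of_nonneg_left h5 (mul_nonneg hC hΛ.le)
  have h9 : (1 + C * √Λ * y) * S.nA u * S.nA w =
    S.nA u * S.nA w + C * √Λ * (y * S.nA u * S.nA w) := by ring
  rw [h9]
  exact h3.trans (add_le_add h4 (h8.trans h7))

end LocalizedSystem

namespace CoarseMesh

variable {P : Problem} (M : CoarseMesh P)

theorem gap_le_eigenvalue (l : ℕ) (i : Fin M.N) : M.gap l ≤ M.eigenvalue i (l + 1) :=
  ciInf_le (Set.finite_range _).bddBelow i

/-! ### Equivalence of the energy norm and the `H¹` norm -/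

theorem norm_sq_eq (x : L2Pair volume) : ‖x‖ ^ 2 = ‖x.fst‖ ^ 2 + ‖x.snd‖ ^ 2 :=
  WithLp.prod_norm_sq_eq_of_L2 x

theorem lp_norm_sq {E : Type*} [NormedAddCommGroup E] [InnerProductSpace ℝ E] {ν : Measure E2}
    (f : Lp E 2 ν) : ‖f‖ ^ 2 = ∫ p, ‖f p‖ ^ 2 ∂ν := by
  rw [← real_inner_self_eq_norm_sq, L2.inner_def]
  simp only [real_inner_self_eq_norm_sq]

theorem integrable_val_sq (u : P.V) : Integrable (fun p => P.val u p ^ 2) volume :=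
  (memLp_val u).integrable_sq

theorem integrable_grad_sq (u : P.V) : Integrable (fun p => ‖P.grad u p‖ ^ 2) volume :=
  (memLp_grad u).integrable_norm_pow (by norm_num)

theorem vA_self (i : Fin M.N) (u : P.V) :
    M.vA i u u = ∫ p in M.elem i, |P.σ p| * ‖P.grad u p‖ ^ 2 := by
  rw [M.vA_apply]; simp only [real_inner_self_eq_norm_sq]

theorem vS_self (i : Fin M.N) (u : P.V) :
    M.vS i u u = M.fac i * P.κ * ∫ p in M.elem i, |P.σ p| * P.val u p ^ 2 := by
  rw [M.vS_apply, M.localS_eq, ← integral_const_mul]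
  refine integral_congr_ae ?_
  filter_upwards [M.ae_c_eq i] with p hp
  rw [hp]; ring

theorem integrableOn_σ_mul {F : E2 → ℝ} (hF : Integrable F volume) :
    IntegrableOn (fun p => |P.σ p| * F p) P.Ω := by
  obtain ⟨lo, hi, _, h⟩ := P.σ_bounds
  refine Integrable.bdd_mul (c := hi) hF.integrableOn (aesm_abs_σ _) ?_
  exact h.mono fun p hp => by rw [Real.norm_eq_abs, abs_abs]; exact hp.2

theorem integral_σ_mul {F : E2 → ℝ} (hF : Integrable F volume) :
    ∫ p in P.Ω, |P.σ p| * F p = ∑ i, ∫ p in M.elem i, |P.σ p| * F p :=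
  M.integral_split fun i => (integrableOn_σ_mul hF).mono_set (M.elem_subset i)

/-- The energy norm dominates the `H¹` norm, by the Poincaré inequality. -/
theorem vA_vS_lower : ∃ C : ℝ, 0 < C ∧ ∀ u : P.V, C * ‖u‖ ^ 2 ≤ ∑ i, M.vA i u u := by
  obtain ⟨lo, hi, hlo, h⟩ := P.σ_bounds
  obtain ⟨r, hr⟩ := P.bounded_Ω.exists_norm_le
  refine ⟨lo / (4 * r ^ 2 + 1), by positivity, fun u => ?_⟩
  have h1 := poincare hr u.2
  have h2 : ‖u‖ ^ 2 = ‖(u : L2Pair volume).fst‖ ^ 2 + ‖(u : L2Pair volume).snd‖ ^ 2 :=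
    norm_sq_eq (u : L2Pair volume)
  have h3 : ‖(u : L2Pair volume).snd‖ ^ 2 = ∫ p in P.Ω, ‖P.grad u p‖ ^ 2 := by
    have e : ‖(u : L2Pair volume).snd‖ ^ 2 = ∫ p, ‖P.grad u p‖ ^ 2 := lp_norm_sq _
    rw [e, ← integral_add_compl P.isOpen_Ω.measurableSet (integrable_grad_sq u)]
    have : ∫ p in P.Ωᶜ, ‖P.grad u p‖ ^ 2 = 0 := by
      refine integral_eq_zero_of_ae ?_
      filter_upwards [ae_zero_outside P.isOpen_Ω.measurableSet u.2] with p hp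
      have : P.grad u p = 0 := hp.2
      rw [this]; simp
    rw [this, add_zero]
  have h4 : lo * ∫ p in P.Ω, ‖P.grad u p‖ ^ 2 ≤ ∑ i, M.vA i u u := by
    simp only [M.vA_self]
    rw [← M.integral_σ_mul (integrable_grad_sq u), ← integral_const_mul]
    refine integral_mono_ae ((integrable_grad_sq u).integrableOn.const_mul _)
      (integrableOn_σ_mul (integrable_grad_sq u)) ?_
    filter_upwards [h] with p hp
    exact mul_le_mul_of_nonneg_right hp.1 (sq_nonneg _)
  refine le_trans ?_ h4
  rw [div_mul_eq_mul_div, div_le_iff₀ (by positivity), h2, ← h3, mul_assoc]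
  refine mul_le_mul_of_nonneg_left ?_ hlo.le
  linarith

theorem norm_sq_eq_integral (u : P.V) :
    ‖u‖ ^ 2 = (∫ p, P.val u p ^ 2) + ∫ p, ‖P.grad u p‖ ^ 2 := by
  have h2 : ‖u‖ ^ 2 = ‖(u : L2Pair volume).fst‖ ^ 2 + ‖(u : L2Pair volume).snd‖ ^ 2 :=
    norm_sq_eq (u : L2Pair volume)
  have e1 : ∫ p, P.val u p ^ 2 = ∫ p, ‖(u : L2Pair volume).fst p‖ ^ 2 :=
    integral_congr_ae (Filter.Eventually.of_forall fun p => (sq_abs _).symm)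
  have e2 : ∫ p, ‖P.grad u p‖ ^ 2 = ‖(u : L2Pair volume).snd‖ ^ 2 := (lp_norm_sq _).symm
  rw [e1, e2, h2, lp_norm_sq (u : L2Pair volume).fst]

theorem integral_elem_le : ∃ C : ℝ, 0 ≤ C ∧ ∀ (i : Fin M.N) {F : E2 → ℝ}
    (_ : Integrable F volume) (_ : ∀ p, 0 ≤ F p),
    ∫ p in M.elem i, |P.σ p| * F p ≤ C * ∫ p, F p := by
  obtain ⟨lo, hi, hlo, h⟩ := P.σ_bounds
  refine ⟨|hi|, abs_nonneg hi, fun i F hF h0 => ?_⟩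
  refine le_trans ?_ (mul_le_mul_of_nonneg_left
    (setIntegral_le_integral (s := M.elem i) hF (Filter.Eventually.of_forall h0)) (abs_nonneg hi))
  rw [← integral_const_mul]
  refine integral_mono_ae ((integrableOn_σ_mul hF).mono_set (M.elem_subset i))
    (hF.integrableOn.const_mul _) ?_
  filter_upwards [M.ae_elem h] with p hp
  exact mul_le_mul_of_nonneg_right (hp.2.trans (le_abs_self hi)) (h0 p)

theorem vA_vS_upper : ∃ C : ℝ, 0 < C ∧ ∀ u : P.V, ∑ i, (M.vA i u u + M.vS i u u) ≤ C * ‖u‖ ^ 2 := by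
  obtain ⟨t, ht, hb⟩ := M.integral_elem_le
  have hf : ∀ i, 0 ≤ M.fac i * P.κ := fun i => mul_nonneg (M.fac_pos i).le P.κ_pos.le
  refine ⟨∑ i, (t + M.fac i * P.κ * t) + 1, add_pos_of_nonneg_of_pos (Finset.sum_nonneg fun i _ =>
    add_nonneg ht (mul_nonneg (hf i) ht)) one_pos, fun u => ?_⟩
  have key : ∀ {t f A S x y : ℝ}, 0 ≤ t → 0 ≤ f → 0 ≤ x → 0 ≤ y → A ≤ t * y → S ≤ t * x →
      A + f * S ≤ (t + f * t) * (x + y) := fun {t f A S x y} ht hf hx hy hA hS => by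
    have b1 := mul_le_mul_of_nonneg_left hS hf
    have b2 := mul_nonneg ht hx
    have b3 := mul_nonneg (mul_nonneg hf ht) hy
    linarith
  refine (Finset.sum_le_sum fun i _ => ?_).trans
    ((Finset.sum_mul _ _ _).symm.le.trans (mul_le_mul_of_nonneg_right
      (le_add_of_nonneg_right zero_le_one) (sq_nonneg ‖u‖)))
  rw [M.vA_self, M.vS_self, norm_sq_eq_integral]
  exact key ht (hf i) (integral_nonneg fun p => sq_nonneg _)
    (integral_nonneg fun p => sq_nonneg _)
    (hb i (integrable_grad_sq u) fun p => sq_nonneg _)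
    (hb i (integrable_val_sq u) fun p => sq_nonneg _)

theorem eq_zero_of_vS {u : P.V} (h : ∀ i, M.vS i u u = 0) : u = 0 := by
  obtain ⟨C, hC, hl⟩ := M.vA_vS_lower
  have h1 := hl u
  rw [Finset.sum_eq_zero fun i _ => M.vA_eq_zero (h i)] at h1
  have : ‖u‖ ^ 2 ≤ 0 := by nlinarith
  simpa using this

/-! ### Reflection and contrast -/

/-- If `Ω⁻` is a null set, the essential supremum is that of the zero filter, which is `0` in the
real numbers. -/
theorem essSup_nonneg : 0 ≤ essSup (fun p => |P.σ p|) (volume.restrict P.Ωm) := by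
  by_contra! h
  have hb : Filter.IsBoundedUnder (· ≤ ·) (ae (volume.restrict P.Ωm)) fun p => |P.σ p| := by
    obtain ⟨lo, hi, _, hh⟩ := P.σ_bounds
    exact ⟨hi, Filter.eventually_map.2
      ((ae_restrict_of_ae_restrict_of_subset P.Ωm_subset hh).mono fun p hp => hp.2)⟩
  have h1 : ∀ᵐ p ∂volume.restrict P.Ωm, False := by
    filter_upwards [ae_le_essSup hb] with p hp
    exact absurd (hp.trans_lt h) (not_lt.2 (abs_nonneg _))
  have h2 : ae (volume.restrict P.Ωm) = ⊥ := Filter.eventually_false_iff_eq_bot.1 h1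
  rw [essSup, h2, Filter.limsup_eq] at h
  simp at h

theorem ae_abs_σ_le : ∀ᵐ p ∂volume.restrict P.Ωm,
    |P.σ p| ≤ essSup (fun p => |P.σ p|) (volume.restrict P.Ωm) := by
  obtain ⟨lo, hi, _, hh⟩ := P.σ_bounds
  exact ae_le_essSup ⟨hi, Filter.eventually_map.2
    ((ae_restrict_of_ae_restrict_of_subset P.Ωm_subset hh).mono fun p hp => hp.2)⟩

theorem ae_le_σ : ∀ᵐ p ∂volume.restrict P.Ωp,
    essInf P.σ (volume.restrict P.Ωp) ≤ P.σ p :=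
  ae_essInf_le ⟨0, Filter.eventually_map.2 (P.σ_pos.mono fun _ hp => hp.le)⟩

theorem sum_neg_le {F : E2 → ℝ} (hF : Integrable F volume) (h0 : ∀ p, 0 ≤ F p) :
    ∑ j with M.sgn j = -1, ∫ p in M.elem j, |P.σ p| * F p ≤
      essSup (fun p => |P.σ p|) (volume.restrict P.Ωm) * ∫ p in P.Ωm, F p := by
  have h1 : ∑ j with M.sgn j = -1, ∫ p in M.elem j, |P.σ p| * F p =
      ∫ p in ⋃ j ∈ Finset.univ.filter fun j => M.sgn j = -1, M.elem j, |P.σ p| * F p := by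
    rw [integral_biUnion_finset _ (fun j _ => (M.isOpen_elem j).measurableSet)
      (fun i _ j _ hij => M.elem_disjoint hij)
      fun j _ => (integrableOn_σ_mul hF).mono_set (M.elem_subset j)]
  have h2 : (⋃ j ∈ Finset.univ.filter fun j => M.sgn j = -1, M.elem j) ⊆ P.Ωm :=
    Set.iUnion₂_subset fun j hj => M.subset_of_sgn_neg (Finset.mem_filter.1 hj).2
  have h3 : IntegrableOn (fun p => |P.σ p| * F p) P.Ωm :=
    (integrableOn_σ_mul hF).mono_set P.Ωm_subset
  rw [h1, ← integral_const_mul]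
  refine (setIntegral_mono_set h3 (Filter.Eventually.of_forall fun p =>
    mul_nonneg (abs_nonneg _) (h0 p)) h2.eventuallyLE).trans ?_
  refine integral_mono_ae h3 (hF.integrableOn.const_mul _) ?_
  filter_upwards [ae_abs_σ_le] with p hp
  exact mul_le_mul_of_nonneg_right hp (h0 p)

theorem pos_le_sum {F : E2 → ℝ} (hF : Integrable F volume) (h0 : ∀ p, 0 ≤ F p) :
    essInf P.σ (volume.restrict P.Ωp) * ∫ p in P.Ωp, F p ≤
      ∑ i, ∫ p in M.elem i, |P.σ p| * F p := by
  rw [← M.integral_σ_mul hF, ← integral_const_mul]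
  refine le_trans (integral_mono_ae (hF.integrableOn.const_mul _)
    ((integrableOn_σ_mul hF).mono_set P.Ωp_subset) ?_)
    (setIntegral_mono_set (integrableOn_σ_mul hF) (Filter.Eventually.of_forall fun p =>
      mul_nonneg (abs_nonneg _) (h0 p)) P.Ωp_subset.eventuallyLE)
  filter_upwards [ae_le_σ (P := P)] with p hp
  exact mul_le_mul_of_nonneg_right (hp.trans (le_abs_self _)) (h0 p)

/-- A bound `B` of an extension from `Ω⁺` to `Ω⁻` becomes `B / √Υ` after weighting with `|σ|`. -/
theorem sum_neg_le_contrast {Υ B : ℝ} (hΥ : 0 < Υ) (hc : Υ ≤ P.contrast)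
    {F G : E2 → ℝ} (hF : Integrable F volume) (hF0 : ∀ p, 0 ≤ F p) (hG : Integrable G volume)
    (hG0 : ∀ p, 0 ≤ G p) (h : √(∫ p in P.Ωm, G p) ≤ B * √(∫ p in P.Ωp, F p)) :
    ∑ j with M.sgn j = -1, ∫ p in M.elem j, |P.σ p| * G p ≤
      B ^ 2 / Υ * ∑ i, ∫ p in M.elem i, |P.σ p| * F p := by
  set s₁ := essInf P.σ (volume.restrict P.Ωp) with hs₁
  set s₂ := essSup (fun p => |P.σ p|) (volume.restrict P.Ωm) with hs₂
  have h2 : 0 ≤ s₂ := essSup_nonneg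
  have hcd : P.contrast = s₁ / s₂ := rfl
  rw [hcd] at hc
  -- a quotient by zero would be zero, against the positive lower bound of the contrast
  have h2' : 0 < s₂ := by
    rcases h2.eq_or_lt with h' | h'
    · rw [← h', div_zero] at hc; linarith
    · exact h'
  rw [le_div_iff₀ h2'] at hc
  have i1 : 0 ≤ ∫ p in P.Ωp, F p := integral_nonneg hF0
  have i2 : 0 ≤ ∫ p in P.Ωm, G p := integral_nonneg hG0
  have h3 : ∫ p in P.Ωm, G p ≤ B ^ 2 * ∫ p in P.Ωp, F p := by
    have := pow_le_pow_left₀ (Real.sqrt_nonneg _) h 2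
    rwa [mul_pow, Real.sq_sqrt i1, Real.sq_sqrt i2] at this
  have h4 := M.pos_le_sum hF hF0
  have h5 := M.sum_neg_le hG hG0
  rw [← hs₁] at h4
  rw [← hs₂] at h5
  refine h5.trans ?_
  rw [div_mul_eq_mul_div, le_div_iff₀ hΥ]
  calc s₂ * (∫ p in P.Ωm, G p) * Υ ≤ s₂ * (B ^ 2 * ∫ p in P.Ωp, F p) * Υ := by gcongr
    _ = B ^ 2 * (Υ * s₂ * ∫ p in P.Ωp, F p) := by ring
    _ ≤ B ^ 2 * (s₁ * ∫ p in P.Ωp, F p) := by gcongr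
    _ ≤ _ := by gcongr

theorem val_sub (u v : P.V) : P.val (u - v) =ᵐ[volume] fun p => P.val u p - P.val v p :=
  Lp.coeFn_sub (u : L2Pair volume).fst (v : L2Pair volume).fst

theorem ae_plus {i : Fin M.N} (h : M.sgn i = 1) {p : E2 → Prop}
    (hp : ∀ᵐ x ∂volume.restrict P.Ωp, p x) : ∀ᵐ x ∂volume.restrict (M.elem i), p x :=
  ae_restrict_of_ae_restrict_of_subset (M.subset_of_sgn_one h) hp

theorem ae_minus {i : Fin M.N} (h : M.sgn i = -1) {p : E2 → Prop}
    (hp : ∀ᵐ x ∂volume.restrict P.Ωm, p x) : ∀ᵐ x ∂volume.restrict (M.elem i), p x :=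
  ae_restrict_of_ae_restrict_of_subset (M.subset_of_sgn_neg h) hp

variable {R₀ R₁ : ℝ} (R : Reflection P R₀ R₁)

theorem vS_ext_sub {i : Fin M.N} (h : M.sgn i = 1) (u : P.V) :
    M.vS i (R.ext u - u) (R.ext u - u) = 0 := by
  rw [M.vS_eq_zero]
  filter_upwards [M.ae_plus h (R.ext_eq u), ae_restrict_of_ae (val_sub (R.ext u) u)] with p h1 h2
  rw [h2, h1, sub_self]

/-- The extension depends only on the values in `Ω⁺`: the difference of `u` and its extension vanishes
there, and hence its extension vanishes in `Ω⁻` by the `L²` bound. -/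
theorem ext_ext (M : CoarseMesh P) {R₀ R₁ : ℝ} (R : Reflection P R₀ R₁) (u : P.V) :
    R.ext (R.ext u) = R.ext u := by
  set d := R.ext u - u with hd
  have hd0 : ∀ᵐ p ∂volume.restrict P.Ωp, P.val d p = 0 := by
    filter_upwards [R.ext_eq u, ae_restrict_of_ae (val_sub (R.ext u) u)] with p h1 h2
    rw [h2, h1, sub_self]
  have hm : ∀ᵐ p ∂volume.restrict P.Ωm, P.val (R.ext d) p = 0 := by
    have h1 := R.bound_zero d
    have h2 : ∫ p in P.Ωp, P.val d p ^ 2 = 0 :=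
      integral_eq_zero_of_ae (hd0.mono fun p hp => by simp [hp])
    rw [h2, Real.sqrt_zero, mul_zero, Real.sqrt_le_left le_rfl] at h1
    have h3 : ∫ p in P.Ωm, P.val (R.ext d) p ^ 2 = 0 :=
      le_antisymm (by simpa using h1) (integral_nonneg fun p => sq_nonneg _)
    rw [integral_eq_zero_iff_of_nonneg (fun p => sq_nonneg _)
      (integrable_val_sq (R.ext d)).integrableOn] at h3
    filter_upwards [h3] with p hp
    simpa using hp
  have h0 : R.ext d = 0 := by
    refine M.eq_zero_of_vS fun i => M.vS_eq_zero.2 ?_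
    rcases M.sgn_eq i with h | h
    · filter_upwards [M.ae_plus h (R.ext_eq d), M.ae_plus h hd0] with p h1 h2
      rw [h1, h2]
    · exact M.ae_minus h hm
  rw [hd, map_sub, sub_eq_zero] at h0
  exact h0

theorem sum_vA_ext_le {Υ : ℝ} (hΥ : 0 < Υ) (hc : Υ ≤ P.contrast) (u : P.V) :
    ∑ j with M.sgn j = -1, M.vA j (R.ext u) (R.ext u) ≤ R₁ ^ 2 / Υ * ∑ j, M.vA j u u := by
  simp only [M.vA_self]
  exact M.sum_neg_le_contrast hΥ hc (integrable_grad_sq u) (fun p => sq_nonneg _)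
    (integrable_grad_sq _) (fun p => sq_nonneg _) (R.bound_one u)

/-- In the norm with the weight `μ`, the ratio of the diameters of the elements enters through `ρ`. -/
theorem sum_vS_ext_le {Υ ρ : ℝ} (hΥ : 0 < Υ) (hc : Υ ≤ P.contrast) (hρ : M.QuasiUniform ρ)
    (u : P.V) :
    ∑ j with M.sgn j = -1, M.vS j (R.ext u) (R.ext u) ≤ (ρ * R₀) ^ 2 / Υ * ∑ j, M.vS j u u := by
  set t := M.μmsh * M.size⁻¹ ^ 2 * P.κ with ht
  have ht0 : 0 ≤ t := by
    have h1 := M.μmsh_pos.le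
    have h2 := P.κ_pos.le
    positivity
  have hF : ∀ (i : Fin M.N) (w : P.V), 0 ≤ ∫ p in M.elem i, |P.σ p| * P.val w p ^ 2 := fun i w =>
    integral_nonneg fun p => mul_nonneg (abs_nonneg _) (sq_nonneg _)
  have h1 := M.sum_neg_le_contrast hΥ hc (integrable_val_sq u) (fun p => sq_nonneg _)
    (integrable_val_sq _) (fun p => sq_nonneg _) (R.bound_zero u)
  have h2 : ∀ i, t ≤ M.fac i * P.κ := fun i => by
    have := M.diam_pos i
    have := M.size_pos i
    have h1 := M.μmsh_pos.le
    have h2 := P.κ_pos.le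
    rw [ht, fac]
    gcongr
    exact M.diam_le_size i
  have h3 : ∀ i, M.fac i * P.κ ≤ ρ ^ 2 * t := fun i => by
    have d0 := M.diam_pos i
    have s0 := M.size_pos i
    have h1 := M.μmsh_pos.le
    have h2 := P.κ_pos.le
    have h4 : (Metric.diam (M.elem i))⁻¹ ≤ ρ * M.size⁻¹ := by
      rw [← div_eq_mul_inv, inv_eq_one_div, div_le_div_iff₀ d0 s0, one_mul]
      exact hρ i
    have h5 := pow_le_pow_left₀ (inv_nonneg.2 d0.le) h4 2
    calc M.fac i * P.κ ≤ M.μmsh * (ρ * M.size⁻¹) ^ 2 * P.κ := by rw [fac]; gcongr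
      _ = ρ ^ 2 * t := by rw [ht]; ring
  calc ∑ j with M.sgn j = -1, M.vS j (R.ext u) (R.ext u)
      ≤ ∑ j with M.sgn j = -1, ρ ^ 2 * t * ∫ p in M.elem j, |P.σ p| * P.val (R.ext u) p ^ 2 := by
        refine Finset.sum_le_sum fun j _ => ?_
        rw [M.vS_self]
        exact mul_le_mul_of_nonneg_right (h3 j) (hF j _)
    _ ≤ ρ ^ 2 * t * (R₀ ^ 2 / Υ * ∑ j, ∫ p in M.elem j, |P.σ p| * P.val u p ^ 2) := by
        rw [← Finset.mul_sum]
        exact mul_le_mul_of_nonneg_left h1 (by positivity)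
    _ = (ρ * R₀) ^ 2 / Υ * ∑ j, t * ∫ p in M.elem j, |P.σ p| * P.val u p ^ 2 := by
        rw [← Finset.mul_sum]; ring
    _ ≤ _ := by
        refine mul_le_mul_of_nonneg_left (Finset.sum_le_sum fun j _ => ?_) (by positivity)
        rw [M.vS_self]
        exact mul_le_mul_of_nonneg_right (h2 j) (hF j u)

end CoarseMesh
namespace CoarseMesh

variable {P : Problem} (M : CoarseMesh P)

/-! ### Cut-off functions -/

theorem nonempty_patch {Q : Patches M} {R₀ R₁ Cmsh : ℝ} {R : Reflection P R₀ R₁}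
    (hQ : Q.Admissible R Cmsh) (i : Fin M.N) {m : ℕ} (hm : 1 ≤ m) : i ∈ Q.patch i m := by
  induction m, hm using Nat.le_induction with
  | base => exact hQ.self_mem i
  | succ m hm ih => exact hQ.mono i m hm ih

set_option maxHeartbeats 1000000 in
/-- The product rule gives `|∇(χ u)|² ≤ 2 |∇u|² + 2 L² u²`, and `L²` is at most `9` times the weight of
`u²` in the full energy, so `19 = 2 * 9 + 1`. -/
theorem energy_cutoff_le {u w : P.V} {χ : E2 → ℝ} {L : ℝ} (hb : ∀ p, |χ p| ≤ 1)
    (hL : ∀ p, ‖gradient χ p‖ ≤ L) (h1 : P.val w =ᵐ[volume] fun p => χ p * P.val u p)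
    (h2 : P.grad w =ᵐ[volume] fun p => χ p • P.grad u p + P.val u p • gradient χ p)
    (j : Fin M.N) (hc : L ^ 2 ≤ 9 * (M.fac j * P.κ)) :
    M.vA j w w + M.vS j w w ≤ 19 * (M.vA j u u + M.vS j u u) := by
  have hi : ∀ {F : E2 → ℝ} (_ : Integrable F volume),
      IntegrableOn (fun p => |P.σ p| * F p) (M.elem j) := fun hF =>
    (integrableOn_σ_mul hF).mono_set (M.elem_subset j)
  have iu := hi (integrable_val_sq u)
  have iw := hi (integrable_val_sq w)
  have gu := hi (integrable_grad_sq u)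
  have gw := hi (integrable_grad_sq w)
  have a1 : ∫ p in M.elem j, |P.σ p| * ‖P.grad w p‖ ^ 2 ≤
      2 * (∫ p in M.elem j, |P.σ p| * ‖P.grad u p‖ ^ 2) +
        2 * L ^ 2 * ∫ p in M.elem j, |P.σ p| * P.val u p ^ 2 := by
    rw [← integral_const_mul, ← integral_const_mul,
      ← integral_add (gu.const_mul _) (iu.const_mul _)]
    refine integral_mono_ae gw ((gu.const_mul _).add (iu.const_mul _)) ?_
    filter_upwards [ae_restrict_of_ae h2] with p hp
    have b1 : ‖χ p • P.grad u p‖ ≤ ‖P.grad u p‖ := by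
      rw [norm_smul]; exact mul_le_of_le_one_left (norm_nonneg _) (hb p)
    have b2 : ‖P.val u p • gradient χ p‖ ≤ |P.val u p| * L := by
      rw [norm_smul]; exact mul_le_mul_of_nonneg_left (hL p) (abs_nonneg _)
    have b3 := (norm_add_le (χ p • P.grad u p) (P.val u p • gradient χ p)).trans (add_le_add b1 b2)
    have b4 : ‖P.grad w p‖ ^ 2 ≤ 2 * ‖P.grad u p‖ ^ 2 + 2 * L ^ 2 * P.val u p ^ 2 := by
      rw [hp]
      refine (pow_le_pow_left₀ (norm_nonneg _) b3 2).trans ?_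
      rw [← sq_abs (P.val u p)]
      nlinarith [sq_nonneg (‖P.grad u p‖ - |P.val u p| * L)]
    have b5 := mul_le_mul_of_nonneg_left b4 (abs_nonneg (P.σ p))
    exact b5.trans_eq (by ring)
  have a2 : ∫ p in M.elem j, |P.σ p| * P.val w p ^ 2 ≤ ∫ p in M.elem j, |P.σ p| * P.val u p ^ 2 := by
    refine integral_mono_ae iw iu ?_
    filter_upwards [ae_restrict_of_ae h1] with p hp
    refine mul_le_mul_of_nonneg_left ?_ (abs_nonneg _)
    rw [hp, sq_le_sq, abs_mul]
    exact mul_le_of_le_one_left (abs_nonneg _) (hb p)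
  have n1 : 0 ≤ ∫ p in M.elem j, |P.σ p| * P.val u p ^ 2 :=
    integral_nonneg fun p => mul_nonneg (abs_nonneg _) (sq_nonneg _)
  have n2 : 0 ≤ ∫ p in M.elem j, |P.σ p| * ‖P.grad u p‖ ^ 2 :=
    integral_nonneg fun p => mul_nonneg (abs_nonneg _) (sq_nonneg _)
  have n3 : 0 ≤ M.fac j * P.κ := mul_nonneg (M.fac_pos j).le P.κ_pos.le
  have key : ∀ {A A' S S' f : ℝ}, A' ≤ 2 * A + 2 * L ^ 2 * S → S' ≤ S → 0 ≤ S → 0 ≤ A → 0 ≤ f →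
      L ^ 2 ≤ 9 * f → A' + f * S' ≤ 19 * (A + f * S) := fun {A A' S S' f} h1 h2 h3 h4 h5 h6 => by
    have c1 := mul_le_mul_of_nonneg_right h6 h3
    have c2 := mul_le_mul_of_nonneg_left h2 h5
    linarith
  rw [M.vA_self j w, M.vA_self j u, M.vS_self j w, M.vS_self j u]
  exact key a1 a2 n1 n2 n3 hc

set_option maxHeartbeats 1000000 in
/-- The cut-off functions between two consecutive patches have gradients of the order
`(C_msh H)⁻¹`, which is bounded by the weight `μ` because of `κ μ_msh C_msh² ≥ 1`. -/
theorem exists_cutoff {Q : Patches M} {R₀ R₁ Cmsh : ℝ} {R : Reflection P R₀ R₁}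
    (hQ : Q.Admissible R Cmsh) (hCmsh : 0 < Cmsh) (hμ : 1 ≤ P.κ * M.μmsh * Cmsh ^ 2)
    (i : Fin M.N) {m : ℕ} (hm : 1 ≤ m) (u : P.V) :
    ∃ w : P.V, (∀ j ∈ Q.patch i m, M.vS j (u - w) (u - w) = 0) ∧
      (∀ j ∉ Q.patch i (m + 1), M.vS j w w = 0) ∧
      ∀ j, M.vA j w w + M.vS j w w ≤ 19 * (M.vA j u u + M.vS j u u) := by
  have hH := M.size_pos i
  have hδ : 0 < Cmsh * M.size := mul_pos hCmsh hH
  have hA : (⋃ j ∈ Q.patch i m, M.elem j).Nonempty := by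
    obtain ⟨x, hx⟩ := M.elem_nonempty i
    exact ⟨x, Set.mem_biUnion (M.nonempty_patch hQ i hm) hx⟩
  obtain ⟨χ, hχ, hχA, hχB, hχ1, hχg⟩ := exists_smooth_cutoff
    (B := ⋃ j ∈ {j | j ∉ Q.patch i (m + 1)}, M.elem j) hA hδ (by
      intro x hx y hy
      simp only [Set.mem_iUnion, exists_prop] at hx hy
      obtain ⟨j, hj, hx⟩ := hx
      obtain ⟨j', hj', hy⟩ := hy
      exact hQ.dist_le i m hm j hj j' hj' x hx y hy)
  have hb : ∀ p, |χ p| ≤ 1 := fun p => abs_le.2 ⟨by linarith [(hχ1 p).1], (hχ1 p).2⟩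
  obtain ⟨y, hy, hy1, hy2⟩ := exists_mul hχ hb hχg u.2
  have h1 : P.val (⟨y, hy⟩ : P.V) =ᵐ[volume] fun p => χ p * P.val u p := hy1
  refine ⟨⟨y, hy⟩, fun j hj => ?_, fun j hj => ?_, fun j => M.energy_cutoff_le hb hχg h1 hy2 j ?_⟩
  · rw [M.vS_eq_zero]
    filter_upwards [ae_restrict_of_ae h1, ae_restrict_of_ae (val_sub u ⟨y, hy⟩),
      ae_restrict_mem (M.isOpen_elem j).measurableSet] with p a1 a2 a3
    rw [a2, a1, hχA p (Set.mem_biUnion hj a3), one_mul, sub_self]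
  · rw [M.vS_eq_zero]
    filter_upwards [ae_restrict_of_ae h1,
      ae_restrict_mem (M.isOpen_elem j).measurableSet] with p a1 a3
    rw [a1, hχB p (Set.mem_biUnion (show j ∈ {j | j ∉ Q.patch i (m + 1)} from hj) a3), zero_mul]
  · have d0 := M.diam_pos j
    have h2 : (M.size)⁻¹ ^ 2 ≤ (Metric.diam (M.elem j))⁻¹ ^ 2 := by
      gcongr
      exact M.diam_le_size j
    have h3 : (Cmsh⁻¹) ^ 2 ≤ P.κ * M.μmsh := by
      rw [inv_pow, inv_le_iff_one_le_mul₀ (by positivity)]; exact hμ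
    calc (3 / (Cmsh * M.size)) ^ 2 = 9 * (Cmsh⁻¹ ^ 2 * M.size⁻¹ ^ 2) := by
          rw [div_eq_mul_inv, mul_inv]; ring
      _ ≤ 9 * (P.κ * M.μmsh * (Metric.diam (M.elem j))⁻¹ ^ 2) := by
          refine mul_le_mul_of_nonneg_left (mul_le_mul h3 h2 (by positivity) ?_) (by norm_num)
          exact mul_nonneg P.κ_pos.le M.μmsh_pos.le
      _ = 9 * (M.fac j * P.κ) := by rw [fac]; ring

end CoarseMesh

namespace AuxBasis

variable {P : Problem} {M : CoarseMesh P} {l : ℕ} (A : AuxBasis M l)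

/-! ### Local liftings -/

/-- The subspace of the energy space of the test functions in an element. -/
noncomputable def testV (i : Fin M.N) : Submodule ℝ P.V := (testSub (M.elem i)).comap P.V.subtype

theorem ae_zero_of_testV {i : Fin M.N} {w : P.V} (hw : w ∈ testV (M := M) i) :
    ∀ᵐ p, p ∉ M.elem i → P.val w p = 0 := by
  obtain ⟨φ, _, _, h3, h4, _⟩ := hw
  filter_upwards [h4] with p hp hpi
  refine Eq.trans hp ?_
  exact image_eq_zero_of_notMem_tsupport fun h => hpi (h3 h)

/-- A linear relation between the coefficients of all test functions in an element would be one
between the eigenvectors, by the fundamental lemma of the calculus of variations. -/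
theorem eq_zero_of_test {i : Fin M.N} {b : Fin l → ℝ}
    (h : ∀ w ∈ testV (M := M) i, ∑ k, b k * A.coef i k w = 0) : b = 0 := by
  set g : E2 → ℝ := A.auxFn (single i b) with hg
  have hgL := A.memLp_auxFn (single i b)
  have hsi : single i b i = b := by classical simp [single]
  have h1 : ∀ᵐ p, p ∈ M.elem i → M.fac i * |P.c p| * g p = 0 := by
    refine (M.isOpen_elem i).ae_eq_zero_of_integral_contDiff_smul_eq_zero ?_ fun φ h₁ h₂ h₃ => ?_
    · have h1 : MemLp g 2 (volume.restrict (M.elem i)) := hgL.restrict _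
      have : IsFiniteMeasure (volume.restrict (M.elem i)) :=
        ⟨by rw [Measure.restrict_apply_univ]; exact (M.isBounded_elem i).measure_lt_top⟩
      obtain ⟨C, hC⟩ := M.fac_c_bdd i
      have h2 : IntegrableOn (fun p => M.fac i * |P.c p| * g p) (M.elem i) :=
        Integrable.bdd_mul (c := C) (h1.integrable one_le_two) (M.aesm_fac_c i _) hC
      exact h2.locallyIntegrableOn
    · let w : P.V := ⟨testPair φ h₁ h₂, testPair_mem h₁ h₂ (h₃.trans (M.elem_subset i))⟩
      have hwφ : P.val w =ᵐ[volume] φ := testPair_fst h₁ h₂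
      have hw : w ∈ testV (M := M) i :=
        ⟨φ, h₁, h₂, h₃, testPair_fst h₁ h₂, testPair_snd h₁ h₂⟩
      have h2 := h w hw
      have h3 : ∑ k, b k * A.coef i k w = M.localS i (P.val w) g := by
        rw [M.localS_congr (M.restrV_fst i w).symm (A.auxFn_ae (single i b) i), ← M.formS_apply,
          form_sum_right]
        simp only [hsi, coef_eq]
      rw [h3, M.localS_eq] at h2
      rw [← setIntegral_eq_integral_of_forall_compl_eq_zero (s := M.elem i)
        (fun p hp => by
          rw [image_eq_zero_of_notMem_tsupport fun h => hp (h₃ h), zero_smul]), ← h2]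
      refine integral_congr_ae ?_
      filter_upwards [ae_restrict_of_ae hwφ] with p hp
      rw [hp, smul_eq_mul]; ring
  have h2 : ∀ᵐ p ∂volume.restrict (M.elem i), g p = 0 := by
    filter_upwards [ae_restrict_of_ae h1, M.ae_c_pos i,
      ae_restrict_mem (M.isOpen_elem i).measurableSet] with p a1 a2 a3
    exact (mul_eq_zero.1 (a1 a3)).resolve_left a2.ne'
  have h3 := (M.localS_self_eq_zero (hgL.restrict _)).2 h2
  rw [A.localS_auxFn, hsi] at h3
  funext k
  have h4 := (Finset.sum_eq_zero_iff_of_nonneg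
    (fun k _ => mul_self_nonneg (b k))).1 h3 k (Finset.mem_univ k)
  exact mul_self_eq_zero.1 h4

/-- The coefficients of the test functions in an element take all values, by duality. -/
theorem exists_test_lift (i : Fin M.N) (b : Fin l → ℝ) :
    ∃ w ∈ testV (M := M) i, ∀ k, A.coef i k w = b k := by
  classical
  let L : P.V →ₗ[ℝ] (Fin l → ℝ) := LinearMap.pi fun k => A.coef i k
  have hL : (testV (M := M) i).map L = ⊤ := by
    by_contra hne
    obtain ⟨f, hf0, hf⟩ := Submodule.exists_le_ker_of_lt_top _ (lt_top_iff_ne_top.2 hne)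
    refine hf0 ?_
    have h1 : (fun k => f (Pi.single k 1)) = 0 := by
      refine A.eq_zero_of_test (i := i) fun w hw => ?_
      have h2 : f (L w) = 0 := hf (Submodule.mem_map_of_mem hw)
      rw [LinearMap.pi_apply_eq_sum_univ f (L w)] at h2
      rw [← h2]
      refine Finset.sum_congr rfl fun k _ => ?_
      rw [smul_eq_mul, mul_comm]
      congr 2
      funext j
      simp [Pi.single_apply, eq_comm]
    refine LinearMap.ext fun x => ?_
    rw [LinearMap.pi_apply_eq_sum_univ f x]
    refine Finset.sum_eq_zero fun k _ => ?_
    have h3 := congrFun h1 k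
    have e : (fun j => if k = j then (1 : ℝ) else 0) = Pi.single k 1 := by
      funext j; simp [Pi.single_apply, eq_comm]
    rw [e]
    simp only [Pi.zero_apply] at h3
    rw [h3, smul_zero]
  have : b ∈ (testV (M := M) i).map L := by rw [hL]; trivial
  obtain ⟨w, hw, hwb⟩ := this
  exact ⟨w, hw, fun k => congrFun hwb k⟩

theorem coef_of_vanish {j : Fin M.N} {w : P.V} (h : M.vS j w w = 0) (k : Fin l) :
    A.coef j k w = 0 := by
  rw [coef_apply]
  refine integral_eq_zero_of_ae ?_
  filter_upwards [M.vS_eq_zero.1 h] with p hp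
  simp [hp]

end AuxBasis
/-! ### Bounds of the local liftings -/

section Forms

variable {X ι κ : Type*} [AddCommGroup X] [Module ℝ X] [Fintype ι] [Fintype κ]

/-- A linear combination is bounded by its coefficients, with a constant that depends only on the
family. -/
theorem sum_form_comb_le {f : ι → LinearMap.BilinForm ℝ X} (hs : ∀ j u w, f j u w = f j w u)
    (hf : ∀ j u, 0 ≤ f j u u) (b : κ → ℝ) (W : κ → X) :
    ∑ j, f j (∑ k, b k • W k) (∑ k, b k • W k) ≤
      (∑ k, √(∑ j, f j (W k) (W k))) ^ 2 * ∑ k, b k ^ 2 := by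
  classical
  set B : LinearMap.BilinForm ℝ X := ∑ j, f j with hB
  have hBa : ∀ u w, B u w = ∑ j, f j u w := fun u w => by simp [hB, LinearMap.sum_apply]
  have hs : ∀ u w, B u w = B w u := fun u w => by
    rw [hBa, hBa]; exact Finset.sum_congr rfl fun j _ => hs j u w
  have hn : ∀ u, 0 ≤ B u u := fun u => by
    rw [hBa]; exact Finset.sum_nonneg fun j _ => hf j u
  simp only [← hBa]
  have h2 : ∀ s : Finset κ, √(B (∑ k ∈ s, b k • W k) (∑ k ∈ s, b k • W k)) ≤
      ∑ k ∈ s, |b k| * √(B (W k) (W k)) := by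
    intro s
    induction s using Finset.induction_on with
    | empty => simp
    | insert k s hk ih =>
      rw [Finset.sum_insert hk, Finset.sum_insert hk]
      refine (sqrt_form_add_le hs hn _ _).trans (add_le_add (le_of_eq ?_) ih)
      rw [map_smul, map_smul, LinearMap.smul_apply, smul_eq_mul, smul_eq_mul, ← mul_assoc,
        Real.sqrt_mul (mul_self_nonneg _), Real.sqrt_mul_self_eq_abs]
  have h3 : ∀ k, |b k| ≤ √(∑ k, b k ^ 2) := fun k => by
    refine Real.abs_le_sqrt ?_
    exact Finset.single_le_sum (f := fun k => b k ^ 2) (fun k _ => sq_nonneg _)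
      (Finset.mem_univ k)
  have h4 : ∑ k, |b k| * √(B (W k) (W k)) ≤ (∑ k, √(B (W k) (W k))) * √(∑ k, b k ^ 2) := by
    rw [mul_comm, Finset.mul_sum]
    exact Finset.sum_le_sum fun k _ => mul_le_mul_of_nonneg_right (h3 k) (Real.sqrt_nonneg _)
  have h5 := pow_le_pow_left₀ (Real.sqrt_nonneg _) ((h2 Finset.univ).trans h4) 2
  rwa [Real.sq_sqrt (hn _), mul_pow,
    Real.sq_sqrt (Finset.sum_nonneg fun k _ => sq_nonneg (b k))] at h5

theorem form_sum_of_null {f : LinearMap.BilinForm ℝ X} (hs : ∀ u w, f u w = f w u)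
    (hf : ∀ u, 0 ≤ f u u) {W : ι → X} {j : ι} (h : ∀ i, i ≠ j → f (W i) (W i) = 0) :
    f (∑ i, W i) (∑ i, W i) = f (W j) (W j) := by
  classical
  have h2 : ∀ i, i ≠ j → ∀ u, f (W i) u = 0 := fun i hij u => form_apply_eq_zero hs hf (h i hij) u
  have h3 : ∀ u, f (∑ i, W i) u = f (W j) u := fun u => by
    rw [map_sum, LinearMap.sum_apply, Finset.sum_eq_single j (fun i _ hij => h2 i hij u) (by simp)]
  rw [h3, hs, h3]

end Forms

namespace AuxBasis

variable {P : Problem} {M : CoarseMesh P} {l : ℕ} (A : AuxBasis M l)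

theorem vS_zero_of_testV {i j : Fin M.N} (hij : j ≠ i) {w : P.V}
    (hw : ∀ᵐ p ∂volume.restrict (P.Ω \ M.elem i), P.val w p = 0) : M.vS j w w = 0 := by
  rw [M.vS_eq_zero]
  have h : M.elem j ⊆ P.Ω \ M.elem i := fun p hp =>
    ⟨M.elem_subset j hp, fun h => Set.disjoint_left.1 (M.elem_disjoint hij) hp h⟩
  exact ae_restrict_of_ae_restrict_of_subset h hw

/-- The numbers that are admissible in the definition of `inverseConst`. -/
def IsInverseConst (C : ℝ) : Prop := ∀ (i : Fin M.N) (b : Fin l → ℝ), ∃ w : P.V,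
    (∀ᵐ p ∂volume.restrict (P.Ω \ M.elem i), P.val w p = 0) ∧
    (∀ j k, A.coef j k w = single i b j k) ∧
    ∑ j, M.vA j w w ≤ C ^ 2 * ∑ k, b k ^ 2

theorem normS_single (i : Fin M.N) (b : Fin l → ℝ) :
    M.normS (fun p => ∑ j, b j * A.fn i j p) = √(∑ k, b k ^ 2) := by
  rw [← A.auxFn_single, A.normS_auxFn, sum_single i b (fun _ b => ∑ k, b k ^ 2) (by simp)]

theorem isInverseConst_iff {C : ℝ} (hC : 0 ≤ C) : A.IsInverseConst C ↔
    ∀ (i : Fin M.N) (b : Fin l → ℝ), ∃ w : P.V,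
    (∀ᵐ p ∂volume.restrict (P.Ω \ M.elem i), P.val w p = 0) ∧
    A.proj (P.val w) =ᵐ[volume.restrict P.Ω] (fun p => ∑ j, b j * A.fn i j p) ∧
    P.normA w ≤ C * M.normS (fun p => ∑ j, b j * A.fn i j p) := by
  refine forall_congr' fun i => forall_congr' fun b => exists_congr fun w =>
    and_congr_right fun _ => and_congr ?_ ?_
  · rw [← A.auxFn_single, A.proj_eq, A.auxFn_ae_eq_iff]
    exact ⟨fun h => funext fun j => funext fun k => h j k, fun h j k => by rw [← h]⟩
  · have h0 : 0 ≤ ∑ j, M.vA j w w := Finset.sum_nonneg fun j _ => M.vA_nonneg j w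
    have h1 : 0 ≤ ∑ k, b k ^ 2 := Finset.sum_nonneg fun k _ => sq_nonneg _
    rw [A.normS_single, M.normA_eq, Real.sqrt_le_left (by positivity), mul_pow, Real.sq_sqrt h1]

/-- Liftings of the unit vectors by test functions give a finite constant, so the infimum in
`inverseConst` is over a nonempty set. -/
theorem exists_isInverseConst : ∃ C : ℝ, 0 ≤ C ∧ A.IsInverseConst C := by
  classical
  have h1 : ∀ (i : Fin M.N) (k : Fin l), ∃ w ∈ testV (M := M) i,
      ∀ k', A.coef i k' w = (Pi.single k 1 : Fin l → ℝ) k' :=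
    fun i k => A.exists_test_lift i (Pi.single k 1)
  choose W hW hWc using h1
  set D : ℝ := ∑ i, ∑ k, √(∑ j, M.vA j (W i k) (W i k)) with hD
  have hD0 : 0 ≤ D := Finset.sum_nonneg fun i _ => Finset.sum_nonneg fun k _ => Real.sqrt_nonneg _
  have hz : ∀ (i : Fin M.N) {w : P.V}, w ∈ testV (M := M) i →
      ∀ᵐ p ∂volume.restrict (P.Ω \ M.elem i), P.val w p = 0 := fun i w hw => by
    filter_upwards [ae_restrict_of_ae (ae_zero_of_testV hw), ae_restrict_mem
      (P.isOpen_Ω.measurableSet.diff (M.isOpen_elem i).measurableSet)] with p h1 h2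
    exact h1 h2.2
  refine ⟨D, hD0, fun i b => ⟨∑ k, b k • W i k, ?_, ?_, ?_⟩⟩
  · exact hz i (Submodule.sum_mem _ fun k _ => Submodule.smul_mem _ _ (hW i k))
  · intro j k
    by_cases hij : j = i
    · subst hij
      rw [map_sum, show single j b j k = b k by simp [single]]
      simp [hWc, Pi.single_apply]
    · have : single i b j k = 0 := by simp [single, Pi.single_eq_of_ne hij]
      rw [this]
      refine A.coef_of_vanish (vS_zero_of_testV hij (hz i ?_)) k
      exact Submodule.sum_mem _ fun k _ => Submodule.smul_mem _ _ (hW i k)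
  · refine (sum_form_comb_le M.vA_symm M.vA_nonneg b (W i)).trans
      (mul_le_mul_of_nonneg_right ?_ (Finset.sum_nonneg fun k _ => sq_nonneg _))
    refine pow_le_pow_left₀ (Finset.sum_nonneg fun k _ => Real.sqrt_nonneg _) ?_ 2
    exact Finset.single_le_sum (f := fun i => ∑ k, √(∑ j, M.vA j (W i k) (W i k)))
      (fun i _ => Finset.sum_nonneg fun k _ => Real.sqrt_nonneg _) (Finset.mem_univ i)

/-- The infimum need not be attained, but every larger number is admissible. -/
theorem isInverseConst_of_lt {C : ℝ} (hC : A.inverseConst < C) :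
    A.IsInverseConst C := by
  obtain ⟨D, hD0, hD⟩ := A.exists_isInverseConst
  have hne : {C : ℝ | 0 ≤ C ∧ ∀ (i : Fin M.N) (b : Fin l → ℝ), ∃ w : P.V,
    (∀ᵐ p ∂volume.restrict (P.Ω \ M.elem i), P.val w p = 0) ∧
    A.proj (P.val w) =ᵐ[volume.restrict P.Ω] (fun p => ∑ j, b j * A.fn i j p) ∧
    P.normA w ≤ C * M.normS (fun p => ∑ j, b j * A.fn i j p)}.Nonempty :=
    ⟨D, hD0, (A.isInverseConst_iff hD0).1 hD⟩
  obtain ⟨C', ⟨h0, h1⟩, h2⟩ := exists_lt_of_csInf_lt hne hC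
  intro i b
  obtain ⟨w, hw1, hw2, hw3⟩ := (A.isInverseConst_iff h0).2 h1 i b
  refine ⟨w, hw1, hw2, hw3.trans (mul_le_mul_of_nonneg_right ?_
    (Finset.sum_nonneg fun k _ => sq_nonneg _))⟩
  exact pow_le_pow_left₀ h0 h2.le 2

/-- The local liftings have disjoint supports, so the square of the norm of their sum is the sum of
the squares of their norms. -/
theorem exists_lift {C : ℝ} (hC : A.IsInverseConst C) (c : Fin M.N → Fin l → ℝ) :
    ∃ w : P.V, (∀ j k, A.coef j k w = c j k) ∧
      ∑ j, M.vA j w w ≤ C ^ 2 * ∑ j, ∑ k, c j k ^ 2 := by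
  classical
  choose W hW1 hW2 hW3 using fun i => hC i (c i)
  have hz : ∀ i j, j ≠ i → M.vS j (W i) (W i) = 0 := fun i j hij => vS_zero_of_testV hij (hW1 i)
  refine ⟨∑ i, W i, fun j k => ?_, ?_⟩
  · rw [map_sum, Finset.sum_congr rfl fun i _ => hW2 i j k, Finset.sum_eq_single j]
    · simp [single]
    · intro i _ hij
      simp [single, Pi.single_eq_of_ne hij.symm]
    · simp
  · have h1 : ∀ j, M.vA j (∑ i, W i) (∑ i, W i) = M.vA j (W j) (W j) := fun j =>
      form_sum_of_null (M.vA_symm j) (M.vA_nonneg j) fun i hij => M.vA_eq_zero (hz i j hij.symm)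
    rw [Finset.sum_congr rfl fun j _ => h1 j, Finset.mul_sum]
    refine Finset.sum_le_sum fun j _ => le_trans ?_ (hW3 j)
    exact Finset.single_le_sum (f := fun i => M.vA i (W j) (W j))
      (fun i _ => M.vA_nonneg i _) (Finset.mem_univ j)

end AuxBasis
namespace LocalizedSystem

variable {V ι κ : Type*} [NormedAddCommGroup V] [InnerProductSpace ℝ V]
  [Fintype ι] [Fintype κ] [DecidableEq ι] {q τ Λ Cl Col : ℝ} (S : LocalizedSystem V ι κ q τ Λ Cl Col)

/-! ### Basis functions, inf-sup constants as infima, and the Poincaré constant -/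

theorem existsUnique_basis [CompleteSpace V] (hq0 : 0 ≤ q) (hq : q < 1) (hτ0 : 0 ≤ τ)
    (hτ : τ ≤ (1 - q) / 16) (X : Submodule ℝ V) (hX : IsClosed (X : Set V))
    (hT : ∀ u ∈ X, S.T u ∈ X) (i : ι) (k : κ) :
    ∃! φ : V, φ ∈ X ∧ ∀ w ∈ X, S.bp φ w = S.sgn i * S.coef i k w := by
  refine S.existsUnique_solution hq0 hq hτ0 hτ X hX hT (S.sgn i • S.coef i k) ⟨1, fun w => ?_⟩
  rw [LinearMap.smul_apply, smul_eq_mul, abs_mul, sgn_abs, one_mul, one_mul]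
  refine abs_le_of_sq_le_sq ?_ (S.nE_nonneg w)
  refine le_trans ?_ (S.sum_coef_sq_le i w)
  exact Finset.single_le_sum (f := fun k => S.coef i k w ^ 2) (fun k _ => sq_nonneg _)
    (Finset.mem_univ k)

/-- The inf-sup constant as an infimum of suprema of quotients. -/
noncomputable def infSup (X : Set V) : EReal :=
  ⨅ u : {u : V // u ∈ X ∧ u ≠ 0}, ⨆ w : {w : V // w ∈ X ∧ w ≠ 0},
    ((S.b u.1 w.1 / (S.nA u.1 * S.nA w.1) : ℝ) : EReal)

variable {S}

theorem infSup_of_le {X : Set V} {β : ℝ} (hβ : (β : EReal) ≤ S.infSup X) : S.InfSup X β := by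
  intro u hu t ht hw
  by_cases hu0 : u = 0
  · rw [hu0, nA_zero, mul_zero]; exact ht
  have hnu := S.nA_pos hu0
  have h1 := hβ.trans (iInf_le _ (⟨u, hu, hu0⟩ : {u : V // u ∈ X ∧ u ≠ 0}))
  have h2 : (β : EReal) ≤ ((t / S.nA u : ℝ) : EReal) := by
    refine h1.trans (iSup_le fun w => EReal.coe_le_coe_iff.2 ?_)
    have hnw := S.nA_pos w.2.2
    rw [div_le_div_iff₀ (mul_pos hnu hnw) hnu]
    have := mul_le_mul_of_nonneg_right (hw w.1 w.2.1) hnu.le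
    linarith
  exact (le_div_iff₀ hnu).1 (EReal.coe_le_coe_iff.1 h2)

theorem le_infSup {X : Set V} {β : ℝ} (hβ0 : 0 < β) (hβ : S.InfSup X β) :
    (β : EReal) ≤ S.infSup X := by
  refine le_iInf fun u => ?_
  by_contra! hlt
  obtain ⟨r, hr1, hr2⟩ := EReal.lt_iff_exists_real_btwn.1 hlt
  have hnu := S.nA_pos u.2.2
  have h1 := hβ u.1 u.2.1 (max r 0 * S.nA u.1) (by positivity) fun w hw => by
    by_cases hw0 : w = 0
    · rw [hw0, map_zero, nA_zero, mul_zero]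
    have hnw := S.nA_pos hw0
    have h2 := (le_iSup (fun w : {w : V // w ∈ X ∧ w ≠ 0} =>
      ((S.b u.1 w.1 / (S.nA u.1 * S.nA w.1) : ℝ) : EReal)) ⟨w, hw, hw0⟩).trans hr1.le
    have h3 := EReal.coe_le_coe_iff.1 h2
    rw [div_le_iff₀ (mul_pos hnu hnw)] at h3
    refine h3.trans ?_
    rw [mul_assoc]
    exact mul_le_mul_of_nonneg_right (le_max_left r 0) (mul_pos hnu hnw).le
  have h2 : β ≤ max r 0 := le_of_mul_le_mul_right h1 hnu
  have h3 : r < β := EReal.coe_lt_coe_iff.1 hr2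
  rcases le_max_iff.1 h2 with h2 | h2 <;> linarith

variable (S)

/-- The best constant in the Poincaré inequality is attained. -/
theorem sqrt_sTot_le {H : ℝ} (hH : 0 < H) (u : V) :
    √(S.sTot u u) ≤ sInf {C : ℝ | 0 ≤ C ∧ ∀ v, √(S.sTot v v) ≤ C * H⁻¹ * S.nA v} * H⁻¹ * S.nA u := by
  obtain ⟨C₁, hC₁, h₁⟩ := S.exists_nE_le
  obtain ⟨C₂, hC₂, h₂⟩ := S.exists_norm_le
  have hS : ∀ v, √(S.sTot v v) ≤ S.nE v := fun v => by
    refine Real.sqrt_le_sqrt ?_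
    rw [S.eTot_eq]
    exact le_add_of_nonneg_left (S.aTot_nonneg v)
  have hne : {C : ℝ | 0 ≤ C ∧ ∀ v, √(S.sTot v v) ≤ C * H⁻¹ * S.nA v}.Nonempty := by
    refine ⟨C₁ * C₂ * H, by positivity, fun v => ?_⟩
    rw [mul_inv_cancel_right₀ hH.ne', mul_assoc]
    exact ((hS v).trans (h₁ v)).trans (mul_le_mul_of_nonneg_left (h₂ v) hC₁.le)
  by_cases hu : u = 0
  · rw [hu, nA_zero]; simp
  · have hn := S.nA_pos hu
    have h3 : √(S.sTot u u) * H / S.nA u ≤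
        sInf {C : ℝ | 0 ≤ C ∧ ∀ v, √(S.sTot v v) ≤ C * H⁻¹ * S.nA v} := by
      refine le_csInf hne fun C hC => ?_
      rw [div_le_iff₀ hn]
      refine (mul_le_mul_of_nonneg_right (hC.2 u) hH.le).trans_eq ?_
      field_simp
    rw [div_le_iff₀ hn] at h3
    rw [mul_right_comm, ← div_eq_mul_inv, le_div_iff₀ hH]
    exact h3

theorem nE_le_of_sTot_le {y : ℝ} (hy : 0 ≤ y) {u : V} (h : √(S.sTot u u) ≤ y * S.nA u) :
    S.nE u ≤ (1 + y) * S.nA u := by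
  refine Real.sqrt_le_iff.2 ⟨mul_nonneg (by linarith) (S.nA_nonneg u), ?_⟩
  have h1 := pow_le_pow_left₀ (Real.sqrt_nonneg _) h 2
  rw [mul_pow, S.nA_sq, Real.sq_sqrt (S.sTot_nonneg u)] at h1
  rw [mul_pow, S.nA_sq, S.eTot_eq]
  have h2 := mul_nonneg hy (S.aTot_nonneg u)
  linarith

end LocalizedSystem

theorem completeSpace_V {P : Problem} : CompleteSpace P.V :=
  (Submodule.isClosed_topologicalClosure _).completeSpace_coe

/-- The span of the elements that are characterized by a unique solvability property is the range of
the combinations of the solutions. -/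
theorem span_eq_range_comb {V ι κ : Type*} [NormedAddCommGroup V] [InnerProductSpace ℝ V]
    [Fintype ι] [Fintype κ] {p : ι → κ → V → Prop} {φ : ι → κ → V}
    (h : ∀ i k v, p i k v ↔ v = φ i k) :
    Submodule.span ℝ {v | ∃ i k, p i k v} = LinearMap.range (LocalizedSystem.comb φ) := by
  classical
  refine le_antisymm (Submodule.span_le.2 ?_) ?_
  · rintro v ⟨i, k, hv⟩
    refine ⟨Pi.single i (Pi.single k 1), ?_⟩
    rw [(h i k v).1 hv, LocalizedSystem.comb_apply, Finset.sum_eq_single i,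
      Finset.sum_eq_single k]
    · simp
    · intro k' _ hk
      simp [Pi.single_eq_of_ne hk]
    · simp
    · intro i' _ hi
      simp [Pi.single_eq_of_ne hi]
    · simp
  · rintro _ ⟨c, rfl⟩
    exact Submodule.sum_mem _ fun i _ => Submodule.sum_mem _ fun k _ =>
      Submodule.smul_mem _ _ (Submodule.subset_span ⟨i, k, (h i k _).2 rfl⟩)

/-! ### The problem on the mesh as a localized system -/

/-- The quantitative assumptions under which the problem on the mesh is a `LocalizedSystem`. -/
structure Setting {P : Problem} {M : CoarseMesh P} {l : ℕ} (A : AuxBasis M l) {R₀ R₁ : ℝ}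
    (R : Reflection P R₀ R₁) (Q : Patches M) (q τ Cl Col : ℝ) : Prop where
  ratio_le : ∀ i, M.ratio i ≤ q
  one_le_gap : 1 ≤ M.gap l
  contrast_pos : 0 < P.contrast
  bound_one : R₁ ^ 2 / P.contrast ≤ τ ^ 2
  bound_zero : ∃ ρ, M.QuasiUniform ρ ∧ (ρ * R₀) ^ 2 / P.contrast ≤ τ ^ 2
  admissible : ∃ Cmsh, 0 < Cmsh ∧ 1 ≤ P.κ * M.μmsh * Cmsh ^ 2 ∧ Q.Admissible R Cmsh
  overlap : Q.Overlap Col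
  isInverseConst : A.IsInverseConst Cl

namespace Setting

variable {P : Problem} {M : CoarseMesh P} {l : ℕ} {A : AuxBasis M l} {R₀ R₁ : ℝ}
  {R : Reflection P R₀ R₁} {Q : Patches M} {q τ Cl Col : ℝ} (h : Setting A R Q q τ Cl Col)

theorem coef_sq_le (A : AuxBasis M l) (j : Fin M.N) (u : P.V) :
    ∑ k, A.coef j k u ^ 2 ≤ M.vS j u u := (A.bessel_and_gap j (M.restrV_mem j u)).1

theorem gap_mul_le (A : AuxBasis M l) (j : Fin M.N) (u : P.V) :
    M.gap l * (M.vS j u u - ∑ k, A.coef j k u ^ 2) ≤ M.vA j u u := by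
  have h1 := A.bessel_and_gap j (M.restrV_mem j u)
  exact (mul_le_mul_of_nonneg_right (M.gap_le_eigenvalue l j) (sub_nonneg.2 h1.1)).trans h1.2

include h

theorem sum_vA_ext_le (u : P.V) :
    ∑ j with M.sgn j = -1, M.vA j (R.ext u) (R.ext u) ≤ τ ^ 2 * ∑ j, M.vA j u u :=
  (M.sum_vA_ext_le R h.contrast_pos le_rfl u).trans
    (mul_le_mul_of_nonneg_right h.bound_one (Finset.sum_nonneg fun j _ => M.vA_nonneg j u))

theorem sum_vS_ext_le (u : P.V) :
    ∑ j with M.sgn j = -1, M.vS j (R.ext u) (R.ext u) ≤ τ ^ 2 * ∑ j, M.vS j u u := by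
  obtain ⟨ρ, hρ, hρ'⟩ := h.bound_zero
  exact (M.sum_vS_ext_le R h.contrast_pos le_rfl hρ u).trans
    (mul_le_mul_of_nonneg_right hρ' (Finset.sum_nonneg fun j _ => M.vS_nonneg j u))

theorem T_inside (i : Fin M.N) (m : ℕ) (hm : 1 ≤ m) (u : P.V)
    (hu : ∀ j ∉ Q.patch i m, M.vS j u u = 0) : ∀ j ∉ Q.patch i m, M.vS j (R.T u) (R.T u) = 0 := by
  obtain ⟨_, _, _, hQ⟩ := h.admissible
  exact M.vanishesOn_iff.1 (hQ.T_inside i m hm u (M.vanishesOn_iff.2 hu))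

theorem T_outside (i : Fin M.N) (m : ℕ) (hm : 1 ≤ m) (u : P.V)
    (hu : ∀ j ∈ Q.patch i m, M.vS j u u = 0) : ∀ j ∈ Q.patch i m, M.vS j (R.T u) (R.T u) = 0 := by
  obtain ⟨_, _, _, hQ⟩ := h.admissible
  exact M.vanishesOn_iff.1 (hQ.T_outside i m hm u (M.vanishesOn_iff.2 hu))

theorem exists_cutoff (i : Fin M.N) (m : ℕ) (hm : 1 ≤ m) (u : P.V) :
    ∃ w : P.V, (∀ j ∈ Q.patch i m, M.vS j (u - w) (u - w) = 0) ∧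
      (∀ j ∉ Q.patch i (m + 1), M.vS j w w = 0) ∧
      ∀ j, M.vA j w w + M.vS j w w ≤ 19 * (M.vA j u u + M.vS j u u) :=
  h.admissible.elim fun _ hC => M.exists_cutoff hC.2.2 hC.1 hC.2.1 i hm u

theorem self_mem_patch (i : Fin M.N) : i ∈ Q.patch i 1 := by
  obtain ⟨_, _, _, hQ⟩ := h.admissible
  exact hQ.self_mem i

theorem patch_mono (i : Fin M.N) (m : ℕ) (hm : 1 ≤ m) : Q.patch i m ⊆ Q.patch i (m + 1) := by
  obtain ⟨_, _, _, hQ⟩ := h.admissible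
  exact hQ.mono i m hm

/-- The problem on the mesh as an abstract localized system. -/
noncomputable def system : LocalizedSystem P.V (Fin M.N) (Fin l) q τ (M.gap l) Cl Col where
  a := M.vA
  s := M.vS
  coef := A.coef
  sgn := M.sgn
  ω := M.ratio
  R := R.ext
  patch := Q.patch
  a_symm := M.vA_symm
  s_symm := M.vS_symm
  a_nonneg := M.vA_nonneg
  s_nonneg := M.vS_nonneg
  a_eq_zero _ _ := M.vA_eq_zero
  sgn_eq := M.sgn_eq
  ω_nonneg := M.ratio_nonneg
  ω_le := h.ratio_le
  one_le_gap := h.one_le_gap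
  coef_le := coef_sq_le A
  gap_le := gap_mul_le A
  R_idem := M.ext_ext R
  R_plus _ u hj := M.vS_ext_sub R hj u
  R_a := h.sum_vA_ext_le
  R_s := h.sum_vS_ext_le
  lift := A.exists_lift h.isInverseConst
  lower := M.vA_vS_lower
  upper := M.vA_vS_upper
  self_mem := h.self_mem_patch
  mono := h.patch_mono
  overlap := h.overlap
  T_inside := h.T_inside
  T_outside := h.T_outside
  cutoff := h.exists_cutoff

theorem b_eq (u w : P.V) : h.system.b u w = P.form u w := by
  rw [h.system.b_apply, M.form_eq]
  exact Finset.sum_congr rfl fun j _ => h.system.bAt_apply j u w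

theorem nA_eq (u : P.V) : h.system.nA u = P.normA u := by
  rw [M.normA_eq, LocalizedSystem.nA, h.system.aTot_apply]; rfl

theorem bp_eq (u w : P.V) : h.system.bp u w =
    P.form u w + M.sForm (A.proj (P.val u)) (A.proj (P.val w)) := by
  refine (h.system.bp_eq u w).trans (congrArg₂ (· + ·) (h.b_eq u w) ?_)
  refine Eq.trans ?_ (A.sForm_proj u w).symm
  exact Finset.sum_congr rfl fun j _ => congrArg _ (h.system.p_apply j u w)

theorem kernel_eq : A.kernel = (h.system.ker : Set P.V) := Set.ext fun _ => A.mem_kernel_iff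

theorem solves_iff {X : Set P.V} {i : Fin M.N} {j : Fin l} {φ : P.V} : A.Solves X i j φ ↔
    ∀ w ∈ X, h.system.bp φ w = h.system.sgn i * h.system.coef i j w := by
  refine forall₂_congr fun w _ => ?_
  rw [h.bp_eq, A.sForm_fn_proj]; rfl

theorem localSpace_eq (i : Fin M.N) (m : ℕ) :
    Q.localSpace i m = (h.system.localSub i m : Set P.V) := Set.ext fun _ => M.vanishesOn_iff

theorem existsUnique_basis (hq0 : 0 ≤ q) (hq : q < 1) (hτ0 : 0 ≤ τ) (hτ : τ ≤ (1 - q) / 16)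
    (X : Submodule ℝ P.V) (hX : IsClosed (X : Set P.V)) (hT : ∀ u ∈ X, h.system.T u ∈ X)
    (i : Fin M.N) (j : Fin l) : ∃! φ : P.V, φ ∈ X ∧ A.Solves X i j φ := by
  have := completeSpace_V (P := P)
  refine (existsUnique_congr fun φ => ?_).1
    (h.system.existsUnique_basis hq0 hq hτ0 hτ X hX hT i j)
  exact and_congr_right fun _ => h.solves_iff.symm

theorem existsUnique_global (hq0 : 0 ≤ q) (hq : q < 1) (hτ0 : 0 ≤ τ) (hτ : τ ≤ (1 - q) / 16)
    (i : Fin M.N) (j : Fin l) : ∃! φ : P.V, A.IsGlobalBasis i j φ := by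
  refine (existsUnique_congr fun φ => ?_).1 (h.existsUnique_basis hq0 hq hτ0 hτ ⊤ isClosed_univ
    (fun _ _ => trivial) i j)
  exact ⟨fun h => h.2, fun h => ⟨trivial, h⟩⟩

theorem existsUnique_local (hq0 : 0 ≤ q) (hq : q < 1) (hτ0 : 0 ≤ τ) (hτ : τ ≤ (1 - q) / 16)
    {m : ℕ} (hm : 1 ≤ m) (i : Fin M.N) (j : Fin l) : ∃! φ : P.V, Q.IsLocalBasis A m i j φ := by
  refine (existsUnique_congr fun φ => ?_).1 (h.existsUnique_basis hq0 hq hτ0 hτ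
    (h.system.localSub i m) (h.system.isClosed_localSub i m)
    (fun _ hu => h.system.T_mem_localSub hm hu) i j)
  change _ ↔ φ ∈ Q.localSpace i m ∧ A.Solves (Q.localSpace i m) i j φ
  rw [h.localSpace_eq]; rfl

theorem exists_global (hq0 : 0 ≤ q) (hq : q < 1) (hτ0 : 0 ≤ τ) (hτ : τ ≤ (1 - q) / 16) :
    ∃ φ : Fin M.N → Fin l → P.V, h.system.IsGlo φ ∧
      A.Vglo = LinearMap.range (LocalizedSystem.comb φ) := by
  choose φ hφ hu using fun i j => h.existsUnique_global hq0 hq hτ0 hτ i j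
  refine ⟨φ, fun i k w => h.solves_iff.1 (hφ i k) w trivial, span_eq_range_comb fun i k v => ?_⟩
  exact ⟨fun hv => hu i k v hv, fun hv => hv ▸ hφ i k⟩

theorem exists_local (hq0 : 0 ≤ q) (hq : q < 1) (hτ0 : 0 ≤ τ) (hτ : τ ≤ (1 - q) / 16)
    {m : ℕ} (hm : 1 ≤ m) :
    ∃ φ : Fin M.N → Fin l → P.V, h.system.IsLoc m φ ∧
      Q.Vms A m = LinearMap.range (LocalizedSystem.comb φ) := by
  choose φ hφ hu using fun i j => h.existsUnique_local hq0 hq hτ0 hτ hm i j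
  refine ⟨φ, fun i k => ?_, span_eq_range_comb fun i k v => ?_⟩
  · have h1 := hφ i k
    change φ i k ∈ Q.localSpace i m ∧ A.Solves (Q.localSpace i m) i k (φ i k) at h1
    rw [h.localSpace_eq] at h1
    exact ⟨h1.1, fun w hw => h.solves_iff.1 h1.2 w hw⟩
  · exact ⟨fun hv => hu i k v hv, fun hv => hv ▸ hφ i k⟩

theorem infSup_eq (X : Set P.V) : P.infSup X = h.system.infSup X := by
  simp only [Problem.infSup, LocalizedSystem.infSup, h.b_eq, h.nA_eq]

/-- There is an element, since the minimum over an empty mesh would be `0`, against `Λ ≥ 1`. -/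
theorem size_pos : 0 < M.size := by
  rcases isEmpty_or_nonempty (Fin M.N) with he | ⟨⟨i⟩⟩
  · have h1 := h.one_le_gap
    rw [CoarseMesh.gap, Real.iInf_of_isEmpty] at h1
    norm_num at h1
  · exact M.size_pos i

omit h in
theorem poincareConst_nonneg : 0 ≤ M.poincareConst := Real.sInf_nonneg fun _ hC => hC.1

theorem normS_eq (u : P.V) : M.normS (P.val u) = √(h.system.sTot u u) := by
  rw [M.normS_val, h.system.sTot_apply]; rfl

theorem sqrt_sTot_le (u : P.V) : √(h.system.sTot u u) ≤
    M.poincareConst * M.size⁻¹ * h.system.nA u := by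
  have h1 := h.system.sqrt_sTot_le h.size_pos u
  simp only [← h.normS_eq, h.nA_eq] at h1 ⊢
  exact h1

end Setting

/-- The load functional `w ↦ ∫_Ω f w`. -/
noncomputable def loadL {P : Problem} {f : E2 → ℝ} (hf : MemLp f 2 (volume.restrict P.Ω)) :
    P.V →ₗ[ℝ] ℝ where
  toFun w := ∫ p in P.Ω, f p * P.val w p
  map_add' u w := by
    rw [← integral_add (integrable_mul_test hf ((CoarseMesh.memLp_val u).restrict _))
      (integrable_mul_test hf ((CoarseMesh.memLp_val w).restrict _))]
    refine integral_congr_ae ?_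
    filter_upwards [ae_restrict_of_ae (Lp.coeFn_add (u : L2Pair volume).fst
      (w : L2Pair volume).fst)] with p hp
    have : P.val (u + w) p = P.val u p + P.val w p := hp
    rw [this, mul_add]
  map_smul' c u := by
    rw [RingHom.id_apply, smul_eq_mul, ← integral_const_mul]
    refine integral_congr_ae ?_
    filter_upwards [ae_restrict_of_ae (Lp.coeFn_smul c (u : L2Pair volume).fst)] with p hp
    have : P.val (c • u) p = c * P.val u p := hp
    rw [this]; ring

namespace LocalizedSystem

variable {V ι κ : Type*} [NormedAddCommGroup V] [InnerProductSpace ℝ V]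
  [Fintype ι] [Fintype κ] [DecidableEq ι] {q τ Λ Cl Col : ℝ} {S : LocalizedSystem V ι κ q τ Λ Cl Col}

/-! ### Stability and quasi-optimality of the localized method -/

/-- The relative error of the localized functions in the energy norm is `ε = t x`, where `x = 1 + y`
compares the two norms. The estimates need `100 x² ε ≤ η`, which explains the third power of `x`. -/
theorem infSup_and_cea (hq0 : 0 ≤ q) (hq : q < 1) (hτ0 : 0 ≤ τ) (hτ : τ ≤ (1 - q) / 16)
    (hCol : 0 ≤ Col) {m : ℕ} (hm : 1 ≤ m) {φ ψ : ι → κ → V} (hφ : S.IsGlo φ) (hψ : S.IsLoc m ψ)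
    {α η β y C : ℝ} (hy : 0 ≤ y) (hyS : ∀ u, √(S.sTot u u) ≤ y * S.nA u) (hC : 0 ≤ C)
    (hω : ∀ j, S.ω j ≤ C * Λ) (hα : 1 ≤ α) (hαC : 1 + C * √Λ * y ≤ α)
    (hη : 100 * locConst q Cl Col * (1 + y) ^ 3 * ((m : ℝ) + 1) * √(rate q ^ (m - 1)) ≤ η)
    (hβ : 0 < β / 4 - 9 * α * η / 4 - 3 * α * η / 2)
    (hker : S.InfSup (S.ker : Set V) β) (hglo : S.InfSup (LinearMap.range (comb φ) : Set V) β) :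
    S.InfSup (LinearMap.range (comb ψ) : Set V) (β / 4 - 9 * α * η / 4 - 3 * α * η / 2) ∧
    ∀ F : V →ₗ[ℝ] ℝ,
      (∃! u, u ∈ LinearMap.range (comb ψ) ∧ ∀ w ∈ LinearMap.range (comb ψ), S.b u w = F w) ∧
      ∀ u z, (∀ w, S.b u w = F w) → z ∈ LinearMap.range (comb ψ) →
        (∀ w ∈ LinearMap.range (comb ψ), S.b z w = F w) → ∀ v ∈ LinearMap.range (comb ψ),
        S.nA (u - z) ≤ α / (β / 4 - 9 * α * η / 4 - 3 * α * η / 2) * S.nA (u - v) := by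
  set x := 1 + y with hx
  set t := locConst q Cl Col * ((m : ℝ) + 1) * √(rate q ^ (m - 1)) with ht
  have ht0 : 0 ≤ t := by
    have : 0 ≤ locConst q Cl Col := Real.sqrt_nonneg _
    positivity
  have hx1 : 1 ≤ x := by linarith
  have hnE : ∀ u, S.nE u ≤ x * S.nA u := fun u => S.nE_le_of_sTot_le hy (hyS u)
  have hclose : ∀ c, S.nE (comb φ c - comb ψ c) ≤ t * x * S.nA (comb φ c) := fun c => by
    refine (nE_comb_sub_le hq0 hq hτ0 hτ hCol hm hφ hψ c).trans ?_
    rw [mul_assoc t]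
    exact mul_le_mul_of_nonneg_left (hnE _) ht0
  have hε : 0 ≤ t * x := mul_nonneg ht0 (by linarith)
  have hη' : 100 * x ^ 2 * (t * x) ≤ η := le_trans (le_of_eq (by rw [ht]; ring)) hη
  have hI := infSup_range_of_close hq hφ hx1 hα hε hη' hβ hnE hker hglo hclose
  refine ⟨hI, fun F => ⟨hI.existsUnique hβ F, fun u z hu hz hzF v hv => ?_⟩⟩
  have hαb : ∀ u, ∀ w ∈ S.ker, |S.b u w| ≤ α * S.nA u * S.nA w := fun u w hw => by
    have hyu : S.sTot u u ≤ y ^ 2 * S.aTot u u := by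
      have := pow_le_pow_left₀ (Real.sqrt_nonneg _) (hyS u) 2
      rwa [mul_pow, S.nA_sq, Real.sq_sqrt (S.sTot_nonneg u)] at this
    refine (S.abs_b_le_of_mem_ker hC hω hy hyu hw).trans ?_
    exact mul_le_mul_of_nonneg_right (mul_le_mul_of_nonneg_right hαC (S.nA_nonneg u))
      (S.nA_nonneg w)
  have h1 := cea_of_close hq hφ hx1 hα hε hη' hβ hnE hker hglo hclose hαb (e := u - z)
    (z := z - v) (fun w hw => by rw [map_sub, LinearMap.sub_apply, hu, hzF w hw, sub_self])
    (Submodule.sub_mem _ hz hv)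
  rwa [sub_add_sub_cancel] at h1

end LocalizedSystem

/-! ### Choice of the constants -/

theorem one_le_constOne (R₀ Υ : ℝ) : 1 ≤ constOne R₀ Υ :=
  le_max_of_le_right (Real.one_le_sqrt.2 one_le_two)

/-- A choice of the constants: `τ` is small compared with `1 - q` and the bound `Cl` of the
liftings, and `Υ` is large compared with `τ` and the bounds of the reflection. -/
theorem exists_constants {q Cl : ℝ} (hq : q < 1) (b : ℝ) :
    ∃ τ Υ : ℝ, 0 ≤ τ ∧ 0 < Υ ∧ τ ≤ (1 - q) / 16 ∧
      (2 * Cl ^ 2 + 1) * (4 * τ ^ 2) ≤ ((1 - q) / 4 / 4) ^ 2 ∧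
      ∀ r Υ', |r| ≤ b → Υ ≤ Υ' → r ^ 2 / Υ' ≤ τ ^ 2 := by
  obtain ⟨D, hD⟩ : ∃ D, D = 2 * Cl ^ 2 + 1 := ⟨_, rfl⟩
  have hD1 : 1 ≤ D := by rw [hD]; linarith [sq_nonneg Cl]
  obtain ⟨g, hg⟩ : ∃ g, g = (1 - q) / 16 := ⟨_, rfl⟩
  have hg0 : 0 < g := by rw [hg]; linarith
  have hτ0 : 0 < g / (2 * D) := by positivity
  have hΥ : 0 < (|b| + 1) ^ 2 / (g / (2 * D)) ^ 2 := by positivity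
  refine ⟨g / (2 * D), (|b| + 1) ^ 2 / (g / (2 * D)) ^ 2, hτ0.le, hΥ, ?_, ?_, fun r Υ' hr hΥ' => ?_⟩
  · rw [← hg]; exact div_le_self hg0.le (by linarith)
  · have e : (1 - q) / 4 / 4 = g := by rw [hg]; ring
    have e2 : D * (4 * (g / (2 * D)) ^ 2) = g ^ 2 / D := by field_simp; ring
    rw [← hD, e, e2]
    exact div_le_self (sq_nonneg g) hD1
  · rw [div_le_iff₀ (hΥ.trans_le hΥ')]
    rw [div_le_iff₀ (by positivity)] at hΥ'
    have := pow_le_pow_left₀ (abs_nonneg r) (hr.trans ((le_abs_self b).trans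
      (le_add_of_nonneg_right zero_le_one))) 2
    rw [sq_abs] at this
    linarith

namespace Setting

variable {P : Problem} {M : CoarseMesh P} {l : ℕ} {A : AuxBasis M l} {R₀ R₁ : ℝ}
  {R : Reflection P R₀ R₁} {Q : Patches M} {q τ Cl Col : ℝ} (h : Setting A R Q q τ Cl Col)

include h

theorem infSup_kernel : P.infSup A.kernel = h.system.infSup (h.system.ker : Set P.V) :=
  (h.infSup_eq _).trans (congrArg _ h.kernel_eq)

theorem infSup_of_eq {X Y : Submodule ℝ P.V} (hXY : X = Y) :
    P.infSup (X : Set P.V) = h.system.infSup (Y : Set P.V) := by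
  rw [hXY]; exact h.infSup_eq _

/-- The constant for the kernel is explicit; the one for the span of the global functions comes from
its finite dimension and the well-posedness of the problem. -/
theorem exists_le_infSup (hq0 : 0 ≤ q) (hq : q < 1) (hτ0 : 0 ≤ τ) (hτ : τ ≤ (1 - q) / 16)
    (hτ2 : (2 * Cl ^ 2 + 1) * (4 * τ ^ 2) ≤ ((1 - q) / 4 / 4) ^ 2) (hwp : P.WellPosed) :
    ∃ β : ℝ, 0 < β ∧ (β : EReal) ≤ P.infSup A.kernel ∧
      (β : EReal) ≤ P.infSup (A.Vglo : Set P.V) := by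
  obtain ⟨φ, hφ, hV⟩ := h.exists_global hq0 hq hτ0 hτ
  have h1 := h.system.infSup_ker hq0 hq hτ0 hτ hτ2
  have h0 : 0 < (1 - q) / 4 / 6 := by linarith
  have hwp' : ∀ u, (∀ w, h.system.b u w = 0) → u = 0 := fun u hu =>
    hwp u fun w => (h.b_eq u w).symm.trans (hu w)
  obtain ⟨β, hβ, h2⟩ := hφ.exists_infSup_range hq h0 h1 hwp'
  refine ⟨min ((1 - q) / 4 / 6) β, lt_min h0 hβ, ?_, ?_⟩
  · have h3 := LocalizedSystem.le_infSup h0 h1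
    exact (EReal.coe_le_coe_iff.2 (min_le_left _ _)).trans (h3.trans_eq h.infSup_kernel.symm)
  · have h3 := LocalizedSystem.le_infSup hβ h2
    exact (EReal.coe_le_coe_iff.2 (min_le_right _ _)).trans (h3.trans_eq (h.infSup_of_eq hV).symm)

theorem isMsSolution_iff {m : ℕ} {X : Submodule ℝ P.V} (hX : Q.Vms A m = X) {f : E2 → ℝ}
    (hf : MemLp f 2 (volume.restrict P.Ω)) (u : P.V) : Q.IsMsSolution A m f u ↔
      u ∈ X ∧ ∀ w ∈ X, h.system.b u w = loadL hf w := by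
  subst hX
  exact and_congr_right fun _ => forall₂_congr fun w _ => by rw [h.b_eq]; rfl

/-- The abstract result, translated to the forms and the spaces of the problem on the mesh. -/
theorem infSup_and_cea (hq0 : 0 ≤ q) (hq : q < 1) (hτ0 : 0 ≤ τ) (hτ : τ ≤ (1 - q) / 16)
    (hCol : 0 ≤ Col) {m : ℕ} (hm : 1 ≤ m) {α η β C : ℝ} (hC : 0 ≤ C)
    (hω : ∀ j, M.ratio j ≤ C * M.gap l) (hα : 1 ≤ α)
    (hαC : 1 + C * √(M.gap l) * (M.poincareConst * M.size⁻¹) ≤ α)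
    (hη : 100 * LocalizedSystem.locConst q Cl Col * (1 + M.poincareConst * M.size⁻¹) ^ 3 *
      ((m : ℝ) + 1) * √(LocalizedSystem.rate q ^ (m - 1)) ≤ η)
    (hβ : 0 < β / 4 - 9 * α * η / 4 - 3 * α * η / 2)
    (hker : (β : EReal) ≤ P.infSup A.kernel) (hglo : (β : EReal) ≤ P.infSup (A.Vglo : Set P.V)) :
    ((β / 4 - 9 * α * η / 4 - 3 * α * η / 2 : ℝ) : EReal) ≤ P.infSup (Q.Vms A m : Set P.V) ∧
    ∀ f : E2 → ℝ, MemLp f 2 (volume.restrict P.Ω) →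
      (∃! u : P.V, Q.IsMsSolution A m f u) ∧
      ∀ u z : P.V, P.IsSolution f u → Q.IsMsSolution A m f z → ∀ v ∈ Q.Vms A m,
        P.normA (u - z) ≤ α / (β / 4 - 9 * α * η / 4 - 3 * α * η / 2) * P.normA (u - v) := by
  obtain ⟨φ, hφ, hV⟩ := h.exists_global hq0 hq hτ0 hτ
  obtain ⟨ψ, hψ, hW⟩ := h.exists_local hq0 hq hτ0 hτ hm
  have hker' := hker.trans_eq h.infSup_kernel
  have hglo' := hglo.trans_eq (h.infSup_of_eq hV)
  have hy : 0 ≤ M.poincareConst * M.size⁻¹ :=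
    mul_nonneg poincareConst_nonneg (inv_nonneg.2 h.size_pos.le)
  obtain ⟨h1, h2⟩ := LocalizedSystem.infSup_and_cea hq0 hq hτ0 hτ hCol hm hφ hψ hy h.sqrt_sTot_le
    hC hω hα hαC hη hβ (LocalizedSystem.infSup_of_le hker') (LocalizedSystem.infSup_of_le hglo')
  refine ⟨?_, fun f hf => ⟨?_, fun u z hu hz v hv => ?_⟩⟩
  · exact (LocalizedSystem.le_infSup hβ h1).trans_eq (h.infSup_of_eq hW).symm
  · exact (existsUnique_congr fun u => (h.isMsSolution_iff hW hf u).symm).1 (h2 (loadL hf)).1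
  · have hz' := (h.isMsSolution_iff hW hf z).1 hz
    have hu' : ∀ w, h.system.b u w = loadL hf w := fun w => (h.b_eq u w).trans (hu w)
    rw [hW] at hv
    have h3 := (h2 (loadL hf)).2 u z hu' hz'.1 hz'.2 v hv
    exact (h.nA_eq (u - z)).symm.le.trans (h3.trans_eq (congrArg _ (h.nA_eq (u - v))))

/-- The localization error in the form in which it enters the estimates. -/
theorem le_locError {C : ℝ} (hC : 100 * LocalizedSystem.locConst q Cl Col ≤ C) {m : ℕ}
    (hm : 1 ≤ m) : 100 * LocalizedSystem.locConst q Cl Col *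
      (1 + M.poincareConst * M.size⁻¹) ^ 3 * ((m : ℝ) + 1) * √(LocalizedSystem.rate q ^ (m - 1)) ≤
      locError M C (LocalizedSystem.rate q) m := by
  have hy : 0 ≤ M.poincareConst * M.size⁻¹ :=
    mul_nonneg poincareConst_nonneg (inv_nonneg.2 h.size_pos.le)
  have hr := LocalizedSystem.rate_pos q
  have e : LocalizedSystem.rate q ^ (((m : ℝ) - 1) / 2) = √(LocalizedSystem.rate q ^ (m - 1)) := by
    rw [Real.sqrt_eq_rpow, ← Real.rpow_natCast, ← Real.rpow_mul hr.le, Nat.cast_sub hm]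
    congr 1
    push_cast
    ring
  rw [locError, e]
  gcongr

end Setting

end SignChanging

theorem mainTheorem2 (R₀ R₁ ρ Cmsh Col Cinv q : ℝ)
    (hR₀ : 0 ≤ R₀) (hR₁ : 0 ≤ R₁) (hCmsh : 0 < Cmsh) (hq : q < 1) :
    ∃ Υ' Cloc θ : ℝ, 0 < Υ' ∧ 0 < Cloc ∧ 0 < θ ∧ θ < 1 ∧
      ∀ (P : SignChanging.Problem) (M : SignChanging.CoarseMesh P) (l : ℕ)
        (A : SignChanging.AuxBasis M l) (R : SignChanging.Reflection P R₀ R₁)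
        (Q : SignChanging.Patches M) (Cstar : ℝ),
        M.QuasiUniform ρ → Q.Admissible R Cmsh → Q.Overlap Col →
        1 ≤ P.κ * M.μmsh * Cmsh ^ 2 →
        A.inverseConst ≤ Cinv →
        Υ' ≤ P.contrast → 1 ≤ M.gap l →
        0 < Cstar → Cstar * M.gap l ≤ q →
        SignChanging.constOne R₀ P.contrast * M.μmsh⁻¹ * P.k ^ 2 * M.size ^ 2
          ≤ Cstar * M.gap l →
        P.WellPosed →
        -- the global and the localized basis functions are well defined
        (∀ i j, ∃! φ : P.V, A.IsGlobalBasis i j φ) ∧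
        (∀ m, 1 ≤ m → ∀ i j, ∃! φ : P.V, Q.IsLocalBasis A m i j φ) ∧
        -- the global inf-sup condition
        (∃ βglo : ℝ, 0 < βglo ∧ (βglo : EReal) ≤ P.infSup A.kernel ∧
          (βglo : EReal) ≤ P.infSup (A.Vglo : Set P.V)) ∧
        -- the localized inf-sup condition and the quasi-optimality
        ∀ (βglo : ℝ), (βglo : EReal) ≤ P.infSup A.kernel →
          (βglo : EReal) ≤ P.infSup (A.Vglo : Set P.V) →
          ∀ (m : ℕ) (α η βcem : ℝ), 1 ≤ m →
            α = M.alpha (SignChanging.constOne R₀ P.contrast) Cstar l →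
            η = SignChanging.locError M Cloc θ m →
            βcem = βglo / 4 - 9 * α * η / 4 - 3 * α * η / 2 →
            0 < βcem →
            (βcem : EReal) ≤ P.infSup (Q.Vms A m : Set P.V) ∧
            ∀ f : SignChanging.E2 → ℝ, MeasureTheory.MemLp f 2 (MeasureTheory.volume.restrict P.Ω) →
              (∃! ums : P.V, Q.IsMsSolution A m f ums) ∧
              ∀ u ums : P.V, P.IsSolution f u → Q.IsMsSolution A m f ums →
                ∀ vms ∈ Q.Vms A m,
                  P.normA (u - ums) ≤ α / βcem * P.normA (u - vms) := by
  -- The given numbers may be negative and are replaced by nonnegative bounds. The bound for the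
  -- liftings is raised by one, since the infimum of the admissible constants need not be attained.
  have hq0 : 0 ≤ max q 0 := le_max_right q 0
  have hq1 : max q 0 < 1 := max_lt hq one_pos
  obtain ⟨τ, Υ', hτ0, hΥ', hτ, hτ2, hb⟩ := SignChanging.exists_constants (Cl := max Cinv 0 + 1)
    hq1 (R₁ + |ρ| * R₀)
  refine ⟨Υ', 100 * SignChanging.LocalizedSystem.locConst (max q 0) (max Cinv 0 + 1) |Col| + 1,
    SignChanging.LocalizedSystem.rate (max q 0), hΥ', ?_,
    SignChanging.LocalizedSystem.rate_pos _, SignChanging.LocalizedSystem.rate_lt_one hq1, ?_⟩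
  · have : 0 ≤ SignChanging.LocalizedSystem.locConst (max q 0) (max Cinv 0 + 1) |Col| :=
      Real.sqrt_nonneg _
    linarith
  intro P M l A R Q Cstar hρ hQ hO hμ hinv hc hgap hCs hCq hres hwp
  have hρR : 0 ≤ |ρ| * R₀ := mul_nonneg (abs_nonneg ρ) hR₀
  have hratio : ∀ i, M.ratio i ≤ Cstar * M.gap l := fun i => by
    refine (M.ratio_le i).trans (le_trans ?_ hres)
    have h1 : 0 ≤ M.μmsh⁻¹ * P.k ^ 2 * M.size ^ 2 := by
      have := M.μmsh_pos.le
      positivity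
    have := mul_le_mul_of_nonneg_right (SignChanging.one_le_constOne R₀ P.contrast) h1
    linarith
  have hS : SignChanging.Setting A R Q (max q 0) τ (max Cinv 0 + 1) |Col| :=
    { ratio_le := fun i => (hratio i).trans (hCq.trans (le_max_left q 0))
      one_le_gap := hgap
      contrast_pos := hΥ'.trans_le hc
      bound_one := hb R₁ _ (by rw [abs_of_nonneg hR₁]; linarith) hc
      bound_zero := ⟨ρ, hρ, hb _ _ (by rw [abs_mul, abs_of_nonneg hR₀]; linarith) hc⟩
      admissible := ⟨Cmsh, hCmsh, hμ, hQ⟩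
      overlap := fun j m hm => (hO j m hm).trans
        (mul_le_mul_of_nonneg_right (le_abs_self Col) (sq_nonneg _))
      isInverseConst := A.isInverseConst_of_lt
        (hinv.trans_lt (lt_of_le_of_lt (le_max_left Cinv 0) (lt_add_one _))) }
  refine ⟨hS.existsUnique_global hq0 hq1 hτ0 hτ,
    fun m hm => hS.existsUnique_local hq0 hq1 hτ0 hτ hm,
    hS.exists_le_infSup hq0 hq1 hτ0 hτ hτ2 hwp, ?_⟩
  intro β hker hglo m α η βcem hm hα hη hβ hβ0
  have hα1 : 1 + Cstar * √(M.gap l) * (M.poincareConst * M.size⁻¹) ≤ α := by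
    rw [hα, SignChanging.CoarseMesh.alpha]
    linarith [SignChanging.one_le_constOne R₀ P.contrast]
  have hy : 0 ≤ M.poincareConst * M.size⁻¹ :=
    mul_nonneg SignChanging.Setting.poincareConst_nonneg (inv_nonneg.2 hS.size_pos.le)
  have hα0 : 1 ≤ α := le_trans (le_add_of_nonneg_right
    (mul_nonneg (mul_nonneg hCs.le (Real.sqrt_nonneg _)) hy)) hα1
  have hη' := hS.le_locError (le_add_of_nonneg_right zero_le_one) hm
  rw [← hη] at hη'
  subst hβ
  exact hS.infSup_and_cea hq0 hq1 hτ0 hτ (abs_nonneg Col) hm hCs.le hratio hα0 hα1 hη' hβ0 hker hglo
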